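/- **Solving $k$-th order ODEs whose solution is close to a piecewise polynomial.** There are absolute constants $K,p$ and a single real-RAM algorithm with the following property. (The machine has an integer memory and a real memory with indirect addressing; integer $+,-,\times$, real $+,-,\times,/,\sqrt{\cdot}$, memory accesses and comparisons cost one time step each; $F$ is accessed through an evaluation oracle. One evaluation of $F$ counts as one evaluation, and is charged the time of reading its argument and writing its value.) Let $k,d,n\ge 1$, let $\|\cdot\|$ be any norm on $\mathbb R^d$, let $F:(\mathbb R^d)^k\times\mathbb R\to\mathbb R^d$, let $v_0,\dots,v_{k-1}\in\mathbb R^d$, let $0=T_0<T_1<\dots<T_n=T$, let $D_1,\dots,D_n\ge 0$ be integers, and let $\epsilon>0$. Let $x^*:[0,T]\to\mathbb R^d$ be a solution of $$\frac{d^k}{dt^k}x(t)=F\Big(\frac{d^{k-1}}{dt^{k-1}}x(t),\dots,\frac{d}{dt}x(t),x(t),t\Big)\ (0\le t\le T),\qquad \frac{d^i}{dt^i}x(0)=v_i\quad(0\le i<k).$$ Suppose that 1. there are polynomials $q_j$ of degree at most $D_j$ ($1\le j\le n$) with coefficients in $\mathbb R^d$ such that $\big\|q_j(t)-\frac{d^k}{dt^k}x^*(t)\big\|\le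 \epsilon/T^k$ for all $t\in(T_{j-1},T_j)$; 2. there are $L_1,\dots,L_k\ge 0$ such that $\|F(y_1,\dots,y_k,t)-F(z_1,\dots,z_k,t)\|\le\sum_{i=1}^k L_i\|y_i-z_i\|$ for all $y_i,z_i\in\mathbb R^d$ and $t\in[0,T]$; 3. $LT\le 1/16000$, where $L=\sum_{i=1}^k L_i^{1/i}$. Put $C=T^{k-1}\int_0^T\|F(v_{k-1},\dots,v_0,s)\|\,ds+\sum_{i=1}^{k-1}T^i\|v_i\|$ (a lower Lebesgue integral, if the integrand is not measurable), and let $N\ge 0$ be any integer with $2^N\epsilon\ge C$. Then the algorithm, given $k,d,n,N$, the $D_j$, the $T_j$, the coordinates of the $v_i$, and oracle access to $F$, outputs polynomials $x_1,\dots,x_n$ with coefficients in $\mathbb R^d$ ($x_j$ by at most $K(k+D_j)$ coefficients in the Chebyshev basis of $[T_{j-1},T_j]$) such that for all $1\le j\le n$ and $0\le i<k$ $$\max_{t\in[T_{j-1},T_j]}\Big\|\frac{d^i}{dt^i}x_j(t)-\frac{d^i}{dt^i}x^*(t)\Big\|\le K\,\frac{\epsilon}{T^i};$$ in particular ($i=0$)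 the piecewise polynomial with pieces $x_j$ is within $K\epsilon$ of $x^*$ in sup norm. It uses at most $K(N+1)\sum_{j=1}^n(1+D_j)$ evaluations of $F$ and at most $K(N+1)\,f\log^p(2+f)$ time, where $f=kd\sum_{j=1}^n(k+D_j)$. For $k=1$: $F$ is $L$-Lipschitz in its first argument, $LT\le 1/16000$, $\frac{d}{dt}x^*$ is within $\epsilon/T$ of the known-degree piecewise polynomial, and with $N=\lceil\log_2(1+C/\epsilon)\rceil$, $C=\int_0^T\|F(v_0,s)\|\,ds$, one gets $O(\epsilon)$ accuracy with $O\big(\sum_j(1+D_j)\cdot\log(2+C/\epsilon)\big)$ evaluations and $\widetilde O\big(d\sum_j(1+D_j)\big)\cdot O(\log(2+C/\epsilon))$ time. -/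

import Mathlib

open Set MeasureTheory

/-! ## A real RAM with an oracle

The machine has finitely many named integer registers (a program mentions only finitely many of
them), an integer memory and a real memory, both addressed indirectly.  A program is a fixed finite
text; it is the same for all inputs.  Every arithmetic operation, memory access and test takes one
time step.  The only control structures are branching and bounded loops, so every program halts. -/

namespace RealRAM

/-- Integer expressions. -/
inductive IExp : Type
  | const (c : ℕ) : IExp
  | reg (r : ℕ) : IExp
  | mem (a : IExp) : IExp
  | add (a b : IExp) : IExp
  | sub (a b : IExp) : IExp
  | mul (a b : IExp) : IExp

/-- Real expressions: rational constants, conversion of integers, memory access, the four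
arithmetic operations and the square root. -/
inductive RExp : Type
  | const (c : ℚ) : RExp
  | ofInt (a : IExp) : RExp
  | mem (a : IExp) : RExp
  | add (x y : RExp) : RExp
  | sub (x y : RExp) : RExp
  | mul (x y : RExp) : RExp
  | div (x y : RExp) : RExp
  | sqrt (x : RExp) : RExp

/-- Programs. -/
inductive Prog : Type
  /-- do nothing -/
  | skip : Prog
  /-- store an integer in a register -/
  | setReg (r : ℕ) (e : IExp) : Prog
  /-- store an integer in the integer memory at address `a` -/
  | setInt (a e : IExp) : Prog
  /-- store a real in the real memory at address `a` -/
  | setReal (a : IExp) (e : RExp) : Prog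
  /-- evaluate the oracle at the block of reals starting at address `a`, and store the
  resulting block of reals starting at address `b` -/
  | call (a b : IExp) : Prog
  /-- sequential composition -/
  | seq (P Q : Prog) : Prog
  /-- `if a ≤ b then P else Q` for integers -/
  | ifInt (a b : IExp) (P Q : Prog) : Prog
  /-- `if x ≤ y then P else Q` for reals -/
  | ifReal (x y : RExp) (P Q : Prog) : Prog
  /-- `for r = 0, …, e - 1 do P`; the bound `e` is evaluated once, on entry -/
  | loop (r : ℕ) (e : IExp) (P : Prog) : Prog

/-- The state of the machine, with the number of time steps and of oracle calls made so far. -/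
structure State : Type where
  regs : ℕ → ℕ
  ints : ℕ → ℕ
  reals : ℕ → ℝ
  time : ℕ
  evals : ℕ

/-- An oracle maps a block of `inSize` reals to a block of `outSize` reals. -/
structure Oracle : Type where
  inSize : ℕ
  outSize : ℕ
  eval : (Fin inSize → ℝ) → Fin outSize → ℝ

/-- Value of an integer expression (`sub` is truncated subtraction). -/
def IExp.val (s : State) : IExp → ℕ
  | .const c => c
  | .reg r => s.regs r
  | .mem a => s.ints (a.val s)
  | .add a b => a.val s + b.val s
  | .sub a b => a.val s - b.val s
  | .mul a b => a.val s * b.val s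

/-- Number of time steps for evaluating an integer expression. -/
def IExp.cost : IExp → ℕ
  | .const _ => 1
  | .reg _ => 1
  | .mem a => a.cost + 1
  | .add a b => a.cost + b.cost + 1
  | .sub a b => a.cost + b.cost + 1
  | .mul a b => a.cost + b.cost + 1

/-- Value of a real expression. -/
noncomputable def RExp.val (s : State) : RExp → ℝ
  | .const c => (c : ℝ)
  | .ofInt a => (a.val s : ℝ)
  | .mem a => s.reals (a.val s)
  | .add x y => x.val s + y.val s
  | .sub x y => x.val s - y.val s
  | .mul x y => x.val s * y.val s
  | .div x y => x.val s / y.val s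
  | .sqrt x => Real.sqrt (x.val s)

/-- Number of time steps for evaluating a real expression. -/
def RExp.cost : RExp → ℕ
  | .const _ => 1
  | .ofInt a => a.cost + 1
  | .mem a => a.cost + 1
  | .add x y => x.cost + y.cost + 1
  | .sub x y => x.cost + y.cost + 1
  | .mul x y => x.cost + y.cost + 1
  | .div x y => x.cost + y.cost + 1
  | .sqrt x => x.cost + 1

/-- Let `m` time steps pass. -/
def State.tick (s : State) (m : ℕ) : State := { s with time := s.time + m }

/-- The effect of one oracle call.  It counts as one evaluation, and its time is that of reading
its argument and writing its value. -/
def State.callOracle (O : Oracle) (s : State) (a b : ℕ) : State :=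
  { s with
    reals := fun i =>
      if h : b ≤ i ∧ i - b < O.outSize then
        O.eval (fun l => s.reals (a + (l : ℕ))) ⟨i - b, h.2⟩
      else s.reals i
    time := s.time + (O.inSize + O.outSize + 1)
    evals := s.evals + 1 }

open Classical in
/-- Execution of a program. -/
noncomputable def Prog.run (O : Oracle) : Prog → State → State
  | .skip, s => s
  | .setReg r e, s =>
      { s.tick (e.cost + 1) with regs := Function.update s.regs r (e.val s) }
  | .setInt a e, s =>
      { s.tick (a.cost + e.cost + 1) with ints := Function.update s.ints (a.val s) (e.val s) }
  | .setReal a e, s =>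
      { s.tick (a.cost + e.cost + 1) with reals := Function.update s.reals (a.val s) (e.val s) }
  | .call a b, s => (s.tick (a.cost + b.cost)).callOracle O (a.val s) (b.val s)
  | .seq P Q, s => Q.run O (P.run O s)
  | .ifInt a b P Q, s =>
      if a.val s ≤ b.val s then P.run O (s.tick (a.cost + b.cost + 1))
      else Q.run O (s.tick (a.cost + b.cost + 1))
  | .ifReal x y P Q, s =>
      if x.val s ≤ y.val s then P.run O (s.tick (x.cost + y.cost + 1))
      else Q.run O (s.tick (x.cost + y.cost + 1))
  | .loop r e P, s =>
      (List.range (e.val s)).foldl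
        (fun s' i => P.run O { s'.tick 1 with regs := Function.update s'.regs r i })
        (s.tick (e.cost + 1))

end RealRAM

/-! ## Ordinary differential equations of order `k` -/

section ODE

variable {E : Type*} [NormedAddCommGroup E] [NormedSpace ℝ E]

/-- `x` solves `x⁽ᵏ⁾(t) = F((x(t), x'(t), …, x⁽ᵏ⁻¹⁾(t)), t)` on `[0, T]` with initial values
`x⁽ⁱ⁾(0) = v i` for `i < k`.  The argument with index `i` of `F` is the `i`-th derivative. -/
structure IsODESolution {k : ℕ} (F : (Fin k → E) → ℝ → E) (v : Fin k → E) (T : ℝ)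
    (x : ℝ → E) : Prop where
  differentiableOn : ∀ i < k,
    DifferentiableOn ℝ (iteratedDerivWithin i x (Icc 0 T)) (Icc 0 T)
  ode : ∀ t ∈ Icc 0 T, iteratedDerivWithin k x (Icc 0 T) t =
    F (fun i => iteratedDerivWithin (i : ℕ) x (Icc 0 T) t) t
  initial : ∀ i : Fin k, iteratedDerivWithin (i : ℕ) x (Icc 0 T) 0 = v i

/-! ## Input and output of an ODE solver

Vectors of the `d`-dimensional space `E` are given to the machine by their coordinates with respect
to a basis `e`. -/

/-- The vector whose coordinates are the `d` reals stored from address `a` on. -/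
noncomputable def vecAt {d : ℕ} (e : Module.Basis (Fin d) ℝ E) (r : ℕ → ℝ) (a : ℕ) : E :=
  ∑ c : Fin d, r (a + (c : ℕ)) • e c

/-- The oracle for `F`.  Its argument is the block of the `k * d` coordinates of `k` vectors
(those of the `i`-th vector start at offset `i * d`) followed by the time. -/
noncomputable def odeOracle {k d : ℕ} (e : Module.Basis (Fin d) ℝ E)
    (F : (Fin k → E) → ℝ → E) : RealRAM.Oracle where
  inSize := k * d + 1
  outSize := d
  eval u :=
    let r : ℕ → ℝ := fun i => if h : i < k * d + 1 then u ⟨i, h⟩ else 0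
    fun c => e.repr (F (fun i => vecAt e r ((i : ℕ) * d)) (r (k * d))) c

/-- The initial state.  Registers `0, 1, 2, 3` hold `k`, `d`, `n` and the number `N`; the integer
memory holds the degrees `D 0, …, D (n - 1)`; the real memory holds the breakpoints
`τ 0, …, τ n` followed by the coordinates of `v 0, …, v (k - 1)`.  All other cells are zero. -/
noncomputable def odeInput {k d n : ℕ} (e : Module.Basis (Fin d) ℝ E) (v : Fin k → E)
    (τ : Fin (n + 1) → ℝ) (D : Fin n → ℕ) (N : ℕ) : RealRAM.State where
  regs r := if r = 0 then k else if r = 1 then d else if r = 2 then n else if r = 3 then N else 0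
  ints i := if h : i < n then D ⟨i, h⟩ else 0
  reals a :=
    if h : a < n + 1 then τ ⟨a, h⟩
    else ∑ i : Fin k, ∑ c : Fin d, if a = n + 1 + ((i : ℕ) * d + (c : ℕ)) then e.repr (v i) c else 0
  time := 0
  evals := 0

/-- Number of coefficients of the `j`-th polynomial piece in a final state.  Register `0` holds the
address of a table in the integer memory, whose entries `2 * j` and `2 * j + 1` are the address of
the coefficients of the `j`-th piece and their number. -/
def outputSize (s : RealRAM.State) (j : ℕ) : ℕ := s.ints (s.regs 0 + (2 * j + 1))

/-- The `j`-th polynomial piece in a final state: its (vector-valued) coefficients refer to the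
Chebyshev polynomials `T₀, T₁, …` transported affinely from `[-1, 1]` to `[α, β]`. -/
noncomputable def outputPiece {d : ℕ} (e : Module.Basis (Fin d) ℝ E) (s : RealRAM.State)
    (α β : ℝ) (j : ℕ) (t : ℝ) : E :=
  ∑ l ∈ Finset.range (outputSize s j),
    (Polynomial.Chebyshev.T ℝ (l : ℤ)).eval ((2 * t - α - β) / (β - α)) •
      vecAt e s.reals (s.ints (s.regs 0 + 2 * j) + l * d)

end ODE

/-! The algorithm is a Picard iteration on the k-th derivative. Given a piecewise polynomial `y`, a
pass integrates it k times from the initial values, gluing across breakpoints, evaluates F along the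
resulting curve at Chebyshev nodes of every piece, and replaces `y` by a filtered interpolant of
these values.

Convergence rests on the filter, the discrete de la Vallée-Poussin kernel on M = 2m Chebyshev nodes.
It reproduces polynomials of degree at most m (`vp_exact`), and the absolute values of its weights
sum to at most 3 (`vp_abs_sum`), since it is twice a nonnegative Fejér kernel minus another one. Its
weights are real numbers, so the bound is valid for vector values in any norm. If the derivatives of
order i < k on a pass have error at most T^(k-i) δ, the Lipschitz condition gives an error of at
most δ/16000 in F, because `sum_mul_pow_le` turns the hypothesis on LT into a bound for the sum of
L_i T^(k-i). Subtracting the given polynomial, which the filter leaves fixed, bounds the error of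
the new `y` by 3(δ/16000 + η) + η with η = ε/T^k (`PicardStep.fit_close`). Integration multiplies
errors by at most T each time (`PicardStep.close_succ`). Hence the part of the error exceeding 5η is
at least halved by each pass. The iteration starts from `y` = 0, where `lintegral_deriv_le` bounds
the error by 2C in scaled form, so about log₂(C/ε) passes suffice (`picard_close`).

Each pass is quasilinear. Integration of Chebyshev expansions takes linear time
(`hasDerivAt_chebP_intCo`). Evaluation at the roots of T_M uses a remainder tree built on T_{2m} -
c' = 2 (T_m - c)(T_m + c), where c is the square root of (1 + c')/2. Reducing a Chebyshev expansion
modulo T_m ∓ c costs O(1) per coefficient (`chebP_residue`), so all M values cost O(M log M)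
operations and only square roots are needed. Interpolation runs the same tree backwards
(`residue_unresidue`).

On the machine side, `exec` forgets the clocks, and functional correctness is proved for it with
loop invariants and frames; the chain ends in `solver_spec`, which speaks of functions only. Running
time is handled separately: a syntactic bound covers programs whose loop bounds do not change while
they run (`Prog.time_le_cost`), and `Prog.Takes` combines such bounds over pieces of different sizes
(`solver_takes`). -/

/-! ## Execution without clocks -/

namespace RealRAM

/-- Update a register. -/
def State.setR (s : State) (r v : ℕ) : State := { s with regs := Function.update s.regs r v }

/-- Update a cell of the real memory. -/
noncomputable def State.setM (s : State) (a : ℕ) (v : ℝ) : State :=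
  { s with reals := Function.update s.reals a v }

/-- Update a cell of the integer memory. -/
def State.setI (s : State) (a v : ℕ) : State := { s with ints := Function.update s.ints a v }

/-- The effect of an oracle call on the real memory. -/
noncomputable def State.ask (O : Oracle) (s : State) (a b : ℕ) : State :=
  { s with reals := fun i =>
      if h : b ≤ i ∧ i - b < O.outSize then
        O.eval (fun l => s.reals (a + (l : ℕ))) ⟨i - b, h.2⟩
      else s.reals i }

open Classical in
/-- Execution of a program, ignoring time and the number of oracle calls. -/
noncomputable def Prog.exec (O : Oracle) : Prog → State → State
  | .skip, s => s
  | .setReg r e, s => s.setR r (e.val s)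
  | .setInt a e, s => s.setI (a.val s) (e.val s)
  | .setReal a e, s => s.setM (a.val s) (e.val s)
  | .call a b, s => s.ask O (a.val s) (b.val s)
  | .seq P Q, s => Q.exec O (P.exec O s)
  | .ifInt a b P Q, s => if a.val s ≤ b.val s then P.exec O s else Q.exec O s
  | .ifReal x y P Q, s => if x.val s ≤ y.val s then P.exec O s else Q.exec O s
  | .loop r e P, s =>
      (List.range (e.val s)).foldl (fun s' i => P.exec O (s'.setR r i)) s

/-- Two states with the same registers and memories. -/
def State.Same (s s' : State) : Prop :=
  s.regs = s'.regs ∧ s.ints = s'.ints ∧ s.reals = s'.reals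

theorem IExp.val_same {s s' : State} (h : s.Same s') (e : IExp) : e.val s = e.val s' := by
  obtain ⟨h1, h2, h3⟩ := h
  induction e <;> simp_all [IExp.val]

theorem RExp.val_same {s s' : State} (h : s.Same s') (e : RExp) : e.val s = e.val s' := by
  induction e <;> simp_all [RExp.val, IExp.val_same h, h.2.2]

/-- No instruction reads the clocks, so erasing them commutes with execution. This transfers every
fact about `exec` to `run`. -/
theorem Prog.run_same_exec (O : Oracle) (P : Prog) :
    ∀ s s' : State, s.Same s' → (P.run O s).Same (P.exec O s') := by
  induction P with
  | skip => intro s s' h; exact h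
  | setReg r e =>
    intro s s' h
    have := IExp.val_same h
    exact ⟨by simp [run, exec, State.tick, State.setR, this, h.1], h.2.1, h.2.2⟩
  | setInt a e =>
    intro s s' h
    have := IExp.val_same h
    exact ⟨h.1, by simp [run, exec, State.tick, State.setI, this, h.2.1], h.2.2⟩
  | setReal a e =>
    intro s s' h
    have := IExp.val_same h
    have h2 := RExp.val_same h
    exact ⟨h.1, h.2.1, by simp [run, exec, State.tick, State.setM, this, h2, h.2.2]⟩
  | call a b =>
    intro s s' h
    have := IExp.val_same h
    exact ⟨h.1, h.2.1, by
      simp [run, exec, State.tick, State.ask, State.callOracle, this, h.2.2]⟩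
  | seq P Q hP hQ => intro s s' h; exact hQ _ _ (hP _ _ h)
  | ifInt a b P Q hP hQ =>
    intro s s' h
    have := IExp.val_same h
    have h2 : (s.tick (a.cost + b.cost + 1)).Same s' := h
    simp only [run, exec, this]
    split
    · exact hP _ _ h2
    · exact hQ _ _ h2
  | ifReal a b P Q hP hQ =>
    intro s s' h
    have := RExp.val_same h
    have h2 : (s.tick (a.cost + b.cost + 1)).Same s' := h
    simp only [run, exec, this]
    split
    · exact hP _ _ h2
    · exact hQ _ _ h2
  | loop r e P hP =>
    intro s s' h
    simp only [run, exec, IExp.val_same h e]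
    generalize e.val s' = m
    have h2 : (s.tick (e.cost + 1)).Same s' := h
    revert h2
    generalize s.tick (e.cost + 1) = s1
    intro h2
    induction m with
    | zero => simpa using h2
    | succ m ih =>
      simp only [List.range_succ, List.foldl_append, List.foldl_cons, List.foldl_nil]
      apply hP
      exact ⟨congrArg (fun f => Function.update f r m) ih.1, ih.2.1, ih.2.2⟩

/-! ### Syntactic bounds for time and oracle calls -/

/-- The expression reads no memory and none of the registers in `W`. -/
def IExp.indep (W : List ℕ) : IExp → Bool
  | .const _ => true
  | .reg r => !W.contains r
  | .mem _ => false
  | .add a b => a.indep W && b.indep W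
  | .sub a b => a.indep W && b.indep W
  | .mul a b => a.indep W && b.indep W

theorem IExp.val_indep {W : List ℕ} {s s' : State} (h : ∀ r, r ∉ W → s.regs r = s'.regs r) :
    ∀ e : IExp, e.indep W = true → e.val s = e.val s'
  | .const _, _ => rfl
  | .reg r, he => h r (by simpa [indep] using he)
  | .mem _, he => by simp [indep] at he
  | .add a b, he => by
    simp only [indep, Bool.and_eq_true] at he
    simp only [val, val_indep h a he.1, val_indep h b he.2]
  | .sub a b, he => by
    simp only [indep, Bool.and_eq_true] at he
    simp only [val, val_indep h a he.1, val_indep h b he.2]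
  | .mul a b, he => by
    simp only [indep, Bool.and_eq_true] at he
    simp only [val, val_indep h a he.1, val_indep h b he.2]

/-- The program writes only the registers in `W`. -/
def Prog.wregs (W : List ℕ) : Prog → Bool
  | .setReg r _ => W.contains r
  | .seq P Q => P.wregs W && Q.wregs W
  | .ifInt _ _ P Q => P.wregs W && Q.wregs W
  | .ifReal _ _ P Q => P.wregs W && Q.wregs W
  | .loop r _ P => W.contains r && P.wregs W
  | _ => true

/-- The bounds of all loops are independent of the registers in `W`. -/
def Prog.static (W : List ℕ) : Prog → Bool
  | .seq P Q => P.static W && Q.static W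
  | .ifInt _ _ P Q => P.static W && Q.static W
  | .ifReal _ _ P Q => P.static W && Q.static W
  | .loop _ e P => e.indep W && P.static W
  | _ => true

/-- Bound for the number of time steps. -/
def Prog.cost (O : Oracle) (s : State) : Prog → ℕ
  | .skip => 0
  | .setReg _ e => e.cost + 1
  | .setInt a e => a.cost + e.cost + 1
  | .setReal a e => a.cost + e.cost + 1
  | .call a b => a.cost + b.cost + (O.inSize + O.outSize + 1)
  | .seq P Q => P.cost O s + Q.cost O s
  | .ifInt a b P Q => a.cost + b.cost + 1 + (P.cost O s + Q.cost O s)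
  | .ifReal x y P Q => x.cost + y.cost + 1 + (P.cost O s + Q.cost O s)
  | .loop _ e P => e.cost + 1 + e.val s * (1 + P.cost O s)

/-- Bound for the number of oracle calls. -/
def Prog.calls (s : State) : Prog → ℕ
  | .call _ _ => 1
  | .seq P Q => P.calls s + Q.calls s
  | .ifInt _ _ P Q => P.calls s + Q.calls s
  | .ifReal _ _ P Q => P.calls s + Q.calls s
  | .loop _ e P => e.val s * P.calls s
  | _ => 0

theorem Prog.run_regs (O : Oracle) {W : List ℕ} (P : Prog) (h : P.wregs W = true) :
    ∀ s : State, ∀ r, r ∉ W → (P.run O s).regs r = s.regs r := by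
  induction P with
  | setReg r' e =>
    intro s r hr
    have : r ≠ r' := by rintro rfl; exact hr (by simpa [wregs] using h)
    simp [run, State.tick, this]
  | seq P Q hP hQ =>
    intro s r hr
    simp only [wregs, Bool.and_eq_true] at h
    simp only [run]
    rw [hQ h.2 _ _ hr, hP h.1 _ _ hr]
  | ifInt a b P Q hP hQ =>
    intro s r hr
    simp only [wregs, Bool.and_eq_true] at h
    simp only [run]
    split
    · rw [hP h.1 _ _ hr]; rfl
    · rw [hQ h.2 _ _ hr]; rfl
  | ifReal a b P Q hP hQ =>
    intro s r hr
    simp only [wregs, Bool.and_eq_true] at h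
    simp only [run]
    split
    · rw [hP h.1 _ _ hr]; rfl
    · rw [hQ h.2 _ _ hr]; rfl
  | loop r' e P hP =>
    intro s r hr
    simp only [wregs, Bool.and_eq_true] at h
    have hne : r ≠ r' := by rintro rfl; exact hr (by simpa using h.1)
    simp only [run]
    generalize e.val s = m
    induction m with
    | zero => simp [State.tick]
    | succ m ih =>
      simp only [List.range_succ, List.foldl_append, List.foldl_cons, List.foldl_nil]
      rw [hP h.2 _ _ hr]
      simp only [State.tick, Function.update_of_ne hne]
      exact ih
  | _ => intro s r hr; simp [run, State.tick, State.callOracle]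

theorem Prog.cost_congr (O : Oracle) {W : List ℕ} {s s' : State}
    (h : ∀ r, r ∉ W → s.regs r = s'.regs r) (P : Prog) (hP : P.static W = true) :
    P.cost O s = P.cost O s' ∧ P.calls s = P.calls s' := by
  induction P with
  | seq P Q hP' hQ =>
    simp only [static, Bool.and_eq_true] at hP
    simp [cost, calls, hP' hP.1, hQ hP.2]
  | ifInt a b P Q hP' hQ =>
    simp only [static, Bool.and_eq_true] at hP
    simp [cost, calls, hP' hP.1, hQ hP.2]
  | ifReal a b P Q hP' hQ =>
    simp only [static, Bool.and_eq_true] at hP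
    simp [cost, calls, hP' hP.1, hQ hP.2]
  | loop r e P hP' =>
    simp only [static, Bool.and_eq_true] at hP
    simp [cost, calls, hP' hP.2, IExp.val_indep h e hP.1]
  | _ => simp [cost, calls]

/-- Loop bounds are built from registers outside `W`, which the program never writes. Each bound
therefore has its initial value whenever the loop is entered, even inside other loops, and the cost
can be read off in the starting state. Branches are charged for both alternatives. -/
theorem Prog.time_le_cost (O : Oracle) {W : List ℕ} (P : Prog) (hW : P.wregs W = true)
    (hS : P.static W = true) : ∀ s : State,
    (P.run O s).time ≤ s.time + P.cost O s ∧ (P.run O s).evals ≤ s.evals + P.calls s := by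
  induction P with
  | seq P Q hP hQ =>
    intro s
    simp only [wregs, static, Bool.and_eq_true] at hW hS
    have h1 := hP hW.1 hS.1 s
    have h2 := hQ hW.2 hS.2 (P.run O s)
    have h3 := Q.cost_congr O (fun r hr => P.run_regs O hW.1 s r hr) hS.2
    rw [h3.1, h3.2] at h2
    simp only [run, cost, calls]
    omega
  | ifInt a b P Q hP hQ =>
    intro s
    simp only [wregs, static, Bool.and_eq_true] at hW hS
    have h1 := hP hW.1 hS.1 (s.tick (a.cost + b.cost + 1))
    have h2 := hQ hW.2 hS.2 (s.tick (a.cost + b.cost + 1))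
    have h3 := P.cost_congr O (s := s.tick (a.cost + b.cost + 1)) (s' := s) (fun r _ => rfl) hS.1
    have h4 := Q.cost_congr O (s := s.tick (a.cost + b.cost + 1)) (s' := s) (fun r _ => rfl) hS.2
    rw [h3.1, h3.2] at h1
    rw [h4.1, h4.2] at h2
    simp only [State.tick] at h1 h2
    simp only [run, cost, calls]
    split <;> simp only [State.tick] <;> omega
  | ifReal a b P Q hP hQ =>
    intro s
    simp only [wregs, static, Bool.and_eq_true] at hW hS
    have h1 := hP hW.1 hS.1 (s.tick (a.cost + b.cost + 1))
    have h2 := hQ hW.2 hS.2 (s.tick (a.cost + b.cost + 1))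
    have h3 := P.cost_congr O (s := s.tick (a.cost + b.cost + 1)) (s' := s) (fun r _ => rfl) hS.1
    have h4 := Q.cost_congr O (s := s.tick (a.cost + b.cost + 1)) (s' := s) (fun r _ => rfl) hS.2
    rw [h3.1, h3.2] at h1
    rw [h4.1, h4.2] at h2
    simp only [State.tick] at h1 h2
    simp only [run, cost, calls]
    split <;> simp only [State.tick] <;> omega
  | loop r e P hP =>
    intro s
    have hW' := hW
    simp only [wregs, static, Bool.and_eq_true] at hW hS
    simp only [run, cost, calls]
    generalize e.val s = m
    -- The agreement of registers with the entry state is part of the invariant: it makes the cost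
    -- of the body the same in every round.
    suffices h : ∀ s1, s1 = (List.range m).foldl (fun s' i => P.run O
        { s'.tick 1 with regs := Function.update s'.regs r i }) (s.tick (e.cost + 1)) →
        (∀ r, r ∉ W → s1.regs r = s.regs r) ∧
        s1.time ≤ s.time + (e.cost + 1 + m * (1 + P.cost O s)) ∧
        s1.evals ≤ s.evals + m * P.calls s from (h _ rfl).2
    induction m with
    | zero => rintro _ rfl; simp [State.tick]
    | succ m ih =>
      rintro _ rfl
      simp only [List.range_succ, List.foldl_append, List.foldl_cons, List.foldl_nil]
      obtain ⟨i1, i2, i3⟩ := ih _ rfl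
      generalize (List.range m).foldl (fun s' i => P.run O
        { s'.tick 1 with regs := Function.update s'.regs r i }) (s.tick (e.cost + 1)) = s1 at *
      have hreg : ∀ r', r' ∉ W → (Function.update s1.regs r m) r' = s.regs r' := by
        intro r' hr'
        have hne : r' ≠ r := by rintro rfl; exact hr' (by simpa using hW.1)
        rw [Function.update_of_ne hne, i1 _ hr']
      have h1 := hP hW.2 hS.2 { s1.tick 1 with regs := Function.update s1.regs r m }
      have h3 := P.cost_congr O (s := { s1.tick 1 with regs := Function.update s1.regs r m })
        (s' := s) hreg hS.2
      rw [h3.1, h3.2] at h1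
      simp only [State.tick] at h1 i2 i3 ⊢
      refine ⟨fun r' hr' => ?_, ?_, ?_⟩
      · rw [P.run_regs O hW.2 _ _ hr']; exact hreg r' hr'
      · rw [add_mul]; omega
      · rw [add_mul]; omega
  | _ =>
    intro s
    simp only [run, cost, calls, State.tick, State.callOracle]
    constructor <;> omega

/-! ### Two-dimensional arrays of reals -/

/-- Offset of the cell `(x, y)` of array `ρ`. -/
def cell (ρ x y : ℕ) : ℕ := 16 * ((x + y) * (x + y) + x) + ρ

/-- The array number is the remainder modulo 16. For the rest, (x + y)² + x lies below (x + y + 1)²,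
so its integer square root is x + y. Two unbounded indices are thus coded by ring operations alone,
without fixing row lengths. -/
theorem cell_inj {ρ x y ρ' x' y' : ℕ} (h : ρ < 16) (h' : ρ' < 16) :
    cell ρ x y = cell ρ' x' y' ↔ ρ = ρ' ∧ x = x' ∧ y = y' := by
  constructor
  · intro e
    unfold cell at e
    have e1 : ρ = ρ' := by omega
    have e2 : (x + y) * (x + y) + x = (x' + y') * (x' + y') + x' := by omega
    have e3 : x + y = x' + y' := by
      rcases lt_trichotomy (x + y) (x' + y') with hl | hl | hl
      · nlinarith
      · exact hl
      · nlinarith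
    rw [e3] at e2
    omega
  · rintro ⟨rfl, rfl, rfl⟩; rfl

/-- The cell `(x, y)` of array `ρ`; the arrays start at the address in register `5`. -/
def State.arr (s : State) (ρ x y : ℕ) : ℝ := s.reals (s.regs 5 + cell ρ x y)

/-- Address expression for `State.arr`. -/
def cellE (ρ : ℕ) (x y : IExp) : IExp :=
  .add (.reg 5) (.add (.mul (.const 16) (.add (.mul (.add x y) (.add x y)) x)) (.const ρ))

/-- Read a cell. -/
def rd (ρ : ℕ) (x y : IExp) : RExp := .mem (cellE ρ x y)

/-- Write a cell. -/
def wr (ρ : ℕ) (x y : IExp) (e : RExp) : Prog := .setReal (cellE ρ x y) e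

theorem rd_val (s : State) (ρ : ℕ) (x y : IExp) :
    (rd ρ x y).val s = s.arr ρ (x.val s) (y.val s) := rfl

/-- The state after writing a cell. -/
noncomputable def State.setA (s : State) (ρ x y : ℕ) (v : ℝ) : State :=
  s.setM (s.regs 5 + cell ρ x y) v

theorem exec_wr (O : Oracle) (s : State) (ρ : ℕ) (x y : IExp) (e : RExp) :
    (wr ρ x y e).exec O s = s.setA ρ (x.val s) (y.val s) (e.val s) := rfl

theorem setA_regs (s : State) (ρ x y : ℕ) (v : ℝ) : (s.setA ρ x y v).regs = s.regs := rfl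
theorem setR_reals (s : State) (r v : ℕ) : (s.setR r v).reals = s.reals := rfl
theorem setR_regs (s : State) (r v r' : ℕ) :
    (s.setR r v).regs r' = if r' = r then v else s.regs r' := by
  simp [State.setR, Function.update_apply]

theorem setR_arr (s : State) {r : ℕ} (hr : r ≠ 5) (v : ℕ) : (s.setR r v).arr = s.arr := by
  funext ρ x y
  simp [State.arr, State.setR, Function.update_of_ne hr.symm]

theorem setA_arr (s : State) {ρ ρ' : ℕ} (h : ρ < 16) (h' : ρ' < 16) (x y x' y' : ℕ) (v : ℝ) :
    (s.setA ρ x y v).arr ρ' x' y' = if ρ' = ρ ∧ x' = x ∧ y' = y then v else s.arr ρ' x' y' := by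
  simp [State.arr, State.setA, State.setM, Function.update_apply, cell_inj h' h]

/-! ### Frames -/

/-- The expression is the address of a cell of one of the arrays in `A`. -/
def IExp.inArr (A : List ℕ) : IExp → Bool
  | .add (.reg 5) (.add (.mul (.const 16) _) (.const ρ)) => A.contains ρ && decide (ρ < 16)
  | _ => false

theorem IExp.inArr_val {A : List ℕ} {e : IExp} (h : e.inArr A = true) (s : State) :
    ∃ m, ∃ ρ ∈ A, ρ < 16 ∧ e.val s = s.regs 5 + (16 * m + ρ) := by
  unfold inArr at h
  split at h
  · simp only [List.contains_eq_mem, Bool.and_eq_true, decide_eq_true_eq] at h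
    exact ⟨_, _, h.1, h.2, rfl⟩
  · simp at h

/-- The program writes only the registers in `W` and the arrays in `A`, and makes no calls. -/
def Prog.chk (W A : List ℕ) : Prog → Bool
  | .skip => true
  | .setReg r _ => W.contains r
  | .setInt _ _ => false
  | .setReal a _ => a.inArr A
  | .call _ _ => false
  | .seq P Q => P.chk W A && Q.chk W A
  | .ifInt _ _ P Q => P.chk W A && Q.chk W A
  | .ifReal _ _ P Q => P.chk W A && Q.chk W A
  | .loop r _ P => W.contains r && P.chk W A

/-- The states agree outside the registers in `W` and the arrays in `A`. -/
structure Fr (W A : List ℕ) (s s' : State) : Prop where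
  regs : ∀ r, r ∉ W → s'.regs r = s.regs r
  ints : s'.ints = s.ints
  low : ∀ a < s.regs 5, s'.reals a = s.reals a
  arr : ∀ ρ < 16, ρ ∉ A → ∀ x y, s'.arr ρ x y = s.arr ρ x y

theorem Fr.refl (W A : List ℕ) (s : State) : Fr W A s s := ⟨by simp, rfl, by simp, by simp⟩

/-- Array addresses and the limit of the low memory are relative to register `5`; frames compose
only if it is fixed. -/
theorem Fr.trans {W A : List ℕ} (h5 : 5 ∉ W) {s s' s'' : State} (h : Fr W A s s')
    (h' : Fr W A s' s'') : Fr W A s s'' :=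
  ⟨fun r hr => (h'.regs r hr).trans (h.regs r hr), h'.ints.trans h.ints,
    fun a ha => (h'.low a (by rw [h.regs 5 h5]; exact ha)).trans (h.low a ha),
    fun ρ h1 h2 x y => (h'.arr ρ h1 h2 x y).trans (h.arr ρ h1 h2 x y)⟩

theorem Fr.mono {W A W' A' : List ℕ} (hW : W ⊆ W') (hA : A ⊆ A') {s s' : State}
    (h : Fr W A s s') : Fr W' A' s s' :=
  ⟨fun r hr => h.regs r fun h' => hr (hW h'), h.ints, h.low,
    fun ρ h1 h2 => h.arr ρ h1 fun h' => h2 (hA h')⟩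

theorem Fr.setR {W A : List ℕ} (h5 : 5 ∉ W) {s : State} {r : ℕ} (hr : r ∈ W) (v : ℕ) :
    Fr W A s (s.setR r v) :=
  ⟨fun r' h' => by
      rw [setR_regs, if_neg]; rintro rfl; exact h' hr, rfl, fun _ _ => rfl,
    fun ρ _ _ x y => by rw [setR_arr _ (by rintro rfl; exact h5 hr)]⟩

/-- The check is a computation on the program text, so for a concrete program the hypothesis is
closed by `rfl`. It rejects oracle calls and integer writes; those need separate arguments. -/
theorem Prog.chk_frame (O : Oracle) {W A : List ℕ} (h5 : 5 ∉ W) (P : Prog)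
    (h : P.chk W A = true) : ∀ s, Fr W A s (P.exec O s) := by
  induction P with
  | skip => intro s; exact Fr.refl _ _ _
  | setReg r e => intro s; exact Fr.setR h5 (by simpa [chk] using h) _
  | setInt a e => simp [chk] at h
  | call a e => simp [chk] at h
  | setReal a e =>
    intro s
    obtain ⟨m, ρ, hρ, hlt, hv⟩ := IExp.inArr_val (show a.inArr A = true from h) s
    refine ⟨fun _ _ => rfl, rfl, fun a' ha => ?_, fun ρ' h1 h2 x' y' => ?_⟩
    · simp only [exec, State.setM, hv]
      rw [Function.update_of_ne]; omega
    · simp only [exec, State.setM, State.arr, hv]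
      rw [Function.update_of_ne]
      have : ρ' ≠ ρ := by rintro rfl; exact h2 hρ
      unfold cell
      omega
  | seq P Q hP hQ =>
    intro s
    simp only [chk, Bool.and_eq_true] at h
    exact (hP h.1 s).trans h5 (hQ h.2 _)
  | ifInt a b P Q hP hQ =>
    intro s
    simp only [chk, Bool.and_eq_true] at h
    simp only [exec]
    split
    · exact hP h.1 s
    · exact hQ h.2 s
  | ifReal a b P Q hP hQ =>
    intro s
    simp only [chk, Bool.and_eq_true] at h
    simp only [exec]
    split
    · exact hP h.1 s
    · exact hQ h.2 s
  | loop r e P hP =>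
    intro s
    simp only [chk, Bool.and_eq_true] at h
    simp only [exec]
    generalize e.val s = m
    induction m with
    | zero => exact Fr.refl _ _ _
    | succ m ih =>
      simp only [List.range_succ, List.foldl_append, List.foldl_cons, List.foldl_nil]
      exact ih.trans h5 ((Fr.setR h5 (by simpa using h.1) m).trans h5 (hP h.2 _))

/-- Invariant rule for loops. -/
theorem exec_loop_rule (O : Oracle) {r : ℕ} {e : IExp} {P : Prog} {s : State}
    (I : ℕ → State → Prop) (h0 : I 0 s)
    (hs : ∀ i < e.val s, ∀ s', I i s' → I (i + 1) (P.exec O (s'.setR r i))) :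
    I (e.val s) ((Prog.loop r e P).exec O s) := by
  simp only [Prog.exec]
  generalize e.val s = m at *
  induction m with
  | zero => exact h0
  | succ m ih =>
    simp only [List.range_succ, List.foldl_append, List.foldl_cons, List.foldl_nil]
    exact hs _ (Nat.lt_succ_self m) _ (ih fun i hi => hs i (hi.trans (Nat.lt_succ_self m)))

/-- Invariant rule for loops, with frames. -/
theorem exec_loop_frame (O : Oracle) (W A : List ℕ) {r : ℕ} {e : IExp} {P : Prog} {s : State}
    (h5 : 5 ∉ W) (hr : r ∈ W) (hP : P.chk W A = true)
    (I : ℕ → State → Prop) (h0 : I 0 s)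
    (hs : ∀ i < e.val s, ∀ s', Fr W A s s' → I i s' → I (i + 1) (P.exec O (s'.setR r i))) :
    I (e.val s) ((Prog.loop r e P).exec O s) := by
  refine (exec_loop_rule O (fun i s' => Fr W A s s' ∧ I i s') ⟨Fr.refl _ _ _, h0⟩ ?_).2
  rintro i hi s' ⟨h1, h2⟩
  exact ⟨h1.trans h5 ((Fr.setR h5 hr i).trans h5 (P.chk_frame O h5 hP _)), hs i hi s' h1 h2⟩

end RealRAM


/-! ## The program -/

namespace RealRAM

instance : Add IExp := ⟨IExp.add⟩
instance : Sub IExp := ⟨IExp.sub⟩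
instance : Mul IExp := ⟨IExp.mul⟩
instance (n : ℕ) : OfNat IExp n := ⟨IExp.const n⟩
instance : Add RExp := ⟨RExp.add⟩
instance : Sub RExp := ⟨RExp.sub⟩
instance : Mul RExp := ⟨RExp.mul⟩
instance : Div RExp := ⟨RExp.div⟩
instance (n : ℕ) : OfNat RExp n := ⟨RExp.const n⟩

@[simp] theorem IExp.val_add (s : State) (a b : IExp) : (a + b).val s = a.val s + b.val s := rfl
@[simp] theorem IExp.val_sub (s : State) (a b : IExp) : (a - b).val s = a.val s - b.val s := rfl
@[simp] theorem IExp.val_mul (s : State) (a b : IExp) : (a * b).val s = a.val s * b.val s := rfl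
@[simp] theorem IExp.val_two (s : State) : (2 : IExp).val s = 2 := rfl
@[simp] theorem IExp.val_four (s : State) : (4 : IExp).val s = 4 := rfl
@[simp] theorem IExp.val_zero (s : State) : (0 : IExp).val s = 0 := rfl
@[simp] theorem IExp.val_one (s : State) : (1 : IExp).val s = 1 := rfl
@[simp] theorem IExp.val_reg (s : State) (r : ℕ) : (IExp.reg r).val s = s.regs r := rfl
@[simp] theorem IExp.val_mem (s : State) (a : IExp) : (IExp.mem a).val s = s.ints (a.val s) := rfl
@[simp] theorem RExp.val_add (s : State) (a b : RExp) : (a + b).val s = a.val s + b.val s := rfl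
@[simp] theorem RExp.val_sub (s : State) (a b : RExp) : (a - b).val s = a.val s - b.val s := rfl
@[simp] theorem RExp.val_mul (s : State) (a b : RExp) : (a * b).val s = a.val s * b.val s := rfl
@[simp] theorem RExp.val_div (s : State) (a b : RExp) : (a / b).val s = a.val s / b.val s := rfl
@[simp] theorem RExp.val_two (s : State) : (2 : RExp).val s = 2 := by
  change (((2 : ℕ) : ℚ) : ℝ) = _
  simp
@[simp] theorem RExp.val_four (s : State) : (4 : RExp).val s = 4 := by
  change (((4 : ℕ) : ℚ) : ℝ) = _
  simp
@[simp] theorem RExp.val_zero (s : State) : (0 : RExp).val s = 0 := by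
  change (((0 : ℕ) : ℚ) : ℝ) = _
  simp
@[simp] theorem RExp.val_one (s : State) : (1 : RExp).val s = 1 := by
  change (((1 : ℕ) : ℚ) : ℝ) = _
  simp
@[simp] theorem RExp.val_ofInt (s : State) (a : IExp) : (RExp.ofInt a).val s = a.val s := rfl
@[simp] theorem RExp.val_mem (s : State) (a : IExp) : (RExp.mem a).val s = s.reals (a.val s) := rfl
@[simp] theorem RExp.val_sqrt (s : State) (a : RExp) : (RExp.sqrt a).val s = √(a.val s) := rfl

infixr:60 " ;; " => Prog.seq

/-! Registers: `0` order `k`, `1` dimension `d`, `2` number `n` of pieces, `3` the number `N`,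
`4` distance of the output blocks, `5` start of the arrays, `6` half the number `M` of nodes of the
current piece, `7` binary logarithm of `M`, `8` degree, `9` current piece, `10` pass, `11` current
coordinate, `12` number of integrations, `13`–`20` local.

Arrays: `0` Chebyshev nodes in heap order, `1` residues, `2` coefficients of the iterated
antiderivatives, `3` coefficients of the `k`-th derivative, `4` values at the nodes, `5` values at
the left ends of the pieces, `6` values of the oracle, `7` local, `8` output. -/

/-- The number of nodes of the current piece. -/
def nodesE : IExp := 2 * .reg 6

/-- Start of the argument block of the oracle. -/
def argE : IExp := .reg 2 + 1 + .reg 0 * .reg 1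

/-- Start of the result block of the oracle. -/
def resE : IExp := argE + (.reg 0 * .reg 1 + 1)

/-- Start of the output block of the current piece. -/
def outE : IExp := resE + .reg 1 + .reg 9 * .reg 4

/-- Heap of Chebyshev nodes. -/
def heapProg : Prog :=
  wr 0 1 0 0 ;;
  .loop 13 nodesE
    (wr 0 (2 * (.reg 13 + 1)) 0 (.sqrt ((1 + rd 0 (.reg 13 + 1) 0) / 2)) ;;
      wr 0 (2 * (.reg 13 + 1) + 1) 0 (0 - rd 0 (2 * (.reg 13 + 1)) 0))

/-- Store `2 ^ (h - 1 - t)` in a register. -/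
def powProg (r : ℕ) : Prog :=
  .setReg r 1 ;;
  .loop 18 (.reg 7)
    (.ifInt (.reg 18 + .reg 14 + 2) (.reg 7) (.setReg r (.reg r + .reg r)) .skip)

/-- Advance the pair of registers `16`, `17`. -/
def stepProg : Prog :=
  .setReg 17 (.reg 17 + 1) ;;
  .ifInt (.reg 15) (.reg 17) (.setReg 17 0 ;; .setReg 16 (.reg 16 + 1)) .skip

/-- One division step of the evaluation. -/
def evalStep : Prog :=
  .ifInt 1 (.reg 17)
    (wr 1 (2 * .reg 16) (.reg 17)
        (rd 1 (.reg 16) (.reg 17) - rd 1 (.reg 16) (2 * .reg 15 - .reg 17)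
          + 2 * rd 0 (2 * .reg 16) 0 * rd 1 (.reg 16) (.reg 15 + .reg 17)) ;;
      wr 1 (2 * .reg 16 + 1) (.reg 17)
        (rd 1 (.reg 16) (.reg 17) - rd 1 (.reg 16) (2 * .reg 15 - .reg 17)
          - 2 * rd 0 (2 * .reg 16) 0 * rd 1 (.reg 16) (.reg 15 + .reg 17)))
    (wr 1 (2 * .reg 16) 0
        (rd 1 (.reg 16) 0 + rd 0 (2 * .reg 16) 0 * rd 1 (.reg 16) (.reg 15)) ;;
      wr 1 (2 * .reg 16 + 1) 0
        (rd 1 (.reg 16) 0 - rd 0 (2 * .reg 16) 0 * rd 1 (.reg 16) (.reg 15))) ;;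
  stepProg

/-- Evaluate the polynomial with coefficients in row `1` of array `1` at all nodes. -/
def evalProg : Prog :=
  .setReg 19 1 ;;
  .loop 14 (.reg 7)
    (powProg 15 ;; .setReg 16 (.reg 19) ;; .setReg 17 0 ;;
      .loop 13 (.reg 6) evalStep ;;
      .setReg 19 (.reg 19 + .reg 19))

/-- One reconstruction step of the interpolation. -/
def fitStep : Prog :=
  .ifInt 1 (.reg 17)
    (wr 1 (.reg 16) (.reg 17)
        ((rd 1 (2 * .reg 16) (.reg 17) + rd 1 (2 * .reg 16 + 1) (.reg 17)) / 2
          + (rd 1 (2 * .reg 16) (.reg 15 - .reg 17) - rd 1 (2 * .reg 16 + 1) (.reg 15 - .reg 17))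
            / (4 * rd 0 (2 * .reg 16) 0)) ;;
      wr 1 (.reg 16) (.reg 15 + .reg 17)
        ((rd 1 (2 * .reg 16) (.reg 17) - rd 1 (2 * .reg 16 + 1) (.reg 17))
            / (4 * rd 0 (2 * .reg 16) 0)))
    (wr 1 (.reg 16) 0 ((rd 1 (2 * .reg 16) 0 + rd 1 (2 * .reg 16 + 1) 0) / 2) ;;
      wr 1 (.reg 16) (.reg 15)
        ((rd 1 (2 * .reg 16) 0 - rd 1 (2 * .reg 16 + 1) 0) / (2 * rd 0 (2 * .reg 16) 0))) ;;
  stepProg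

/-- Interpolate at the nodes; the inverse of `evalProg`. -/
def fitProg : Prog :=
  .setReg 15 1 ;;
  .loop 14 (.reg 7)
    (powProg 19 ;; .setReg 16 (.reg 19) ;; .setReg 17 0 ;;
      .loop 13 (.reg 6) fitStep ;;
      .setReg 15 (.reg 15 + .reg 15))

/-- Address expression: component `c` of the vector `x` in a block of vectors. -/
def compE (x : IExp) : IExp := x * .reg 1 + .reg 11

/-- A quarter of the length of the current piece. -/
def quarterE : RExp := (.mem (.reg 9 + 1) - .mem (.reg 9)) / 4

/-- Preparations for an integration. -/
def intHead : Prog :=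
  -- Array `7` accumulates the constant coefficient, the alternating sign and the sum of the other
  -- coefficients. The cell past the last coefficient is cleared because the next integration reads
  -- two places ahead.
  wr 7 0 0 (rd 5 (.reg 9) (compE (.reg 12))) ;; wr 7 0 1 1 ;; wr 7 0 2 0 ;;
  wr 2 (.reg 12 + 1) (nodesE + .reg 0 + 1) 0

/-- Compute one coefficient of an antiderivative. -/
def intCoef : Prog :=
  .ifInt 1 (.reg 13)
    (wr 2 (.reg 12 + 1) (.reg 13 + 1)
      (quarterE * (rd 2 (.reg 12) (.reg 13) - rd 2 (.reg 12) (.reg 13 + 2)) / .ofInt (.reg 13 + 1)))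
    (wr 2 (.reg 12 + 1) 1 (quarterE * (2 * rd 2 (.reg 12) 0 - rd 2 (.reg 12) 2)))

/-- Compute one coefficient of an antiderivative and update the sums for the values at the ends. -/
def intBody : Prog :=
  intCoef ;;
  wr 7 0 1 (0 - rd 7 0 1) ;;
  wr 7 0 0 (rd 7 0 0 - rd 7 0 1 * rd 2 (.reg 12 + 1) (.reg 13 + 1)) ;;
  wr 7 0 2 (rd 7 0 2 + rd 2 (.reg 12 + 1) (.reg 13 + 1))

/-- Integrate row `u` of array `2` to row `u + 1`. -/
def intProg : Prog :=
  intHead ;;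
  .loop 13 (nodesE + .reg 0) intBody ;;
  wr 2 (.reg 12 + 1) 0 (rd 7 0 0) ;;
  wr 5 (.reg 9 + 1) (compE (.reg 12)) (rd 7 0 0 + rd 7 0 2)

/-- Reduce row `u + 1` of array `2` modulo `T_M`, into row `1` of array `1`. -/
def foldProg : Prog :=
  .loop 13 (nodesE + .reg 0 + 1) (wr 1 0 (.reg 13) (rd 2 (.reg 12 + 1) (.reg 13))) ;;
  .loop 13 (.reg 0)
    (.setReg 18 (nodesE + .reg 0 - .reg 13) ;;
      -- Subtraction is truncated, so one summand vanishes and the sum is |2M - l|.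
      .setReg 17 ((2 * nodesE - .reg 18) + (.reg 18 - 2 * nodesE)) ;;
      wr 1 0 (.reg 17) (rd 1 0 (.reg 17) - rd 1 0 (.reg 18))) ;;
  .loop 13 nodesE (wr 1 1 (.reg 13) (rd 1 0 (.reg 13)))

/-- Store the values at the nodes. -/
def storeProg : Prog :=
  .loop 13 nodesE
    (wr 4 (.reg 13) (compE (.reg 0 - (.reg 12 + 1))) (rd 1 (nodesE + .reg 13) 0))

/-- Integrate the current coordinate `k` times and evaluate at the nodes. -/
def coordProg : Prog :=
  .loop 13 (nodesE + .reg 0 + 2)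
    (.ifInt (.reg 13 + 1) nodesE (wr 2 0 (.reg 13) (rd 3 (.reg 9) (compE (.reg 13))))
      (wr 2 0 (.reg 13) 0)) ;;
  .loop 12 (.reg 0) (intProg ;; foldProg ;; evalProg ;; storeProg) ;;
  .loop 13 (nodesE + .reg 0) (wr 8 0 (compE (.reg 13)) (rd 2 (.reg 0) (.reg 13)))

/-- Evaluate the oracle at the node in register `20`. -/
def askProg : Prog :=
  .loop 13 (.reg 0 * .reg 1) (.setReal (argE + .reg 13) (rd 4 (.reg 20) (.reg 13))) ;;
  .setReal (argE + .reg 0 * .reg 1)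
    (.mem (.reg 9) + 2 * quarterE * (1 + rd 0 (nodesE + .reg 20) 0)) ;;
  .call argE resE ;;
  .loop 13 (.reg 1) (wr 6 (.reg 20) (.reg 13) (.mem (resE + .reg 13)))

/-- Fit the current coordinate. -/
def filterProg : Prog :=
  .loop 13 nodesE (wr 1 (nodesE + .reg 13) 0 (rd 6 (.reg 13) (.reg 11))) ;;
  fitProg ;;
  .loop 13 nodesE
    -- Multipliers of the de la Vallée-Poussin kernel: 1 up to half the number of nodes, then
    -- linearly decreasing.
    (.ifInt (.reg 13) (.reg 6) (wr 3 (.reg 9) (compE (.reg 13)) (rd 1 1 (.reg 13)))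
      (wr 3 (.reg 9) (compE (.reg 13))
        ((2 - .ofInt (.reg 13) / .ofInt (.reg 6)) * rd 1 1 (.reg 13))))

/-- Write the output block of the current piece. -/
def dumpProg : Prog :=
  .loop 13 ((nodesE + .reg 0) * .reg 1) (.setReal (outE + .reg 13) (rd 8 0 (.reg 13))) ;;
  .setInt (.reg 2 + 2 * .reg 9) outE ;;
  .setInt (.reg 2 + (2 * .reg 9 + 1)) (nodesE + .reg 0)

/-- Choose the number of nodes of the current piece. -/
def sizeProg : Prog :=
  .setReg 6 1 ;; .setReg 7 1 ;;
  .loop 13 (.reg 8)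
    (.ifInt (.reg 8) (.reg 6) .skip
      (.setReg 6 (.reg 6 + .reg 6) ;; .setReg 7 (.reg 7 + 1)))

/-- Treat a piece whose size is known. -/
def mainProg : Prog :=
  heapProg ;; .loop 11 (.reg 1) coordProg ;; .loop 20 nodesE askProg ;;
    .loop 11 (.reg 1) filterProg ;; dumpProg

/-- Treat a piece. -/
def pieceProg : Prog := .setReg 8 (.mem (.reg 9)) ;; sizeProg ;; mainProg

/-- Store the initial values. -/
def startProg : Prog :=
  .loop 12 (.reg 0) (.loop 11 (.reg 1)
    (wr 5 0 (compE (.reg 12))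
      (.mem (.reg 2 + 1 + ((.reg 0 - (.reg 12 + 1)) * .reg 1 + .reg 11)))))

/-- One Picard iteration. -/
def passProg : Prog := startProg ;; .loop 9 (.reg 2) pieceProg

/-- Choose the memory layout. -/
def setupProg : Prog :=
  .setReg 8 0 ;; .loop 9 (.reg 2) (.setReg 8 (.reg 8 + .mem (.reg 9))) ;;
  -- A piece of degree D has at most 4D + 2 nodes and k further coefficients; the sum of all degrees
  -- makes this one distance large enough for every piece.
  .setReg 4 ((4 * .reg 8 + .reg 0 + 4) * .reg 1) ;;
  .setReg 5 (resE + .reg 1 + .reg 2 * .reg 4)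

/-- The solver. -/
def solver : Prog :=
  -- Pass 0 starts with scaled error 2C ≤ 2^(N+1) ε, so N + 1 further passes of halving are needed.
  -- The output table begins at address n, right after the degrees.
  setupProg ;; .loop 10 (.reg 3 + 2) passProg ;; .setReg 0 (.reg 2)

end RealRAM


/-! ## Chebyshev polynomials at the roots of `T_M` -/

/-- The Chebyshev polynomial of degree `l` as a function. -/
noncomputable def chebT (l : ℕ) (x : ℝ) : ℝ := (Polynomial.Chebyshev.T ℝ (l : ℤ)).eval x

@[simp] theorem chebT_zero (x : ℝ) : chebT 0 x = 1 := by simp [chebT]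
@[simp] theorem chebT_one (x : ℝ) : chebT 1 x = x := by simp [chebT]

theorem chebT_mul (a b : ℕ) (x : ℝ) :
    2 * chebT (a + b) x * chebT b x = chebT (a + 2 * b) x + chebT a x := by
  have h := congrArg (Polynomial.eval x) (Polynomial.Chebyshev.T_mul_T ℝ ((a + b : ℕ) : ℤ) b)
  simp only [Polynomial.eval_mul, Polynomial.eval_add, Polynomial.eval_ofNat] at h
  simp only [chebT, h]
  congr 3 <;> push_cast <;> ring_nf

theorem chebT_mul_le {a b : ℕ} (h : b ≤ a) (x : ℝ) :
    2 * chebT a x * chebT b x = chebT (a + b) x + chebT (a - b) x := by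
  obtain ⟨c, rfl⟩ := Nat.exists_eq_add_of_le' h
  rw [chebT_mul]
  congr 2 <;> omega

/-- The composition law with T_2. It trades a doubled degree for a step from a node of the heap to
its parent. -/
theorem chebT_two_mul (q : ℕ) (x : ℝ) : chebT (2 * q) x = chebT q (2 * x ^ 2 - 1) := by
  have h := congrArg (Polynomial.eval x) (Polynomial.Chebyshev.T_mul ℝ (q : ℤ) 2)
  simp only [Polynomial.eval_comp, Polynomial.Chebyshev.T_two] at h
  simp only [chebT]
  push_cast
  rw [mul_comm, h]
  simp

theorem chebT_neg (l : ℕ) (x : ℝ) : chebT l (-x) = (-1) ^ l * chebT l x := by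
  simp only [chebT, Polynomial.Chebyshev.T_eval_neg]
  simp [Int.coe_negOnePow_natCast]

theorem chebT_at_one (l : ℕ) : chebT l 1 = 1 := by simp [chebT]

theorem chebT_at_neg_one (l : ℕ) : chebT l (-1) = (-1) ^ l := by
  rw [chebT_neg, chebT_at_one, mul_one]

theorem chebT_cos (l : ℕ) (θ : ℝ) : chebT l (Real.cos θ) = Real.cos (l * θ) := by
  simp [chebT, Polynomial.Chebyshev.T_real_cos]

/-- With l = M + b, the product 2 T_M T_b = T_{M+b} + T_{|M-b|} vanishes at a root of T_M. -/
theorem chebT_fold {M l : ℕ} {x : ℝ} (hx : chebT M x = 0) (h : M ≤ l) :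
    chebT l x = -chebT ((2 * M - l) + (l - 2 * M)) x := by
  obtain ⟨b, rfl⟩ := Nat.exists_eq_add_of_le h
  rcases le_total b M with hb | hb
  · have := chebT_mul_le hb x
    rw [hx] at this
    have e : (2 * M - (M + b)) + (M + b - 2 * M) = M - b := by omega
    rw [e]
    linarith
  · have := chebT_mul_le hb x
    rw [hx] at this
    have e : (2 * M - (M + b)) + (M + b - 2 * M) = b - M := by omega
    rw [e, add_comm M b]
    linarith

/-- The polynomial function with Chebyshev coefficients `a 0, …, a (n - 1)`. -/
noncomputable def chebP (a : ℕ → ℝ) (n : ℕ) (x : ℝ) : ℝ := ∑ l ∈ Finset.range n, a l * chebT l x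

theorem chebP_congr {a b : ℕ → ℝ} {n : ℕ} (h : ∀ l < n, a l = b l) (x : ℝ) :
    chebP a n x = chebP b n x :=
  Finset.sum_congr rfl fun l hl => by rw [h l (Finset.mem_range.1 hl)]

theorem chebP_extend {a : ℕ → ℝ} {m n : ℕ} (hmn : m ≤ n) (h : ∀ l, m ≤ l → a l = 0) (x : ℝ) :
    chebP a n x = chebP a m x := by
  symm
  refine Finset.sum_subset (by simpa using hmn) fun l _ hl => ?_
  rw [h l (by simpa using hl), zero_mul]

/-- Division by `T_m - c`: splitting a sum of `2 * m` terms. -/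
theorem chebP_residue {m : ℕ} (hm : 1 ≤ m) {x c : ℝ} (hx : chebT m x = c) {a b : ℕ → ℝ}
    (h0 : b 0 = a 0 + c * a m)
    (hi : ∀ i, 1 ≤ i → i < m → b i = a i - a (2 * m - i) + 2 * c * a (m + i)) :
    chebP b m x = chebP a (2 * m) x := by
  unfold chebP
  obtain ⟨m, rfl⟩ := Nat.exists_eq_add_of_le' hm
  have e : 2 * (m + 1) = (m + 1) + (m + 1) := by ring
  rw [e, Finset.sum_range_add (fun l => a l * chebT l x),
    Finset.sum_range_succ' (fun l => b l * chebT l x),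
    Finset.sum_range_succ' (fun l => a l * chebT l x),
    Finset.sum_range_succ' (fun l => a (m + 1 + l) * chebT (m + 1 + l) x), h0]
  have h1 : ∑ i ∈ Finset.range m, b (i + 1) * chebT (i + 1) x
      = ∑ i ∈ Finset.range m, (a (i + 1) * chebT (i + 1) x
        - a (2 * (m + 1) - (i + 1)) * chebT (i + 1) x
        + a ((m + 1) + (i + 1)) * (2 * c * chebT (i + 1) x)) := by
    refine Finset.sum_congr rfl fun i hi' => ?_
    rw [hi (i + 1) (by omega) (by have := Finset.mem_range.1 hi'; omega)]
    ring
  -- Where T_m = c, the product formula turns 2c T_i into T_{m+i} + T_{m-i}; the reflected terms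
  -- T_{m-i} then cancel the coefficients with index 2m - i.
  have h2 : ∑ i ∈ Finset.range m, a ((m + 1) + (i + 1)) * (2 * c * chebT (i + 1) x)
      = ∑ i ∈ Finset.range m, (a ((m + 1) + (i + 1)) * chebT ((m + 1) + (i + 1)) x
        + a ((m + 1) + (i + 1)) * chebT ((m + 1) - (i + 1)) x) := by
    refine Finset.sum_congr rfl fun i hi' => ?_
    have := chebT_mul_le (show i + 1 ≤ m + 1 by have := Finset.mem_range.1 hi'; omega) x
    rw [hx] at this
    rw [this]
    ring
  have h3 : ∑ i ∈ Finset.range m, a ((m + 1) + (i + 1)) * chebT ((m + 1) - (i + 1)) x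
      = ∑ i ∈ Finset.range m, a (2 * (m + 1) - (i + 1)) * chebT (i + 1) x := by
    rw [← Finset.sum_range_reflect]
    refine Finset.sum_congr rfl fun i hi' => ?_
    have := Finset.mem_range.1 hi'
    congr 2 <;> omega
  rw [h1, Finset.sum_add_distrib, Finset.sum_sub_distrib, h2, Finset.sum_add_distrib, h3]
  simp only [chebT_zero, add_zero, mul_one, hx]
  ring

/-! ### The heap of nodes -/

/-- The values `T_m` takes at the leaves below a node of the heap; leaves are Chebyshev nodes. -/
noncomputable def cc (g : ℕ) : ℝ :=
  if _h : g < 2 then 0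
  else if g % 2 = 0 then √((1 + cc (g / 2)) / 2) else -√((1 + cc (g / 2)) / 2)
termination_by g
decreasing_by all_goals omega

theorem cc_one : cc 1 = 0 := by rw [cc]; simp

theorem cc_even {g : ℕ} (hg : 1 ≤ g) : cc (2 * g) = √((1 + cc g) / 2) := by
  rw [cc, dif_neg (by omega), if_pos (by omega)]
  congr 4
  omega

theorem cc_odd {g : ℕ} (hg : 1 ≤ g) : cc (2 * g + 1) = -cc (2 * g) := by
  rw [cc_even hg, cc, dif_neg (by omega), if_neg (by omega)]
  congr 5
  omega

/-- Strictness propagates down the heap: (1 + c)/2 stays strictly between 0 and 1. It keeps the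
nodes below the root away from 0, which makes the divisions during interpolation legitimate. -/
theorem cc_mem (g : ℕ) : -1 < cc g ∧ cc g < 1 := by
  induction g using Nat.strong_induction_on with
  | _ g ih =>
    rcases lt_or_ge g 2 with h | h
    · rw [cc, dif_pos h]; norm_num
    · obtain ⟨h1, h2⟩ := ih (g / 2) (by omega)
      have h3 : 0 ≤ √((1 + cc (g / 2)) / 2) := Real.sqrt_nonneg _
      have h4 : √((1 + cc (g / 2)) / 2) < 1 := by
        rw [Real.sqrt_lt' one_pos]; linarith
      rw [cc, dif_neg (by omega)]
      split <;> constructor <;> linarith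

theorem cc_even_pos {g : ℕ} (hg : 1 ≤ g) : 0 < cc (2 * g) := by
  rw [cc_even hg]
  have := cc_mem g
  exact Real.sqrt_pos.2 (by linarith)

theorem cc_sq {g : ℕ} (hg : 2 ≤ g) : 2 * cc g ^ 2 - 1 = cc (g / 2) := by
  have := cc_mem (g / 2)
  rw [cc, dif_neg (by omega)]
  split
  · rw [Real.sq_sqrt (by linarith)]; ring
  · rw [neg_sq, Real.sq_sqrt (by linarith)]; ring

/-- Each factor T_2 climbs one level, by `cc_sq`. -/
theorem chebT_cc (s : ℕ) : ∀ g, 2 ^ s ≤ g → chebT (2 ^ s) (cc g) = cc (g / 2 ^ s) := by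
  induction s with
  | zero => intro g _; simp
  | succ s ih =>
    intro g hg
    have h2 : 2 ≤ g := le_trans (by rw [pow_succ]; have := Nat.one_le_two_pow (n := s); omega) hg
    rw [pow_succ, mul_comm, chebT_two_mul, cc_sq h2, ih _ (by rw [pow_succ] at hg; omega),
      Nat.div_div_eq_div_mul]

theorem chebT_leaf {h t r : ℕ} (ht : t ≤ h) :
    chebT (2 ^ (h - t)) (cc (2 ^ h + r)) = cc (2 ^ t + r / 2 ^ (h - t)) := by
  have e : 2 ^ h = 2 ^ t * 2 ^ (h - t) := by rw [← pow_add]; congr 1; omega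
  rw [chebT_cc]
  · rw [e, mul_comm, Nat.mul_add_div (Nat.two_pow_pos _)]
  · exact le_trans (Nat.pow_le_pow_right (by norm_num) (by omega)) (Nat.le_add_right _ _)

theorem chebT_root (h r : ℕ) (hr : r < 2 ^ h) : chebT (2 ^ h) (cc (2 ^ h + r)) = 0 := by
  have := chebT_leaf (h := h) (t := 0) (r := r) (Nat.zero_le _)
  rw [Nat.sub_zero, Nat.div_eq_of_lt hr] at this
  simpa [cc_one] using this

theorem sum_range_two_mul (f : ℕ → ℝ) (n : ℕ) :
    ∑ i ∈ Finset.range (2 * n), f i = ∑ b ∈ Finset.range n, (f (2 * b) + f (2 * b + 1)) := by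
  induction n with
  | zero => simp
  | succ n ih =>
    rw [show 2 * (n + 1) = 2 * n + 1 + 1 by ring, Finset.sum_range_succ, Finset.sum_range_succ, ih,
      Finset.sum_range_succ]
    ring

/-- Siblings are opposite numbers, so odd degrees cancel in pairs. An even degree 2q takes equal
values on siblings, namely that of T_q at the parent, and the induction hypothesis applies one level
higher. -/
theorem sum_chebT_nodes (t : ℕ) : ∀ r, 0 < r → r < 2 ^ (t + 1) →
    ∑ b ∈ Finset.range (2 ^ t), chebT r (cc (2 ^ t + b)) = 0 := by
  induction t with
  | zero =>
    intro r h0 h1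
    have : r = 1 := by simp at h1; omega
    subst this
    simp [cc_one]
  | succ t ih =>
    intro r h0 h1
    have hg : ∀ b, 1 ≤ 2 ^ t + b := fun b => le_trans Nat.one_le_two_pow (Nat.le_add_right _ _)
    rw [pow_succ, mul_comm, sum_range_two_mul]
    have e : ∀ b, chebT r (cc (2 * 2 ^ t + 2 * b)) + chebT r (cc (2 * 2 ^ t + (2 * b + 1)))
        = (1 + (-1) ^ r) * chebT r (cc (2 * (2 ^ t + b))) := by
      intro b
      rw [show 2 * 2 ^ t + (2 * b + 1) = 2 * (2 ^ t + b) + 1 by ring, cc_odd (hg b), chebT_neg,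
        show 2 * 2 ^ t + 2 * b = 2 * (2 ^ t + b) by ring]
      ring
    simp only [e]
    rcases Nat.even_or_odd' r with ⟨q, rfl | rfl⟩
    · have : ∀ b, chebT (2 * q) (cc (2 * (2 ^ t + b))) = chebT q (cc (2 ^ t + b)) := by
        intro b
        rw [chebT_two_mul, cc_sq (by have := hg b; omega)]
        congr 2
        omega
      simp only [this]
      rw [← Finset.mul_sum, ih q (by omega) (by rw [pow_succ] at h1; omega), mul_zero]
    · simp [pow_succ, pow_mul]

/-- By the product formula this reduces to sums of T_{a+b} and T_{a-b} over the nodes; both indices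
are below 2^(h+1), where only T_0 has a nonzero sum. -/
theorem chebT_orthogonal (h : ℕ) {a b : ℕ} (ha : a < 2 ^ h) (hb : b < 2 ^ h) :
    (if a = 0 then 1 else 2) *
      ∑ r ∈ Finset.range (2 ^ h), chebT a (cc (2 ^ h + r)) * chebT b (cc (2 ^ h + r))
      = if a = b then (2 : ℝ) ^ h else 0 := by
  wlog hab : b ≤ a generalizing a b
  · have hba : ¬ a = b := by omega
    have h1 := this hb ha (by omega)
    rw [if_neg (by omega : ¬ b = a), if_neg (by omega : ¬ b = 0)] at h1
    have h2 : ∑ r ∈ Finset.range (2 ^ h), chebT b (cc (2 ^ h + r)) * chebT a (cc (2 ^ h + r)) = 0 := by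
      linarith
    simp only [mul_comm (chebT a _)]
    rw [h2, if_neg hba, mul_zero]
  have e : ∑ r ∈ Finset.range (2 ^ h), 2 * (chebT a (cc (2 ^ h + r)) * chebT b (cc (2 ^ h + r)))
      = ∑ r ∈ Finset.range (2 ^ h), chebT (a + b) (cc (2 ^ h + r))
        + ∑ r ∈ Finset.range (2 ^ h), chebT (a - b) (cc (2 ^ h + r)) := by
    rw [← Finset.sum_add_distrib]
    refine Finset.sum_congr rfl fun r _ => ?_
    rw [← mul_assoc, chebT_mul_le hab]
  rw [← Finset.mul_sum] at e
  rcases Nat.eq_zero_or_pos a with rfl | ha0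
  · have : b = 0 := by omega
    subst this
    simp
  · have hs := sum_chebT_nodes h (a + b) (by omega) (by rw [pow_succ]; omega)
    rw [if_neg (by omega : ¬ a = 0), e, hs]
    rcases eq_or_ne a b with rfl | hne
    · simp
    · rw [sum_chebT_nodes h (a - b) (by omega) (by rw [pow_succ]; omega), if_neg hne, add_zero]

/-! ### Positive kernels -/

/-- The left side is the squared modulus of the sum of e^{ijφ} over j < n, and the difference l of
two indices occurs n - l times. Being a sum of squares, it supplies the positivity of the Fejér
kernel. -/
theorem fejer_sum (n : ℕ) (φ : ℝ) :
    (∑ j ∈ Finset.range n, Real.cos (j * φ)) ^ 2 + (∑ j ∈ Finset.range n, Real.sin (j * φ)) ^ 2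
      = ∑ l ∈ Finset.range n, (if l = 0 then 1 else 2) * ((n : ℝ) - l) * Real.cos (l * φ) := by
  induction n with
  | zero => simp
  | succ n ih =>
    have h1 : ∑ l ∈ Finset.range (n + 1),
        (if l = 0 then (1 : ℝ) else 2) * (((n + 1 : ℕ) : ℝ) - l) * Real.cos (l * φ)
        = ∑ l ∈ Finset.range n, (if l = 0 then 1 else 2) * ((n : ℝ) - l) * Real.cos (l * φ)
          + ∑ l ∈ Finset.range (n + 1), (if l = 0 then (1 : ℝ) else 2) * Real.cos (l * φ) := by
      rw [Finset.sum_range_succ, Finset.sum_range_succ _ n, ← add_assoc, ← Finset.sum_add_distrib]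
      congr 1
      · refine Finset.sum_congr rfl fun l _ => ?_
        push_cast; ring
      · push_cast; ring
    have h2 : ∑ l ∈ Finset.range (n + 1), (if l = 0 then (1 : ℝ) else 2) * Real.cos (l * φ)
        = 1 + 2 * ∑ j ∈ Finset.range n,
          (Real.cos (j * φ) * Real.cos (n * φ) + Real.sin (j * φ) * Real.sin (n * φ)) := by
      rw [Finset.sum_range_succ', ← Finset.sum_range_reflect, Finset.mul_sum]
      simp only [if_true, Nat.cast_zero, zero_mul, Real.cos_zero, mul_one]
      rw [add_comm]
      congr 1
      refine Finset.sum_congr rfl fun j hj => ?_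
      have hj' := Finset.mem_range.1 hj
      rw [if_neg (by omega), show n - 1 - j + 1 = n - j by omega, Nat.cast_sub hj'.le, sub_mul,
        Real.cos_sub]
      ring
    rw [h1, h2, ← ih, Finset.sum_range_succ, Finset.sum_range_succ, Finset.sum_add_distrib,
      ← Finset.sum_mul, ← Finset.sum_mul]
    have := Real.sin_sq_add_cos_sq (n * φ)
    linear_combination this

/-- The kernel with multipliers `w` for the nodes of level `h`. -/
noncomputable def nodeKernel (h : ℕ) (w : ℕ → ℝ) (x x' : ℝ) : ℝ :=
  (∑ l ∈ Finset.range (2 ^ h), (if l = 0 then 1 else 2) * w l * chebT l x * chebT l x') / 2 ^ h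

/-- Discrete orthogonality singles out the term l = b, so the kernel acts diagonally on the
Chebyshev basis. -/
theorem nodeKernel_reproduce (h : ℕ) (w : ℕ → ℝ) (x : ℝ) {b : ℕ} (hb : b < 2 ^ h) :
    ∑ r ∈ Finset.range (2 ^ h), nodeKernel h w x (cc (2 ^ h + r)) * chebT b (cc (2 ^ h + r))
      = w b * chebT b x := by
  have e : ∀ r, nodeKernel h w x (cc (2 ^ h + r)) * chebT b (cc (2 ^ h + r))
      = ∑ l ∈ Finset.range (2 ^ h), w l * chebT l x / 2 ^ h * ((if l = 0 then 1 else 2) *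
        (chebT l (cc (2 ^ h + r)) * chebT b (cc (2 ^ h + r)))) := by
    intro r
    rw [nodeKernel, div_mul_eq_mul_div, Finset.sum_mul, Finset.sum_div]
    refine Finset.sum_congr rfl fun l _ => ?_
    ring
  simp only [e]
  rw [Finset.sum_comm]
  simp only [← Finset.mul_sum]
  rw [Finset.sum_eq_single b]
  · rw [chebT_orthogonal h hb hb, if_pos rfl]
    field_simp
  · intro l hl hne
    rw [chebT_orthogonal h (Finset.mem_range.1 hl) hb, if_neg hne, mul_zero]
  · intro h'; exact absurd (Finset.mem_range.2 hb) h'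

/-- The multipliers of the Fejér kernel. -/
noncomputable def fejerW (n l : ℕ) : ℝ := if l < n then 1 - l / n else 0

/-- For x = cos θ and x' = cos θ' the products of cosines split into cosines at θ - θ' and θ + θ',
leaving two expressions of the type in `fejer_sum`. -/
theorem nodeKernel_fejer_nonneg (h : ℕ) {n : ℕ} (hn : n ≤ 2 ^ h) {x x' : ℝ}
    (hx : x ∈ Icc (-1 : ℝ) 1) (hx' : x' ∈ Icc (-1 : ℝ) 1) :
    0 ≤ nodeKernel h (fejerW n) x x' := by
  refine div_nonneg ?_ (by positivity)
  have h1 : ∑ l ∈ Finset.range (2 ^ h), (if l = 0 then 1 else 2) * fejerW n l * chebT l x * chebT l x'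
      = ∑ l ∈ Finset.range n, (if l = 0 then 1 else 2) * fejerW n l * chebT l x * chebT l x' := by
    symm
    refine Finset.sum_subset (by simpa using hn) fun l _ hl => ?_
    have : ¬ l < n := by simpa using hl
    simp [fejerW, this]
  rw [h1]
  rcases Nat.eq_zero_or_pos n with rfl | hpos
  · simp
  have hn0 : (n : ℝ) ≠ 0 := by positivity
  rw [← Real.cos_arccos hx.1 hx.2, ← Real.cos_arccos hx'.1 hx'.2]
  generalize Real.arccos x = θ
  generalize Real.arccos x' = θ'
  have e : ∑ l ∈ Finset.range n, (if l = 0 then 1 else 2) * fejerW n l * chebT l (Real.cos θ)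
        * chebT l (Real.cos θ')
      = (∑ l ∈ Finset.range n, (if l = 0 then 1 else 2) * ((n : ℝ) - l) * Real.cos (l * (θ - θ'))
        + ∑ l ∈ Finset.range n, (if l = 0 then 1 else 2) * ((n : ℝ) - l) * Real.cos (l * (θ + θ')))
        / (2 * n) := by
    rw [← Finset.sum_add_distrib, Finset.sum_div]
    refine Finset.sum_congr rfl fun l hl => ?_
    rw [fejerW, if_pos (Finset.mem_range.1 hl), chebT_cos, chebT_cos,
      mul_sub (l : ℝ) θ, mul_add (l : ℝ) θ, Real.cos_sub, Real.cos_add]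
    field_simp
    ring
  rw [e, ← fejer_sum, ← fejer_sum]
  positivity

/-- By positivity the absolute values can be dropped, and the sum is then the action of the kernel
on the constant 1. -/
theorem fejer_abs_sum (h : ℕ) {n : ℕ} (h0 : 0 < n) (hn : n ≤ 2 ^ h) {x : ℝ}
    (hx : x ∈ Icc (-1 : ℝ) 1) :
    ∑ r ∈ Finset.range (2 ^ h), |nodeKernel h (fejerW n) x (cc (2 ^ h + r))| = 1 := by
  have := nodeKernel_reproduce h (fejerW n) x (b := 0) (by positivity)
  simp only [chebT_zero, mul_one] at this
  rw [show fejerW n 0 = 1 by simp [fejerW, h0]] at this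
  rw [← this]
  refine Finset.sum_congr rfl fun r _ => abs_of_nonneg (nodeKernel_fejer_nonneg h hn hx ?_)
  have := cc_mem (2 ^ h + r)
  exact ⟨this.1.le, this.2.le⟩

/-- The multipliers of the de la Vallée-Poussin kernel, for `2 * m` nodes. -/
noncomputable def vpW (m l : ℕ) : ℝ := if l ≤ m then 1 else 2 - l / m

/-- The trapezoidal multipliers are twice the Fejér multipliers of length 2m minus those of length
m, whence 2 · 1 + 1. The bound does not depend on the number of nodes, in contrast to plain
interpolation, whose norm grows logarithmically. -/
theorem vp_abs_sum (h : ℕ) {x : ℝ} (hx : x ∈ Icc (-1 : ℝ) 1) :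
    ∑ r ∈ Finset.range (2 ^ (h + 1)),
      |nodeKernel (h + 1) (vpW (2 ^ h)) x (cc (2 ^ (h + 1) + r))| ≤ 3 := by
  have key : ∀ x', nodeKernel (h + 1) (vpW (2 ^ h)) x x'
      = 2 * nodeKernel (h + 1) (fejerW (2 ^ (h + 1))) x x'
        - nodeKernel (h + 1) (fejerW (2 ^ h)) x x' := by
    intro x'
    simp only [nodeKernel]
    rw [← mul_div_assoc, ← sub_div, Finset.mul_sum, ← Finset.sum_sub_distrib]
    congr 1
    refine Finset.sum_congr rfl fun l hl => ?_
    have hl' := Finset.mem_range.1 hl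
    have : vpW (2 ^ h) l = 2 * fejerW (2 ^ (h + 1)) l - fejerW (2 ^ h) l := by
      rw [vpW, fejerW, fejerW, if_pos hl']
      push_cast
      rw [pow_succ]
      have : (2 : ℝ) ^ h ≠ 0 := by positivity
      rcases lt_trichotomy l (2 ^ h) with h1 | h1 | h1
      · rw [if_pos h1.le, if_pos h1]; field_simp; ring
      · rw [if_pos h1.le, if_neg (by omega), h1]; push_cast; field_simp; ring
      · rw [if_neg (by omega), if_neg (by omega)]; field_simp; ring
    rw [this]
    ring
  simp only [key]
  have hle : 2 ^ h ≤ 2 ^ (h + 1) := Nat.pow_le_pow_right (by norm_num) (by omega)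
  have h1 := fejer_abs_sum (h + 1) (n := 2 ^ (h + 1)) (by positivity) le_rfl hx
  have h2 := fejer_abs_sum (h + 1) (n := 2 ^ h) (by positivity) hle hx
  calc _ ≤ ∑ r ∈ Finset.range (2 ^ (h + 1)),
        (2 * |nodeKernel (h + 1) (fejerW (2 ^ (h + 1))) x (cc (2 ^ (h + 1) + r))|
          + |nodeKernel (h + 1) (fejerW (2 ^ h)) x (cc (2 ^ (h + 1) + r))|) := by
        refine Finset.sum_le_sum fun r _ => (abs_sub _ _).trans ?_
        rw [abs_mul, abs_two]
    _ = 3 := by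
        rw [Finset.sum_add_distrib, ← Finset.mul_sum, h1, h2]; norm_num

/-! ### Filtered interpolation and its polynomial exactness -/

/-- Filtered interpolation is given by the kernel. -/
theorem chebP_filter (h : ℕ) (w a : ℕ → ℝ) (x : ℝ) :
    chebP (fun l => w l * a l) (2 ^ h) x = ∑ r ∈ Finset.range (2 ^ h),
      nodeKernel h w x (cc (2 ^ h + r)) * chebP a (2 ^ h) (cc (2 ^ h + r)) := by
  simp only [chebP, Finset.mul_sum]
  rw [Finset.sum_comm]
  refine Finset.sum_congr rfl fun l hl => ?_
  rw [mul_right_comm, ← nodeKernel_reproduce h w x (Finset.mem_range.1 hl), Finset.sum_mul]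
  refine Finset.sum_congr rfl fun r _ => ?_
  ring

/-- From x T_l = (T_{l+1} + T_{l-1})/2 for l ≥ 1. -/
theorem x_mul_chebP (a : ℕ → ℝ) (n : ℕ) :
    ∃ b : ℕ → ℝ, ∀ x, x * chebP a n x = chebP b (n + 1) x := by
  induction n with
  | zero => exact ⟨0, fun x => by simp [chebP]⟩
  | succ n ih =>
    obtain ⟨b, hb⟩ := ih
    rcases n with _ | n
    · refine ⟨fun l => if l = 1 then a 0 else 0, fun x => ?_⟩
      simp [chebP, mul_comm]
    · refine ⟨fun l => (if l < n + 2 then b l else 0) + (if l = n then a (n + 1) / 2 else 0)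
        + (if l = n + 2 then a (n + 1) / 2 else 0), fun x => ?_⟩
      have e : chebP a (n + 1 + 1) x = chebP a (n + 1) x + a (n + 1) * chebT (n + 1) x := by
        rw [chebP, Finset.sum_range_succ]; rfl
      have hx := chebT_mul_le (show 1 ≤ n + 1 by omega) x
      rw [chebT_one, Nat.add_sub_cancel] at hx
      rw [e, mul_add, hb x]
      simp only [chebP, add_mul, Finset.sum_add_distrib, ite_mul, zero_mul]
      rw [Finset.sum_ite_eq' , Finset.sum_ite_eq', if_pos (by simp; omega), if_pos (by simp),
        Finset.sum_range_succ _ (n + 1 + 1), if_neg (by omega), add_zero,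
        Finset.sum_congr rfl fun l hl => if_pos (Finset.mem_range.1 hl)]
      linear_combination (a (n + 1) / 2) * hx

/-- The approximating polynomials are given by powers of t, which is affine in the Chebyshev
variable; this puts them in the span on which the kernel is diagonal. -/
theorem chebP_affine_pow (p q : ℝ) (m : ℕ) :
    ∃ a : ℕ → ℝ, ∀ x, (p + q * x) ^ m = chebP a (m + 1) x := by
  induction m with
  | zero => exact ⟨fun _ => 1, fun x => by simp [chebP]⟩
  | succ m ih =>
    obtain ⟨a, ha⟩ := ih
    obtain ⟨b, hb⟩ := x_mul_chebP a (m + 1)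
    refine ⟨fun l => p * (if l < m + 1 then a l else 0) + q * b l, fun x => ?_⟩
    rw [pow_succ, ha]
    have e : chebP (fun l => p * (if l < m + 1 then a l else 0) + q * b l) (m + 1 + 1) x
        = p * chebP (fun l => if l < m + 1 then a l else 0) (m + 1 + 1) x
          + q * chebP b (m + 1 + 1) x := by
      simp only [chebP, Finset.mul_sum, ← Finset.sum_add_distrib]
      refine Finset.sum_congr rfl fun l _ => ?_
      ring
    rw [e, chebP_extend (m := m + 1) (by omega) (fun l hl => if_neg (by omega)),
      chebP_congr (fun l hl => if_pos hl), ← hb]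
    ring

/-- The de la Vallée-Poussin kernel reproduces polynomials of degree at most half the number of
nodes. -/
theorem vp_exact (h : ℕ) (p q : ℝ) {m : ℕ} (hm : m ≤ 2 ^ h) (x : ℝ) :
    ∑ r ∈ Finset.range (2 ^ (h + 1)), nodeKernel (h + 1) (vpW (2 ^ h)) x (cc (2 ^ (h + 1) + r))
      * (p + q * cc (2 ^ (h + 1) + r)) ^ m = (p + q * x) ^ m := by
  obtain ⟨a, ha⟩ := chebP_affine_pow p q m
  simp only [ha]
  have hlt : m + 1 ≤ 2 ^ (h + 1) := by
    have := Nat.one_le_two_pow (n := h)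
    rw [pow_succ]; omega
  -- Padding with zeros to the full number of nodes; the multipliers equal 1 on the indices l ≤ 2^h
  -- that carry nonzero coefficients.
  have e : ∀ y, chebP a (m + 1) y = chebP (fun l => if l < m + 1 then a l else 0) (2 ^ (h + 1)) y := by
    intro y
    rw [chebP_extend hlt fun l hl => if_neg (by omega)]
    exact chebP_congr (fun l hl => (if_pos hl).symm) y
  simp only [e]
  rw [← chebP_filter]
  refine chebP_congr (fun l _ => ?_) x
  split_ifs with hl
  · rw [vpW, if_pos (by omega), one_mul]
  · ring


/-! ### Antiderivatives of Chebyshev expansions -/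

/-- The nonconstant coefficients of an antiderivative, for the quarter length `q`. -/
noncomputable def intRaw (q : ℝ) (a : ℕ → ℝ) : ℕ → ℝ
  | 0 => 0
  | 1 => q * (2 * a 0 - a 2)
  | l + 2 => q * (a (l + 1) - a (l + 3)) / ((l + 2 : ℕ) : ℝ)

/-- The coefficients of the antiderivative with value `v` at the left end. -/
noncomputable def intCo (q : ℝ) (a : ℕ → ℝ) (v : ℝ) (n : ℕ) (l : ℕ) : ℝ :=
  if l = 0 then v - ∑ i ∈ Finset.range n, (-1) ^ (i + 1) * intRaw q a (i + 1) else intRaw q a l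

theorem intCo_succ (q : ℝ) (a : ℕ → ℝ) (v : ℝ) (n l : ℕ) :
    intCo q a v n (l + 1) = intRaw q a (l + 1) := by simp [intCo]

theorem intCo_eq_zero {q : ℝ} {a : ℕ → ℝ} {v : ℝ} {n m : ℕ} (h : ∀ l, m ≤ l → a l = 0) :
    ∀ l, m + 1 ≤ l → intCo q a v n l = 0 := by
  intro l hl
  rcases l with _ | _ | l
  · omega
  · simp [intCo, intRaw, h 0 (by omega), h 2 (by omega)]
  · simp [intCo, intRaw, h (l + 1) (by omega), h (l + 3) (by omega)]

theorem chebP_intCo_left (q : ℝ) (a : ℕ → ℝ) (v : ℝ) (n : ℕ) :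
    chebP (intCo q a v n) (n + 1) (-1) = v := by
  rw [chebP, Finset.sum_range_succ']
  simp only [intCo_succ, chebT_at_neg_one]
  simp [intCo, mul_comm]

theorem chebP_intCo_right (q : ℝ) (a : ℕ → ℝ) (v : ℝ) (n : ℕ) :
    chebP (intCo q a v n) (n + 1) 1
      = intCo q a v n 0 + ∑ l ∈ Finset.range n, intRaw q a (l + 1) := by
  rw [chebP, Finset.sum_range_succ']
  simp only [intCo_succ, chebT_at_one, mul_one]
  rw [add_comm]

/-- Chebyshev polynomials of the second kind as functions. -/
noncomputable def chebU (l : ℤ) (x : ℝ) : ℝ := (Polynomial.Chebyshev.U ℝ l).eval x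

theorem two_mul_chebT (l : ℕ) (x : ℝ) : 2 * chebT l x = chebU l x - chebU (l - 2) x := by
  have h := congrArg (Polynomial.eval x) (Polynomial.Chebyshev.two_mul_T_eq_U_sub_U ℝ ((l : ℤ) - 2))
  simpa [chebT, chebU] using h

theorem hasDerivAt_chebT (l : ℕ) (x : ℝ) :
    HasDerivAt (chebT (l + 1)) ((l + 1) * chebU l x) x := by
  have h := (Polynomial.Chebyshev.T ℝ ((l + 1 : ℕ) : ℤ)).hasDerivAt x
  rw [Polynomial.Chebyshev.T_derivative_eq_U] at h
  have e : Polynomial.eval x ((((l + 1 : ℕ) : ℤ) : Polynomial ℝ)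
      * Polynomial.Chebyshev.U ℝ (((l + 1 : ℕ) : ℤ) - 1)) = (l + 1) * chebU l x := by
    simp [chebU]
  rw [e] at h
  exact h

/-- For l ≥ 1 the summand is q (a_l - a_{l+2}) U_l. Summation by parts and U_l - U_{l-2} = 2 T_l
give the expansion itself, up to the two boundary terms on the right. -/
theorem sum_intRaw_chebU (q : ℝ) (a : ℕ → ℝ) (x : ℝ) (n : ℕ) :
    ∑ l ∈ Finset.range (n + 1), intRaw q a (l + 1) * ((l + 1) * chebU l x)
      = 2 * q * chebP a (n + 1) x
        - q * (a (n + 1) * chebU (n - 1) x + a (n + 2) * chebU n x) := by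
  induction n with
  | zero =>
    simp [intRaw, chebP, chebU]
    ring
  | succ n ih =>
    rw [Finset.sum_range_succ, ih, chebP, chebP, Finset.sum_range_succ _ (n + 1)]
    have h := two_mul_chebT (n + 1) x
    have e : (((n + 1 : ℕ) : ℤ) - 2) = (n : ℤ) - 1 := by push_cast; ring
    have e2 : (((n + 1 : ℕ) : ℤ) - 1) = (n : ℤ) := by push_cast; ring
    rw [e] at h
    rw [e2]
    have h3 : intRaw q a (n + 1 + 1) * ((((n + 1 : ℕ) : ℝ) + 1) * chebU ((n + 1 : ℕ) : ℤ) x)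
        = q * (a (n + 1) - a (n + 3)) * chebU ((n + 1 : ℕ) : ℤ) x := by
      have : ((n + 2 : ℕ) : ℝ) ≠ 0 := by positivity
      simp only [intRaw]
      push_cast at this ⊢
      field_simp
      ring
    rw [h3]
    linear_combination (-(q * a (n + 1))) * h

/-- The boundary terms in `sum_intRaw_chebU` vanish for a finite expansion. The factor 2q, half the
length of the piece, disappears later when the affine change of variable is differentiated. -/
theorem hasDerivAt_chebP_intCo {q : ℝ} {a : ℕ → ℝ} {v : ℝ} {n : ℕ} (hn : 1 ≤ n)
    (h : ∀ l, n ≤ l → a l = 0) (x : ℝ) :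
    HasDerivAt (chebP (intCo q a v n) (n + 1)) (2 * q * chebP a n x) x := by
  have e : chebP (intCo q a v n) (n + 1) = fun y =>
      ∑ l ∈ Finset.range n, intRaw q a (l + 1) * chebT (l + 1) y + intCo q a v n 0 := by
    funext y
    rw [chebP, Finset.sum_range_succ']
    simp only [intCo_succ, chebT_zero, mul_one]
  rw [e]
  have h1 : HasDerivAt (fun y => ∑ l ∈ Finset.range n, intRaw q a (l + 1) * chebT (l + 1) y)
      (∑ l ∈ Finset.range n, intRaw q a (l + 1) * ((l + 1) * chebU l x)) x :=
    HasDerivAt.fun_sum fun l _ => (hasDerivAt_chebT l x).const_mul _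
  obtain ⟨m, rfl⟩ := Nat.exists_eq_add_of_le' hn
  rw [sum_intRaw_chebU, h (m + 1) le_rfl, h (m + 2) (by omega)] at h1
  simpa using h1.add_const (intCo q a v (m + 1) 0)

/-- Iterated antiderivatives; `v u` is the value at the left end after `u + 1` integrations. -/
noncomputable def intIter (q : ℝ) (a : ℕ → ℝ) (v : ℕ → ℝ) (n : ℕ) : ℕ → ℕ → ℝ
  | 0 => a
  | u + 1 => intCo q (intIter q a v n u) (v u) n

theorem intIter_eq_zero {q : ℝ} {a : ℕ → ℝ} {v : ℕ → ℝ} {n m : ℕ} (h : ∀ l, m ≤ l → a l = 0) :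
    ∀ u l, m + u ≤ l → intIter q a v n u l = 0
  | 0, l, hl => h l hl
  | u + 1, l, hl => intCo_eq_zero (intIter_eq_zero h u) l hl


namespace RealRAM

/-! ### Correctness of the transforms -/

theorem exec_seq (O : Oracle) (P Q : Prog) (s : State) :
    (P ;; Q).exec O s = Q.exec O (P.exec O s) := rfl
theorem exec_setReg (O : Oracle) (r : ℕ) (e : IExp) (s : State) :
    (Prog.setReg r e).exec O s = s.setR r (e.val s) := rfl
theorem exec_skip (O : Oracle) (s : State) : Prog.skip.exec O s = s := rfl
theorem exec_ifInt (O : Oracle) (a b : IExp) (P Q : Prog) (s : State) :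
    (Prog.ifInt a b P Q).exec O s = if a.val s ≤ b.val s then P.exec O s else Q.exec O s := by
  simp only [Prog.exec]

theorem heapProg_spec (O : Oracle) (s : State) :
    ∀ g, 1 ≤ g → g ≤ 4 * s.regs 6 + 1 → (heapProg.exec O s).arr 0 g 0 = cc g := by
  have key := exec_loop_frame O [13] [0] (r := 13) (e := nodesE)
    (P := wr 0 (2 * (.reg 13 + 1)) 0 (.sqrt ((1 + rd 0 (.reg 13 + 1) 0) / 2)) ;;
      wr 0 (2 * (.reg 13 + 1) + 1) 0 (0 - rd 0 (2 * (.reg 13 + 1)) 0))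
    (s := (wr 0 1 0 0).exec O s) (by simp) (by simp) rfl
    (fun q s' => ∀ g, 1 ≤ g → g ≤ 2 * q + 1 → s'.arr 0 g 0 = cc g) ?_ ?_
  · intro g h1 h2
    refine key g h1 ?_
    simp [nodesE, exec_wr, setA_regs]
    omega
  · intro g h1 h2
    have : g = 1 := by omega
    subst this
    simp [exec_wr, setA_arr, cc_one]
  · intro q hq s' hf hI g h1 h2
    simp only [exec_seq, exec_wr]
    simp [setA_arr, setR_arr, setA_regs, setR_regs, rd_val]
    have hq1 := hI (q + 1) (by omega) (by omega)
    rw [hq1]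
    by_cases e1 : g = 2 * (q + 1) + 1
    · rw [if_pos e1, e1, cc_odd (by omega), cc_even (by omega), Real.sqrt_div' _ (by norm_num)]
    · rw [if_neg e1]
      by_cases e2 : g = 2 * (q + 1)
      · rw [if_pos e2, e2, cc_even (by omega), Real.sqrt_div' _ (by norm_num)]
      · rw [if_neg e2, hI g h1 (by omega)]

theorem powProg_spec (O : Oracle) (s : State) {r : ℕ} (h18 : r ≠ 18) (h7 : r ≠ 7) (h14 : r ≠ 14)
    (h5 : r ≠ 5) :
    ((powProg r).exec O s).regs r = 2 ^ (s.regs 7 - 1 - s.regs 14) := by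
  have key := exec_loop_frame O [r, 18] [] (r := 18) (e := .reg 7)
    (P := .ifInt (.reg 18 + .reg 14 + 2) (.reg 7) (.setReg r (.reg r + .reg r)) .skip)
    (s := s.setR r 1) (by simp; omega) (by simp) (by simp [Prog.chk])
    (fun q s' => s'.regs r = 2 ^ (min q (s.regs 7 - 1 - s.regs 14))) ?_ ?_
  · rw [powProg, exec_seq, exec_setReg]
    refine key.trans ?_
    simp only [IExp.val_reg, setR_regs, if_neg h7.symm]
    congr 1
    omega
  · simp [setR_regs]
  · intro q hq s' hf hI
    have e7 : s'.regs 7 = s.regs 7 := by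
      rw [hf.regs 7 (by simp; omega), setR_regs, if_neg h7.symm]
    have e14 : s'.regs 14 = s.regs 14 := by
      rw [hf.regs 14 (by simp; omega), setR_regs, if_neg h14.symm]
    simp only [exec_ifInt, IExp.val_add, IExp.val_reg, setR_regs, exec_setReg, exec_skip]
    simp only [e7, e14, IExp.val_two, if_true, if_neg h18]
    norm_num
    split
    · rw [setR_regs, if_pos rfl, hI, ← two_mul, ← pow_succ']
      congr 1
      omega
    · rw [setR_regs, if_neg h18, hI]
      congr 1
      omega

/-- The coefficients of the residue modulo `T_m - c`. -/
noncomputable def residue (a : ℕ → ℝ) (m : ℕ) (c : ℝ) (i : ℕ) : ℝ :=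
  if 1 ≤ i then a i - a (2 * m - i) + 2 * c * a (m + i) else a 0 + c * a m

theorem chebP_residue' {m : ℕ} (hm : 1 ≤ m) {x c : ℝ} (hx : chebT m x = c) (a : ℕ → ℝ) :
    chebP (residue a m c) m x = chebP a (2 * m) x := by
  refine chebP_residue hm hx ?_ ?_
  · simp [residue]
  · intro i h _
    simp [residue, h]

theorem stepProg_regs (O : Oracle) (s : State) (r : ℕ) :
    (stepProg.exec O s).regs r =
      if s.regs 15 ≤ s.regs 17 + 1 then
        if r = 16 then s.regs 16 + 1 else if r = 17 then 0 else s.regs r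
      else if r = 17 then s.regs 17 + 1 else s.regs r := by
  simp only [stepProg, exec_seq, exec_setReg, exec_ifInt, exec_skip, IExp.val_reg, IExp.val_add,
    IExp.val_one, IExp.val_zero, setR_regs]
  norm_num
  split <;> simp [setR_regs]
  split_ifs <;> simp_all

theorem stepProg_arr (O : Oracle) (s : State) (ρ x y : ℕ) (hρ : ρ < 16) :
    (stepProg.exec O s).arr ρ x y = s.arr ρ x y :=
  (Prog.chk_frame O (W := [16, 17]) (A := []) (by simp) stepProg rfl s).arr ρ hρ (by simp) x y

/-- For g ≥ 1 the rows 2g and 2g + 1 differ from row g, so the second write still sees the parent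
unchanged. -/
theorem evalStep_spec (O : Oracle) (s : State) (hg : 1 ≤ s.regs 16) (x y : ℕ) :
    (evalStep.exec O s).arr 1 x y =
      if x = 2 * s.regs 16 + 1 ∧ y = s.regs 17 then
        residue (s.arr 1 (s.regs 16)) (s.regs 15) (-s.arr 0 (2 * s.regs 16) 0) (s.regs 17)
      else if x = 2 * s.regs 16 ∧ y = s.regs 17 then
        residue (s.arr 1 (s.regs 16)) (s.regs 15) (s.arr 0 (2 * s.regs 16) 0) (s.regs 17)
      else s.arr 1 x y := by
  have hne : s.regs 16 ≠ 2 * s.regs 16 := by omega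
  rw [evalStep, exec_seq, stepProg_arr _ _ _ _ _ (by norm_num), exec_ifInt]
  simp only [residue]
  by_cases h1 : 1 ≤ s.regs 17
  · rw [if_pos (show (IExp.val s 1 ≤ (IExp.reg 17).val s) from h1)]
    simp only [if_pos h1]
    simp [exec_seq, exec_wr, setA_arr, setA_regs, rd_val, hne, sub_eq_add_neg]
  · have h0 : s.regs 17 = 0 := by omega
    simp [exec_seq, exec_wr, setA_arr, setA_regs, rd_val, hne, h0, sub_eq_add_neg]

theorem evalStep_regs (O : Oracle) (s : State) (r : ℕ) :
    (evalStep.exec O s).regs r =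
      if s.regs 15 ≤ s.regs 17 + 1 then
        if r = 16 then s.regs 16 + 1 else if r = 17 then 0 else s.regs r
      else if r = 17 then s.regs 17 + 1 else s.regs r := by
  rw [evalStep, exec_seq, stepProg_regs, exec_ifInt]
  split <;> rfl

/-- Counting in mixed radix: the invariant of `stepProg`. -/
theorem step_counter {m b i q : ℕ} (hi : i < m) (hq : q = b * m + i) :
    (if m ≤ i + 1 then 0 else i + 1) < m ∧
      q + 1 = (if m ≤ i + 1 then b + 1 else b) * m + (if m ≤ i + 1 then 0 else i + 1) := by
  split_ifs with h
  · have : m = i + 1 := by omega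
    refine ⟨by omega, ?_⟩
    rw [hq, add_mul]; omega
  · exact ⟨by omega, by omega⟩

/-- Uniqueness of division with remainder: the only new pair is the current one. -/
theorem pair_lt_succ {m b i b' i' : ℕ} (hi : i < m) (hi' : i' < m) :
    b' * m + i' < b * m + i + 1 ↔ b' * m + i' < b * m + i ∨ (b' = b ∧ i' = i) := by
  constructor
  · intro h
    rcases Nat.lt_or_ge (b' * m + i') (b * m + i) with h1 | h1
    · exact Or.inl h1
    · right
      have h2 : b' * m + i' = b * m + i := by omega
      have h3 : b' = b := by
        have := congrArg (· / m) h2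
        simpa [Nat.add_div_of_dvd_right, Nat.div_eq_of_lt hi, Nat.div_eq_of_lt hi',
          (Nat.zero_lt_of_lt hi)] using this
      subst h3
      exact ⟨rfl, by omega⟩
  · rintro (h | ⟨rfl, rfl⟩) <;> omega

theorem evalLevel_spec (O : Oracle) (s : State) {G : ℕ} (_hG : 1 ≤ G) (h16 : s.regs 16 = G)
    (h17 : s.regs 17 = 0) (hm : 1 ≤ s.regs 15) (h6 : s.regs 6 = G * s.regs 15) :
    ∀ b < G, ∀ i < s.regs 15,
      ((Prog.loop 13 (.reg 6) evalStep).exec O s).arr 1 (2 * (G + b)) i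
        = residue (s.arr 1 (G + b)) (s.regs 15) (s.arr 0 (2 * (G + b)) 0) i ∧
      ((Prog.loop 13 (.reg 6) evalStep).exec O s).arr 1 (2 * (G + b) + 1) i
        = residue (s.arr 1 (G + b)) (s.regs 15) (-s.arr 0 (2 * (G + b)) 0) i := by
  set m := s.regs 15 with hm'
  have key := exec_loop_frame O [13, 16, 17] [1] (r := 13) (e := .reg 6) (P := evalStep) (s := s)
    (by simp) (by simp) rfl
    -- One flat loop replaces two nested ones, with q = bm + i as clock. Nested loops would have a
    -- bound read from register `15`, which changes from level to level and spoils the static cost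
    -- bound. The rows of this level and above stay intact while the children are filled.
    (fun q s' => ∃ b i, s'.regs 16 = G + b ∧ s'.regs 17 = i ∧ i < m ∧ q = b * m + i ∧
      (∀ g < 2 * G, ∀ y, s'.arr 1 g y = s.arr 1 g y) ∧
      ∀ b' i', i' < m → b' * m + i' < q →
        s'.arr 1 (2 * (G + b')) i' = residue (s.arr 1 (G + b')) m (s.arr 0 (2 * (G + b')) 0) i' ∧
        s'.arr 1 (2 * (G + b') + 1) i'
          = residue (s.arr 1 (G + b')) m (-s.arr 0 (2 * (G + b')) 0) i') ?_ ?_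
  · obtain ⟨b, i, -, -, -, -, -, h⟩ := key
    intro b' hb' i' hi'
    refine h b' i' hi' ?_
    rw [IExp.val_reg, h6]
    calc b' * m + i' < b' * m + m := by omega
      _ = (b' + 1) * m := by ring
      _ ≤ G * m := Nat.mul_le_mul_right _ hb'
  · exact ⟨0, 0, by simpa using h16, h17, hm, by simp, fun _ _ _ => rfl, by simp⟩
  · rintro q hq s' hf ⟨b, i, e16, e17, hi, hqe, hlow, hdone⟩
    rw [IExp.val_reg, h6] at hq
    have hb : b < G := by
      by_contra hcon
      have : G * m ≤ b * m := Nat.mul_le_mul_right _ (by omega)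
      omega
    have e15 : s'.regs 15 = m := hf.regs 15 (by simp)
    have h0 : ∀ x y, s'.arr 0 x y = s.arr 0 x y := fun x y => hf.arr 0 (by simp) (by simp) x y
    have ev := evalStep_spec O (s'.setR 13 q) (by simp [setR_regs, e16]; omega)
    simp only [setR_regs, setR_arr _ (show 13 ≠ 5 by norm_num)] at ev
    norm_num at ev
    simp only [e16, e17, e15, h0] at ev
    have hrow : s'.arr 1 (G + b) = s.arr 1 (G + b) := by
      funext y; exact hlow _ (by omega) y
    rw [hrow] at ev
    have hc := step_counter hi hqe
    refine ⟨if m ≤ i + 1 then b + 1 else b, if m ≤ i + 1 then 0 else i + 1, ?_, ?_, hc.1, hc.2,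
      ?_, ?_⟩
    · rw [evalStep_regs]; simp [setR_regs, e15, e16, e17]
      split_ifs <;> rfl
    · rw [evalStep_regs]; simp [setR_regs, e15, e17]
    · intro g hg y
      rw [ev, if_neg (by omega), if_neg (by omega), hlow g hg]
    · intro b' i' hi' hlt
      rw [hqe, pair_lt_succ hi hi'] at hlt
      rw [ev, ev]
      rcases hlt with hlt | ⟨rfl, rfl⟩
      · have hne : ¬ (b' = b ∧ i' = i) := by rintro ⟨rfl, rfl⟩; omega
        rw [← hqe] at hlt
        obtain ⟨d1, d2⟩ := hdone b' i' hi' hlt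
        constructor
        · rw [if_neg (by omega), if_neg (by omega), d1]
        · rw [if_neg (by omega), if_neg (by omega), d2]
      · constructor
        · rw [if_neg (by omega), if_pos ⟨rfl, rfl⟩]
        · rw [if_pos ⟨rfl, rfl⟩]

/-- Descent in a remainder tree: at depth t, row 2^t + b holds the residue of the polynomial modulo
T_m - c, with m = 2^(h+1-t) and c the heap entry. At the leaves m = 1 and the residue is the value
at the node. -/
theorem evalProg_spec (O : Oracle) (s : State) {h : ℕ} (h7 : s.regs 7 = h + 1)
    (h6 : s.regs 6 = 2 ^ h) (hheap : ∀ g, 1 ≤ g → g < 2 ^ (h + 2) → s.arr 0 g 0 = cc g) :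
    ∀ r < 2 ^ (h + 1), (evalProg.exec O s).arr 1 (2 ^ (h + 1) + r) 0
      = chebP (s.arr 1 1) (2 ^ (h + 1)) (cc (2 ^ (h + 1) + r)) := by
  have key := exec_loop_frame O [13, 14, 15, 16, 17, 18, 19] [1] (r := 14) (e := .reg 7)
    (P := powProg 15 ;; .setReg 16 (.reg 19) ;; .setReg 17 0 ;;
      .loop 13 (.reg 6) evalStep ;; .setReg 19 (.reg 19 + .reg 19))
    (s := s.setR 19 1) (by simp) (by simp) rfl
    -- A residue is described by its values at all points where the modulus vanishes, so no division
    -- of polynomials has to be formalized.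
    (fun t s' => s'.regs 19 = 2 ^ t ∧ ∀ b < 2 ^ t, ∀ x,
      chebT (2 ^ (h + 1 - t)) x = cc (2 ^ t + b) →
      chebP (s'.arr 1 (2 ^ t + b)) (2 ^ (h + 1 - t)) x = chebP (s.arr 1 1) (2 ^ (h + 1)) x) ?_ ?_
  · intro r hr
    have hv : (IExp.reg 7).val (s.setR 19 1) = h + 1 := by simp [setR_regs, h7]
    rw [hv] at key
    have := key.2 r hr (cc (2 ^ (h + 1) + r)) (by simp)
    rw [← this]
    simp [chebP, evalProg, exec_seq, exec_setReg]
  · refine ⟨by simp [setR_regs], fun b hb x _ => ?_⟩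
    have : b = 0 := by simpa using hb
    subst this
    simp only [pow_zero, Nat.sub_zero, add_zero]
    congr 1
  · rintro t ht s' hf ⟨e19, hI⟩
    have ht' : t < h + 1 := by simpa [setR_regs, h7] using ht
    obtain ⟨m, hm⟩ : ∃ m, m = 2 ^ (h - t) := ⟨_, rfl⟩
    have hm1 : 1 ≤ m := hm ▸ Nat.one_le_two_pow
    have e2m : 2 ^ (h + 1 - t) = 2 * m := by
      rw [hm, ← pow_succ']; congr 1; omega
    have em : 2 ^ (h + 1 - (t + 1)) = m := by rw [hm]; congr 1; omega
    rw [e2m] at hI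
    rw [em]
    set G := 2 ^ t with hGdef
    have hG1 : 1 ≤ G := Nat.one_le_two_pow
    have hGm : 2 ^ h = G * m := by rw [hm, hGdef, ← pow_add]; congr 1; omega
    have e7 : s'.regs 7 = h + 1 := by rw [hf.regs 7 (by simp)]; simp [setR_regs, h7]
    have e6 : s'.regs 6 = 2 ^ h := by rw [hf.regs 6 (by simp)]; simp [setR_regs, h6]
    set s1 := (powProg 15).exec O (s'.setR 14 t) with hs1
    have hp : Fr [15, 18] [] (s'.setR 14 t) s1 :=
      Prog.chk_frame O (by simp) (powProg 15) rfl _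
    have p15 : s1.regs 15 = m := by
      rw [hs1, powProg_spec O _ (by norm_num) (by norm_num) (by norm_num) (by norm_num)]
      simp only [setR_regs]
      norm_num
      rw [hm, e7]
      congr 1
    have p19 : s1.regs 19 = G := by rw [hp.regs 19 (by simp)]; simp [setR_regs, e19]
    have p6 : s1.regs 6 = 2 ^ h := by rw [hp.regs 6 (by simp)]; simp [setR_regs, e6]
    have parr : ∀ ρ < 16, ∀ x y, s1.arr ρ x y = s'.arr ρ x y := by
      intro ρ hρ x y
      rw [hp.arr ρ hρ (by simp), setR_arr _ (by norm_num)]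
    simp only [exec_seq, exec_setReg, ← hs1]
    set s2 := (s1.setR 16 ((IExp.reg 19).val s1)).setR 17 0 with hs2
    have lev := evalLevel_spec O s2 (G := G) hG1 (by simp [hs2, setR_regs, p19])
      (by simp [hs2, setR_regs]) (by simp [hs2, setR_regs, p15, hm1])
      (by simp [hs2, setR_regs, p15, p6, hGm])
    have q15 : s2.regs 15 = m := by simp [hs2, setR_regs, p15]
    have qarr : ∀ ρ < 16, ∀ x y, s2.arr ρ x y = s'.arr ρ x y := by
      intro ρ hρ x y
      rw [hs2, setR_arr _ (by norm_num), setR_arr _ (by norm_num), parr ρ hρ]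
    rw [q15] at lev
    have hl : Fr [13, 16, 17] [1] s2 ((Prog.loop 13 (.reg 6) evalStep).exec O s2) :=
      Prog.chk_frame O (by simp) _ rfl _
    have e0 : ((IExp.val (s1.setR 16 ((IExp.reg 19).val s1)) 0)) = 0 := rfl
    rw [e0, ← hs2]
    set s3 := (Prog.loop 13 (.reg 6) evalStep).exec O s2 with hs3
    refine ⟨?_, ?_⟩
    · have : s3.regs 19 = G := by rw [hl.regs 19 (by simp), hs2]; simp [setR_regs, p19]
      simp [setR_regs, this, pow_succ, hGdef]
      ring
    · intro b hb x hx
      have hs3a : ∀ g y, (s3.setR 19 ((IExp.reg 19 + IExp.reg 19).val s3)).arr 1 g y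
          = s3.arr 1 g y := fun g y => by
        rw [setR_arr _ (by norm_num)]
      have hb2 : b / 2 < G := by rw [pow_succ] at hb; omega
      have hg1 : 1 ≤ G + b / 2 := by omega
      have hcell : s2.arr 0 (2 * (G + b / 2)) 0 = cc (2 * (G + b / 2)) := by
        rw [qarr 0 (by norm_num), hf.arr 0 (by norm_num) (by simp), setR_arr _ (by norm_num)]
        refine hheap _ (by omega) ?_
        have : 2 * G ≤ 2 ^ (h + 1) := by
          rw [hGdef, ← pow_succ']; exact Nat.pow_le_pow_right (by norm_num) (by omega)
        rw [pow_succ 2 (h + 1)]; omega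
      have hrow : s2.arr 1 (G + b / 2) = s'.arr 1 (G + b / 2) := by
        funext y; exact qarr 1 (by norm_num) _ _
      -- A zero of the child modulus is a zero of the parent modulus: T_{2m} = 2 T_m² - 1, and
      -- `cc_sq` is the same relation in the heap.
      have hsq : chebT (2 * m) x = cc (G + b / 2) := by
        rw [mul_comm, show m * 2 = 2 * m by ring, mul_comm 2 m]
        have : chebT (m * 2) x = 2 * chebT m x ^ 2 - 1 := by
          have h1 := chebT_mul_le (le_refl m) x
          simp only [Nat.sub_self, chebT_zero] at h1
          rw [mul_two]
          linarith
        rw [this, hx, cc_sq (by rw [pow_succ]; omega)]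
        congr 1
        rw [pow_succ]; omega
      rw [← hI (b / 2) hb2 x hsq]
      rcases Nat.even_or_odd' b with ⟨b', hbb⟩
      have hb' : b / 2 = b' := by omega
      rw [hb'] at hb2 hg1 hcell hrow hsq ⊢
      rcases hbb with hbb | hbb
      · have e1 : 2 ^ (t + 1) + b = 2 * (G + b') := by rw [pow_succ]; omega
        rw [e1] at hx ⊢
        rw [chebP_congr (b := residue (s'.arr 1 (G + b')) m (cc (2 * (G + b')))),
          chebP_residue' hm1 hx]
        intro l hl'
        rw [hs3a, (lev b' hb2 l hl').1, hcell, hrow]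
      · have e1 : 2 ^ (t + 1) + b = 2 * (G + b') + 1 := by rw [pow_succ]; omega
        rw [e1] at hx ⊢
        rw [cc_odd hg1] at hx
        rw [chebP_congr (b := residue (s'.arr 1 (G + b')) m (-cc (2 * (G + b')))),
          chebP_residue' hm1 hx]
        intro l hl'
        rw [hs3a, (lev b' hb2 l hl').2, hcell, hrow]

end RealRAM


/-! ### Interpolation: climbing the remainder tree -/

namespace RealRAM

/-- Reconstruction from the residues modulo `T_m - c` and `T_m + c`. -/
noncomputable def unresidue (b₀ b₁ : ℕ → ℝ) (m : ℕ) (c : ℝ) (i : ℕ) : ℝ :=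
  if i < m then
    if 1 ≤ i then (b₀ i + b₁ i) / 2 + (b₀ (m - i) - b₁ (m - i)) / (4 * c) else (b₀ 0 + b₁ 0) / 2
  else if 1 ≤ i - m then (b₀ (i - m) - b₁ (i - m)) / (4 * c) else (b₀ 0 - b₁ 0) / (2 * c)

/-- For i ≥ 1, half the sum of the residues is a_i - a_{2m-i} and their difference is 4c a_{m+i}. So
the upper half is found first, and the lower half is corrected by the entry with index m + (m - i).
-/
theorem residue_unresidue (b₀ b₁ : ℕ → ℝ) {m : ℕ} {c : ℝ} (hc : c ≠ 0) {i : ℕ} (hi : i < m) :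
    residue (unresidue b₀ b₁ m c) m c i = b₀ i ∧ residue (unresidue b₀ b₁ m c) m (-c) i = b₁ i := by
  rcases Nat.eq_zero_or_pos i with rfl | h
  · simp only [residue, unresidue]
    simp [hi]
    constructor <;> field_simp <;> ring
  · have h1 : 1 ≤ i := h
    have h2 : ¬ 2 * m - i < m := by omega
    have h3 : 2 * m - i - m = m - i := by omega
    have h4 : 1 ≤ m - i := by omega
    simp only [residue, unresidue, if_pos h1, if_pos hi, if_neg h2, h3, if_pos h4]
    simp [h1]
    constructor <;> field_simp <;> ring

/-- One step produces the two coefficients i and m + i, so a level takes as many steps as in the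
evaluation. -/
theorem fitStep_spec (O : Oracle) (s : State) (hg : 1 ≤ s.regs 16) (hi : s.regs 17 < s.regs 15)
    (x y : ℕ) :
    (fitStep.exec O s).arr 1 x y =
      if x = s.regs 16 ∧ (y = s.regs 17 ∨ y = s.regs 15 + s.regs 17) then
        unresidue (s.arr 1 (2 * s.regs 16)) (s.arr 1 (2 * s.regs 16 + 1)) (s.regs 15)
          (s.arr 0 (2 * s.regs 16) 0) y
      else s.arr 1 x y := by
  have hne : ¬ 2 * s.regs 16 = s.regs 16 := by omega
  have hne' : ¬ 2 * s.regs 16 + 1 = s.regs 16 := by omega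
  rw [fitStep, exec_seq, stepProg_arr _ _ _ _ _ (by norm_num), exec_ifInt]
  by_cases h1 : 1 ≤ s.regs 17
  · rw [if_pos (show (IExp.val s 1 ≤ (IExp.reg 17).val s) from h1)]
    simp [exec_seq, exec_wr, setA_arr, setA_regs, rd_val, hne, hne']
    by_cases hx : x = s.regs 16
    · by_cases h2 : y = s.regs 15 + s.regs 17
      · simp [hx, h2, unresidue, h1]
      · by_cases h3 : y = s.regs 17
        · have : ¬ s.regs 15 = 0 := by omega
          simp [hx, h3, unresidue, h1, hi, this]
        · simp [hx, h2, h3]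
    · simp [hx]
  · have h0 : s.regs 17 = 0 := by omega
    rw [if_neg (show ¬ (IExp.val s 1 ≤ (IExp.reg 17).val s) from h1)]
    simp [exec_seq, exec_wr, setA_arr, setA_regs, rd_val, hne, hne', h0]
    by_cases hx : x = s.regs 16
    · by_cases h2 : y = s.regs 15
      · simp [hx, h2, unresidue]
      · by_cases h3 : y = 0
        · have : ¬ 0 = s.regs 15 := by omega
          have h4 : 0 < s.regs 15 := by omega
          simp [hx, h3, unresidue, this, h4]
        · simp [hx, h2, h3]
    · simp [hx]

theorem fitStep_regs (O : Oracle) (s : State) (r : ℕ) :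
    (fitStep.exec O s).regs r =
      if s.regs 15 ≤ s.regs 17 + 1 then
        if r = 16 then s.regs 16 + 1 else if r = 17 then 0 else s.regs r
      else if r = 17 then s.regs 17 + 1 else s.regs r := by
  rw [fitStep, exec_seq, stepProg_regs, exec_ifInt]
  split <;> rfl

theorem fitLevel_spec (O : Oracle) (s : State) {G : ℕ} (_hG : 1 ≤ G) (h16 : s.regs 16 = G)
    (h17 : s.regs 17 = 0) (hm : 1 ≤ s.regs 15) (h6 : s.regs 6 = G * s.regs 15) :
    ∀ b < G, ∀ i < 2 * s.regs 15,
      ((Prog.loop 13 (.reg 6) fitStep).exec O s).arr 1 (G + b) i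
        = unresidue (s.arr 1 (2 * (G + b))) (s.arr 1 (2 * (G + b) + 1)) (s.regs 15)
          (s.arr 0 (2 * (G + b)) 0) i := by
  set m := s.regs 15 with hm'
  have key := exec_loop_frame O [13, 16, 17] [1] (r := 13) (e := .reg 6) (P := fitStep) (s := s)
    (by simp) (by simp) rfl
    (fun q s' => ∃ b i, s'.regs 16 = G + b ∧ s'.regs 17 = i ∧ i < m ∧ q = b * m + i ∧
      (∀ g, 2 * G ≤ g → ∀ y, s'.arr 1 g y = s.arr 1 g y) ∧
      ∀ b' i' y, i' < m → b' * m + i' < q → (y = i' ∨ y = m + i') →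
        s'.arr 1 (G + b') y
          = unresidue (s.arr 1 (2 * (G + b'))) (s.arr 1 (2 * (G + b') + 1)) m
            (s.arr 0 (2 * (G + b')) 0) y) ?_ ?_
  · obtain ⟨b, i, -, -, -, -, -, h⟩ := key
    intro b' hb' i' hi'
    refine h b' (if i' < m then i' else i' - m) i' (by split <;> omega) ?_ (by split <;> omega)
    rw [IExp.val_reg, h6]
    calc b' * m + (if i' < m then i' else i' - m) < b' * m + m := by split <;> omega
      _ = (b' + 1) * m := by ring
      _ ≤ G * m := Nat.mul_le_mul_right _ hb'
  · exact ⟨0, 0, by simpa using h16, h17, hm, by simp, fun _ _ _ => rfl, by simp⟩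
  · rintro q hq s' hf ⟨b, i, e16, e17, hi, hqe, hlow, hdone⟩
    rw [IExp.val_reg, h6] at hq
    have hb : b < G := by
      by_contra hcon
      have : G * m ≤ b * m := Nat.mul_le_mul_right _ (by omega)
      omega
    have e15 : s'.regs 15 = m := hf.regs 15 (by simp)
    have h0 : ∀ x y, s'.arr 0 x y = s.arr 0 x y := fun x y => hf.arr 0 (by simp) (by simp) x y
    have ev := fitStep_spec O (s'.setR 13 q) (by simp [setR_regs, e16]; omega)
      (by simp [setR_regs, e17, e15, hi])
    simp only [setR_regs, setR_arr _ (show 13 ≠ 5 by norm_num)] at ev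
    norm_num at ev
    simp only [e16, e17, e15, h0] at ev
    have hrow : s'.arr 1 (2 * (G + b)) = s.arr 1 (2 * (G + b)) := by
      funext y; exact hlow _ (by omega) y
    have hrow' : s'.arr 1 (2 * (G + b) + 1) = s.arr 1 (2 * (G + b) + 1) := by
      funext y; exact hlow _ (by omega) y
    rw [hrow, hrow'] at ev
    have hc := step_counter hi hqe
    refine ⟨if m ≤ i + 1 then b + 1 else b, if m ≤ i + 1 then 0 else i + 1, ?_, ?_, hc.1, hc.2,
      ?_, ?_⟩
    · rw [fitStep_regs]; simp [setR_regs, e15, e16, e17]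
      split_ifs <;> rfl
    · rw [fitStep_regs]; simp [setR_regs, e15, e17]
    · intro g hg y
      rw [ev, if_neg (by omega), hlow g hg]
    · intro b' i' y hi' hlt hy
      rw [hqe, pair_lt_succ hi hi'] at hlt
      rw [ev]
      rcases hlt with hlt | ⟨rfl, rfl⟩
      · have hne : ¬ (b' = b ∧ i' = i) := by rintro ⟨rfl, rfl⟩; omega
        rw [← hqe] at hlt
        rw [if_neg (by omega), hdone b' i' y hi' hlt hy]
      · rw [if_pos ⟨rfl, hy⟩]

/-- Only the interpolation property at the nodes is recorded; by `chebP_filter` the filtered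
polynomial depends on nothing else, so uniqueness of the coefficients is not needed. -/
theorem fitProg_spec (O : Oracle) (s : State) {h : ℕ} (h7 : s.regs 7 = h + 1)
    (h6 : s.regs 6 = 2 ^ h) (hheap : ∀ g, 1 ≤ g → g < 2 ^ (h + 2) → s.arr 0 g 0 = cc g) :
    ∀ r < 2 ^ (h + 1), chebP ((fitProg.exec O s).arr 1 1) (2 ^ (h + 1)) (cc (2 ^ (h + 1) + r))
      = s.arr 1 (2 ^ (h + 1) + r) 0 := by
  have key := exec_loop_frame O [13, 14, 15, 16, 17, 18, 19] [1] (r := 14) (e := .reg 7)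
    (P := powProg 19 ;; .setReg 16 (.reg 19) ;; .setReg 17 0 ;;
      .loop 13 (.reg 6) fitStep ;; .setReg 15 (.reg 15 + .reg 15))
    (s := s.setR 15 1) (by simp) (by simp) rfl
    -- The ancestor of leaf r at height t has a polynomial of length 2^t with the prescribed value
    -- at each leaf below it.
    (fun t s' => s'.regs 15 = 2 ^ t ∧ ∀ r < 2 ^ (h + 1),
      chebP (s'.arr 1 (2 ^ (h + 1 - t) + r / 2 ^ t)) (2 ^ t) (cc (2 ^ (h + 1) + r))
        = s.arr 1 (2 ^ (h + 1) + r) 0) ?_ ?_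
  · intro r hr
    have hv : (IExp.reg 7).val (s.setR 15 1) = h + 1 := by simp [setR_regs, h7]
    rw [hv] at key
    have := key.2 r hr
    rw [Nat.sub_self, Nat.div_eq_of_lt hr] at this
    exact this
  · refine ⟨by simp [setR_regs], fun r hr => ?_⟩
    simp [chebP, setR_arr]
  · rintro t ht s' hf ⟨e15, hI⟩
    have ht' : t < h + 1 := by simpa [setR_regs, h7] using ht
    set m := 2 ^ t with hm
    have hm1 : 1 ≤ m := Nat.one_le_two_pow
    obtain ⟨G, hGdef⟩ : ∃ G, G = 2 ^ (h - t) := ⟨_, rfl⟩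
    have hG1 : 1 ≤ G := hGdef ▸ Nat.one_le_two_pow
    have e2G : 2 ^ (h + 1 - t) = 2 * G := by
      rw [hGdef, ← pow_succ']; congr 1; omega
    have eG : 2 ^ (h + 1 - (t + 1)) = G := by rw [hGdef]; congr 1; omega
    have hGm : 2 ^ h = G * m := by rw [hm, hGdef, ← pow_add]; congr 1; omega
    rw [e2G] at hI
    have e7 : s'.regs 7 = h + 1 := by rw [hf.regs 7 (by simp)]; simp [setR_regs, h7]
    have e6 : s'.regs 6 = 2 ^ h := by rw [hf.regs 6 (by simp)]; simp [setR_regs, h6]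
    set s1 := (powProg 19).exec O (s'.setR 14 t) with hs1
    have hp : Fr [19, 18] [] (s'.setR 14 t) s1 :=
      Prog.chk_frame O (by simp) (powProg 19) rfl _
    have p19 : s1.regs 19 = G := by
      rw [hs1, powProg_spec O _ (by norm_num) (by norm_num) (by norm_num) (by norm_num)]
      simp only [setR_regs]
      norm_num
      rw [hGdef, e7]
      congr 1
    have p15 : s1.regs 15 = m := by rw [hp.regs 15 (by simp)]; simp [setR_regs, e15]
    have p6 : s1.regs 6 = 2 ^ h := by rw [hp.regs 6 (by simp)]; simp [setR_regs, e6]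
    have parr : ∀ ρ < 16, ∀ x y, s1.arr ρ x y = s'.arr ρ x y := by
      intro ρ hρ x y
      rw [hp.arr ρ hρ (by simp), setR_arr _ (by norm_num)]
    simp only [exec_seq, exec_setReg, ← hs1]
    set s2 := (s1.setR 16 ((IExp.reg 19).val s1)).setR 17 0 with hs2
    have lev := fitLevel_spec O s2 (G := G) hG1 (by simp [hs2, setR_regs, p19])
      (by simp [hs2, setR_regs]) (by simp [hs2, setR_regs, p15, hm1])
      (by simp [hs2, setR_regs, p15, p6, hGm])
    have q15 : s2.regs 15 = m := by simp [hs2, setR_regs, p15]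
    have qarr : ∀ ρ < 16, ∀ x y, s2.arr ρ x y = s'.arr ρ x y := by
      intro ρ hρ x y
      rw [hs2, setR_arr _ (by norm_num), setR_arr _ (by norm_num), parr ρ hρ]
    rw [q15] at lev
    have hl : Fr [13, 16, 17] [1] s2 ((Prog.loop 13 (.reg 6) fitStep).exec O s2) :=
      Prog.chk_frame O (by simp) _ rfl _
    have e0 : ((IExp.val (s1.setR 16 ((IExp.reg 19).val s1)) 0)) = 0 := rfl
    rw [e0, ← hs2]
    set s3 := (Prog.loop 13 (.reg 6) fitStep).exec O s2 with hs3
    refine ⟨?_, ?_⟩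
    · have : s3.regs 15 = m := by rw [hl.regs 15 (by simp), q15]
      simp [setR_regs, this, pow_succ, hm]
      ring
    · intro r hr
      rw [setR_arr _ (by norm_num), eG]
      obtain ⟨b, hb⟩ : ∃ b, b = r / 2 ^ (t + 1) := ⟨_, rfl⟩
      rw [← hb]
      have hbr : b = r / m / 2 := by rw [hb, pow_succ, Nat.div_div_eq_div_mul]
      have hbG : b < G := by
        rw [hb]
        refine Nat.div_lt_of_lt_mul ?_
        calc r < 2 ^ (h + 1) := hr
          _ = 2 ^ (t + 1) * G := by rw [pow_succ, pow_succ, hGm, hm]; ring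
      set x := cc (2 ^ (h + 1) + r) with hx
      have hleaf : chebT m x = cc (2 * G + r / m) := by
        have := chebT_leaf (h := h + 1) (t := h + 1 - t) (r := r) (by omega)
        rw [show h + 1 - (h + 1 - t) = t by omega, e2G] at this
        exact this
      have hcell : s2.arr 0 (2 * (G + b)) 0 = cc (2 * (G + b)) := by
        rw [qarr 0 (by norm_num), hf.arr 0 (by norm_num) (by simp), setR_arr _ (by norm_num)]
        refine hheap _ (by omega) ?_
        have : 2 * G ≤ 2 ^ (h + 1) := by
          rw [hGdef, ← pow_succ']; exact Nat.pow_le_pow_right (by norm_num) (by omega)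
        rw [pow_succ 2 (h + 1)]; omega
      have hc0 : cc (2 * (G + b)) ≠ 0 := (cc_even_pos (by omega)).ne'
      rw [pow_succ, mul_comm, chebP_congr (lev b hbG), hcell]
      -- The parity of the ancestor tells whether T_m takes the value c or -c at this leaf, hence
      -- which of the two residues applies.
      rcases Nat.mod_two_eq_zero_or_one (r / m) with hpar | hpar
      · have e1 : 2 * G + r / m = 2 * (G + b) := by omega
        rw [e1] at hleaf
        rw [← chebP_residue' hm1 hleaf, ← hI r hr, e1]
        refine chebP_congr (fun l hl' => ?_) x
        rw [(residue_unresidue _ _ hc0 hl').1, qarr 1 (by norm_num)]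
      · have e1 : 2 * G + r / m = 2 * (G + b) + 1 := by omega
        rw [e1, cc_odd (by omega)] at hleaf
        rw [← chebP_residue' hm1 hleaf, ← hI r hr, e1]
        refine chebP_congr (fun l hl' => ?_) x
        rw [(residue_unresidue _ _ hc0 hl').2, qarr 1 (by norm_num)]

end RealRAM


namespace RealRAM

/-! ### Correctness of the treatment of one coordinate -/

theorem mul_add_inj {d u c u' c' : ℕ} (hc : c < d) (hc' : c' < d) (h : u * d + c = u' * d + c') :
    u = u' ∧ c = c' := by
  have := (pair_lt_succ hc' hc (b := u') (b' := u)).1 (by omega)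
  rcases this with h1 | h1
  · omega
  · exact h1

/-- A loop filling cells of one array. -/
theorem fill_loop (O : Oracle) {ρ r : ℕ} {e ex ey : IExp} {rhs : RExp} {s : State} (hr : r ≠ 5)
    (hρ : ρ < 16) (hin : (cellE ρ ex ey).inArr [ρ] = true) (X Y : ℕ → ℕ) (V : ℕ → ℝ)
    (inj : ∀ i < e.val s, ∀ j < e.val s, X i = X j → Y i = Y j → i = j)
    (h : ∀ i < e.val s, ∀ s', Fr [r] [ρ] s s' →
      (∀ x y, (∀ i' < e.val s, ¬ (x = X i' ∧ y = Y i')) → s'.arr ρ x y = s.arr ρ x y) →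
      ex.val (s'.setR r i) = X i ∧ ey.val (s'.setR r i) = Y i ∧ rhs.val (s'.setR r i) = V i) :
    (∀ i < e.val s, ((Prog.loop r e (wr ρ ex ey rhs)).exec O s).arr ρ (X i) (Y i) = V i) ∧
    ∀ x y, (∀ i < e.val s, ¬ (x = X i ∧ y = Y i)) →
      ((Prog.loop r e (wr ρ ex ey rhs)).exec O s).arr ρ x y = s.arr ρ x y := by
  refine exec_loop_frame O [r] [ρ] (s := s) (by simpa using hr.symm) (by simp)
    (by simpa [wr, Prog.chk] using hin)
    (fun q s' => (∀ i < q, s'.arr ρ (X i) (Y i) = V i) ∧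
      ∀ x y, (∀ i < e.val s, ¬ (x = X i ∧ y = Y i)) → s'.arr ρ x y = s.arr ρ x y) ?_ ?_
  · exact ⟨by simp, fun _ _ _ => rfl⟩
  · rintro q hq s' hf ⟨h1, h2⟩
    obtain ⟨e1, e2, e3⟩ := h q hq s' hf h2
    rw [exec_wr, e1, e2, e3]
    refine ⟨fun i hi => ?_, fun x y hxy => ?_⟩
    · rw [setA_arr _ hρ hρ]
      rcases Nat.lt_succ_iff_lt_or_eq.1 hi with hi' | rfl
      · rw [if_neg, setR_arr _ hr, h1 i hi']
        rintro ⟨-, a1, a2⟩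
        have := inj i (hi'.trans hq) q hq a1 a2
        omega
      · rw [if_pos ⟨rfl, rfl, rfl⟩]
    · rw [setA_arr _ hρ hρ, if_neg (fun hh => hxy q hq hh.2), setR_arr _ hr, h2 x y hxy]

theorem intProg_spec (O : Oracle) (s : State) {j c u k d n : ℕ} (h9 : s.regs 9 = j)
    (h11 : s.regs 11 = c) (h12 : s.regs 12 = u) (h0 : s.regs 0 = k) (h1 : s.regs 1 = d)
    (hn : n = 2 * s.regs 6 + k) (hj : j + 1 < s.regs 5) (hn1 : 1 ≤ n) {q : ℝ}
    (hq : q = (s.reals (j + 1) - s.reals j) / 4) {a : ℕ → ℝ}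
    (ha : ∀ l ≤ n + 1, s.arr 2 u l = a l) (ha0 : ∀ l, n ≤ l → a l = 0) :
    (∀ l ≤ n + 1, (intProg.exec O s).arr 2 (u + 1) l = intCo q a (s.arr 5 j (u * d + c)) n l) ∧
    (intProg.exec O s).arr 5 (j + 1) (u * d + c)
      = chebP (intCo q a (s.arr 5 j (u * d + c)) n) (n + 1) 1 ∧
    (∀ x y, ¬ (x = j + 1 ∧ y = u * d + c) → (intProg.exec O s).arr 5 x y = s.arr 5 x y) := by
  set v := s.arr 5 j (u * d + c) with hv
  set s1 := intHead.exec O s with hs1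
  have f1 : Fr [] [2, 7] s s1 := Prog.chk_frame O (by simp) intHead rfl s
  have key := exec_loop_frame O [13] [2, 7] (r := 13) (e := nodesE + .reg 0) (P := intBody)
    (s := s1) (by simp) (by simp) rfl
    (fun m s' => (∀ l, 1 ≤ l → l ≤ m → s'.arr 2 (u + 1) l = intRaw q a l) ∧
      s'.arr 2 (u + 1) (n + 1) = 0 ∧ (∀ l ≤ n + 1, s'.arr 2 u l = a l) ∧
      s'.arr 7 0 1 = (-1) ^ m ∧
      s'.arr 7 0 0 = v - ∑ i ∈ Finset.range m, (-1) ^ (i + 1) * intRaw q a (i + 1) ∧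
      s'.arr 7 0 2 = ∑ i ∈ Finset.range m, intRaw q a (i + 1)) ?_ ?_
  · have hval : (nodesE + .reg 0 : IExp).val s1 = n := by
      simp [nodesE, f1.regs 6, f1.regs 0, h0, hn]
    rw [hval] at key
    set s2 := (Prog.loop 13 (nodesE + .reg 0) intBody).exec O s1 with hs2
    have f2 : Fr [13] [2, 7] s1 s2 := Prog.chk_frame O (by simp)
      (Prog.loop 13 (nodesE + .reg 0) intBody) rfl s1
    have e : intProg.exec O s = (wr 5 (.reg 9 + 1) (compE (.reg 12)) (rd 7 0 0 + rd 7 0 2)).exec O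
      ((wr 2 (.reg 12 + 1) 0 (rd 7 0 0)).exec O s2) := rfl
    obtain ⟨k1, k2, k3, k4, k5, k6⟩ := key
    have g12 : s2.regs 12 = u := by rw [f2.regs 12 (by simp), f1.regs 12 (by simp), h12]
    have g9 : s2.regs 9 = j := by rw [f2.regs 9 (by simp), f1.regs 9 (by simp), h9]
    have g11 : s2.regs 11 = c := by rw [f2.regs 11 (by simp), f1.regs 11 (by simp), h11]
    have g1 : s2.regs 1 = d := by rw [f2.regs 1 (by simp), f1.regs 1 (by simp), h1]
    have g5 : ∀ x y, s2.arr 5 x y = s.arr 5 x y := fun x y => by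
      rw [f2.arr 5 (by simp) (by simp), f1.arr 5 (by simp) (by simp)]
    rw [e]
    simp [exec_wr, setA_arr, setA_regs, rd_val, compE, g12, g9, g11, g1, k5, k6, g5]
    refine ⟨fun l hl => ?_, ?_, ?_⟩
    · rcases Nat.eq_zero_or_pos l with rfl | hpos
      · simp [intCo]
      · rw [if_neg (by omega), intCo, if_neg (by omega)]
        -- The formula gives 0 at index n + 1, matching the cell cleared by `intHead`.
        rcases Nat.lt_or_ge n l with h | h
        · obtain rfl : l = n + 1 := by omega
          rw [k2]
          obtain ⟨m, rfl⟩ := Nat.exists_eq_add_of_le' hn1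
          simp [intRaw, ha0 (m + 1) le_rfl, ha0 (m + 3) (by omega)]
        · exact k1 l hpos h
    · rw [chebP_intCo_right]
      simp [intCo]
    · intro x y h h1 h2
      exact absurd h2 (h h1)
  · simp [hs1, intHead, exec_seq, exec_wr, setA_arr, setA_regs, rd_val, compE, nodesE, h12, h9, h11, h1, h0, ← hn]
    exact ⟨fun l h1 h2 => by omega, ha, rfl⟩
  · rintro m hm s' hf ⟨k1, k2, k3, k4, k5, k6⟩
    have hmn : m < n := by
      simpa [nodesE, f1.regs 6, f1.regs 0, h0, hn] using hm
    have g12 : s'.regs 12 = u := by rw [hf.regs 12 (by simp), f1.regs 12 (by simp), h12]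
    have g9 : s'.regs 9 = j := by rw [hf.regs 9 (by simp), f1.regs 9 (by simp), h9]
    have g5 : s1.regs 5 = s.regs 5 := f1.regs 5 (by simp)
    have hqv : quarterE.val (s'.setR 13 m) = q := by
      simp [quarterE, setR_regs, setR_reals, g9]
      rw [hf.low _ (by rw [g5]; omega), hf.low _ (by rw [g5]; omega), f1.low _ (by omega),
        f1.low _ (by omega), hq]
    set s2 := intCoef.exec O (s'.setR 13 m) with hs2
    have hs2' : s2 = (s'.setR 13 m).setA 2 (u + 1) (m + 1) (intRaw q a (m + 1)) := by
      rw [hs2, intCoef, exec_ifInt]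
      rcases Nat.eq_zero_or_pos m with rfl | hpos
      · rw [if_neg (by simp [setR_regs])]
        rw [exec_wr]
        simp [hqv, setR_regs, g12, rd_val, setR_arr, intRaw, k3 0 (by omega), k3 2 (by omega)]
      · rw [if_pos (by simp [setR_regs]; omega)]
        obtain ⟨m, rfl⟩ := Nat.exists_eq_add_of_le' hpos
        rw [exec_wr]
        simp [hqv, setR_regs, g12, rd_val, setR_arr, intRaw, k3 (m + 1) (by omega),
          k3 (m + 1 + 2) (by omega)]
        norm_num [add_assoc]
    rw [intBody, exec_seq, ← hs2, hs2']
    simp [exec_seq, exec_wr, setA_arr, setA_regs, rd_val, setR_arr, setR_regs, g12, k4, k5, k6, k2]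
    refine ⟨fun l h1 h2 => ?_, fun h => by omega, k3, ?_, ?_, ?_⟩
    · split_ifs with h
      · rw [h]
      · exact k1 l h1 (by omega)
    · rw [pow_succ]; ring
    · rw [Finset.sum_range_succ, pow_succ]; ring
    · rw [Finset.sum_range_succ]

/-- The antiderivative has up to k + 1 coefficients beyond the M that the tree can process. From the
top down, coefficient l is moved with opposite sign to |2M - l| by `chebT_fold`, which changes no
value at roots of T_M. -/
theorem foldProg_spec (O : Oracle) (s : State) {u k M n : ℕ} (h12 : s.regs 12 = u)
    (h0 : s.regs 0 = k) (hM : M = 2 * s.regs 6) (hn : n = M + k) (hM1 : 1 ≤ M) {x : ℝ} (hx : chebT M x = 0) :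
    chebP ((foldProg.exec O s).arr 1 1) M x = chebP (s.arr 2 (u + 1)) (n + 1) x := by
  set L1 := Prog.loop 13 (nodesE + .reg 0 + 1) (wr 1 0 (.reg 13) (rd 2 (.reg 12 + 1) (.reg 13)))
    with hL1
  set L2 := Prog.loop 13 (.reg 0)
    (.setReg 18 (nodesE + .reg 0 - .reg 13) ;;
      .setReg 17 ((2 * nodesE - .reg 18) + (.reg 18 - 2 * nodesE)) ;;
      wr 1 0 (.reg 17) (rd 1 0 (.reg 17) - rd 1 0 (.reg 18))) with hL2
  set L3 := Prog.loop 13 nodesE (wr 1 1 (.reg 13) (rd 1 0 (.reg 13))) with hL3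
  have e : foldProg.exec O s = L3.exec O (L2.exec O (L1.exec O s)) := rfl
  have f1 : Fr [13] [1] s (L1.exec O s) := Prog.chk_frame O (by simp) L1 rfl s
  have f2 : Fr [13, 17, 18] [1] (L1.exec O s) (L2.exec O (L1.exec O s)) :=
    Prog.chk_frame O (by simp) L2 rfl _
  have hv1 : (nodesE + .reg 0 + 1 : IExp).val s = n + 1 := by
    simp [nodesE, h0, hn, hM]
  have c1 := (fill_loop O (e := nodesE + .reg 0 + 1) (ex := 0) (ey := .reg 13) (r := 13) (ρ := 1)
    (rhs := rd 2 (.reg 12 + 1) (.reg 13)) (s := s) (by simp) (by simp) rfl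
    (fun _ => 0) id (fun i => s.arr 2 (u + 1) i) (by simp) (fun i hi s' hf _ => by
      have : s'.regs 12 = u := by rw [hf.regs 12 (by simp), h12]
      simp [setR_regs, rd_val, setR_arr, this, hf.arr 2])).1
  rw [hv1, ← hL1] at c1
  have c2 := exec_loop_frame O [13, 17, 18] [1] (r := 13) (e := .reg 0)
    (P := .setReg 18 (nodesE + .reg 0 - .reg 13) ;;
      .setReg 17 ((2 * nodesE - .reg 18) + (.reg 18 - 2 * nodesE)) ;;
      wr 1 0 (.reg 17) (rd 1 0 (.reg 17) - rd 1 0 (.reg 18))) (s := L1.exec O s)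
    (by simp) (by simp) rfl
    (fun q s' => chebP (s'.arr 1 0) (n + 1 - q) x = chebP (s.arr 2 (u + 1)) (n + 1) x) ?_ ?_
  · rw [← hL2, IExp.val_reg, f1.regs 0 (by simp), h0] at c2
    set s2 := L2.exec O (L1.exec O s) with hs2
    have g6 : s2.regs 6 = s.regs 6 := by rw [f2.regs 6 (by simp), f1.regs 6 (by simp)]
    have hv3 : nodesE.val s2 = M := by simp [nodesE, g6, hM]
    have c3 := (fill_loop O (e := nodesE) (ex := 1) (ey := .reg 13) (r := 13) (ρ := 1)
      (rhs := rd 1 0 (.reg 13)) (s := s2) (by simp) (by simp) rfl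
      (fun _ => 1) id (fun i => s2.arr 1 0 i) (by simp) (fun i hi s' hf h => by
        simp [setR_regs, rd_val, setR_arr]
        exact h 0 i (by simp))).1
    rw [hv3, ← hL3, ← e] at c3
    rw [chebP_congr (a := (foldProg.exec O s).arr 1 1) c3, ← c2, show n + 1 - k = M + 1 by omega]
    -- The k moves stop above index M; that coefficient needs no move since T_M vanishes here.
    rw [chebP, chebP, Finset.sum_range_succ, hx, mul_zero, add_zero]
  · exact chebP_congr (fun l hl => c1 l hl) x
  · intro q hq s' hf hI
    rw [IExp.val_reg, f1.regs 0 (by simp), h0] at hq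
    have g6 : s'.regs 6 = s.regs 6 := by rw [hf.regs 6 (by simp), f1.regs 6 (by simp)]
    have g0 : s'.regs 0 = k := by rw [hf.regs 0 (by simp), f1.regs 0 (by simp), h0]
    rw [← hI]
    obtain ⟨l, hl⟩ : ∃ l, l = n - q := ⟨_, rfl⟩
    have e1 : n + 1 - (q + 1) = l := by omega
    have e2 : n + 1 - q = l + 1 := by omega
    rw [e1, e2]
    simp only [exec_seq, exec_wr, exec_setReg]
    obtain ⟨w, hw⟩ : ∃ w, w = (2 * M - l) + (l - 2 * M) := ⟨_, rfl⟩
    -- The target lies below l because l > M ≥ 1, so the expansion really becomes shorter; for k > M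
    -- the same coefficient may be folded several times.
    have hwl : w < l := by omega
    have ha : ∀ y, ((((s'.setR 13 q).setR 18 l).setR 17 w).setA 1 0 w
        (s'.arr 1 0 w - s'.arr 1 0 l)).arr 1 0 y
        = s'.arr 1 0 y - if y = w then s'.arr 1 0 l else 0 := by
      intro y
      simp [setA_arr, setR_arr]
      split_ifs with h
      · rw [h]
      · simp
    have e18 : (nodesE + .reg 0 - .reg 13 : IExp).val (s'.setR 13 q) = l := by
      simp [nodesE, setR_regs, g6, g0, hl, hn, hM]
    have e17 : ((2 * nodesE - .reg 18) + (.reg 18 - 2 * nodesE) : IExp).val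
        ((s'.setR 13 q).setR 18 l) = w := by
      simp [nodesE, setR_regs, g6, hw, hM]
    simp only [e18, e17]
    have e3 : ((((s'.setR 13 q).setR 18 l).setR 17 w).setA 1 (IExp.val
        (((s'.setR 13 q).setR 18 l).setR 17 w) 0) ((IExp.reg 17).val
        (((s'.setR 13 q).setR 18 l).setR 17 w)) ((rd 1 0 (.reg 17) - rd 1 0 (.reg 18)).val
        (((s'.setR 13 q).setR 18 l).setR 17 w))) = ((((s'.setR 13 q).setR 18 l).setR 17 w).setA 1 0 w
        (s'.arr 1 0 w - s'.arr 1 0 l)) := by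
      simp [setR_regs, rd_val, setR_arr]
    rw [e3, chebP, chebP, Finset.sum_range_succ]
    simp only [ha, sub_mul, Finset.sum_sub_distrib, ite_mul, zero_mul]
    rw [Finset.sum_ite_eq', if_pos (by simpa using hwl), chebT_fold hx (show M ≤ l by omega), ← hw]
    ring

theorem storeProg_spec (O : Oracle) (s : State) {M p : ℕ} (hM : M = 2 * s.regs 6)
    (hp : p = (s.regs 0 - (s.regs 12 + 1)) * s.regs 1 + s.regs 11) :
    (∀ r < M, (storeProg.exec O s).arr 4 r p = s.arr 1 (M + r) 0) ∧
    ∀ x y, y ≠ p → (storeProg.exec O s).arr 4 x y = s.arr 4 x y := by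
  have hv : nodesE.val s = M := by simp [nodesE, hM]
  have c := fill_loop O (e := nodesE) (ex := .reg 13) (ey := compE (.reg 0 - (.reg 12 + 1)))
    (r := 13) (ρ := 4) (rhs := rd 1 (nodesE + .reg 13) 0) (s := s) (by simp) (by simp) rfl
    id (fun _ => p) (fun i => s.arr 1 (M + i) 0) (by simp) (fun i hi s' hf _ => by
      simp [setR_regs, rd_val, setR_arr, nodesE, compE, hf.regs, hf.arr 1, hp, hM])
  rw [hv] at c
  exact ⟨c.1, fun x y h => c.2 x y fun i _ hh => h hh.2⟩

end RealRAM


namespace RealRAM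

/-- The parameters of a piece, as stored in the registers and in the low memory. -/
structure PieceParams (s : State) (k d j h : ℕ) (α β : ℝ) : Prop where
  r0 : s.regs 0 = k
  r1 : s.regs 1 = d
  r6 : s.regs 6 = 2 ^ h
  r7 : s.regs 7 = h + 1
  r9 : s.regs 9 = j
  hlow : j + 1 < s.regs 5
  left : s.reals j = α
  right : s.reals (j + 1) = β

theorem PieceParams.fr {s s' : State} {k d j h : ℕ} {α β : ℝ} (p : PieceParams s k d j h α β)
    {W A : List ℕ} (hf : Fr W A s s') (hW : ∀ r ∈ W, 10 ≤ r) : PieceParams s' k d j h α β := by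
  have key : ∀ r < 10, s'.regs r = s.regs r := fun r hr =>
    hf.regs r fun hm => by have := hW r hm; omega
  have hl := p.hlow
  exact ⟨(key 0 (by norm_num)).trans p.r0, (key 1 (by norm_num)).trans p.r1,
    (key 6 (by norm_num)).trans p.r6, (key 7 (by norm_num)).trans p.r7,
    (key 9 (by norm_num)).trans p.r9, by rw [key 5 (by norm_num)]; exact hl,
    (hf.low _ (by omega)).trans p.left, (hf.low _ hl).trans p.right⟩

/-- The coefficients of the `k`-th derivative on piece `j`, coordinate `c`. -/
noncomputable def pieceCo (s : State) (d j h c : ℕ) (l : ℕ) : ℝ :=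
  if l < 2 ^ (h + 1) then s.arr 3 j (l * d + c) else 0

/-- The coefficients of the antiderivatives on piece `j`, coordinate `c`. -/
noncomputable def rowCo (s : State) (k d j h : ℕ) (α β : ℝ) (c u : ℕ) : ℕ → ℝ :=
  intIter ((β - α) / 4) (pieceCo s d j h c) (fun u => s.arr 5 j (u * d + c)) (2 ^ (h + 1) + k) u

/-- After u + 1 integrations the row stands for the derivative of order k - (u + 1), which explains
the reversed slots in array `4`. The last two clauses confine writes to the column of coordinate c
and to row j + 1 of array `5`, so coordinates and pieces do not interfere. -/
theorem coordProg_spec (O : Oracle) (s : State) {k d j h c : ℕ} {α β : ℝ}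
    (p : PieceParams s k d j h α β) (hd : 0 < d) (hc : s.regs 11 = c)
    (hheap : ∀ g, 1 ≤ g → g < 2 ^ (h + 2) → s.arr 0 g 0 = cc g) :
    (∀ u < k, ∀ r < 2 ^ (h + 1), (coordProg.exec O s).arr 4 r ((k - (u + 1)) * d + c)
      = chebP (rowCo s k d j h α β c (u + 1)) (2 ^ (h + 1) + k + 1) (cc (2 ^ (h + 1) + r))) ∧
    (∀ u < k, (coordProg.exec O s).arr 5 (j + 1) (u * d + c)
      = chebP (rowCo s k d j h α β c (u + 1)) (2 ^ (h + 1) + k + 1) 1) ∧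
    (∀ l < 2 ^ (h + 1) + k, (coordProg.exec O s).arr 8 0 (l * d + c)
      = rowCo s k d j h α β c k l) ∧
    (∀ ρ < 16, ρ = 4 ∨ ρ = 5 ∨ ρ = 8 → ∀ x y, (∀ u, y ≠ u * d + c) →
      (coordProg.exec O s).arr ρ x y = s.arr ρ x y) ∧
    (∀ x y, x ≠ j + 1 → (coordProg.exec O s).arr 5 x y = s.arr 5 x y) := by
  set M := 2 ^ (h + 1) with hMdef
  have hM2 : M = 2 * 2 ^ h := by rw [hMdef, pow_succ, mul_comm]
  have hM1 : 1 ≤ M := Nat.one_le_two_pow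
  set n := M + k with hn
  set L1 := Prog.loop 13 (nodesE + .reg 0 + 2)
    (.ifInt (.reg 13 + 1) nodesE (wr 2 0 (.reg 13) (rd 3 (.reg 9) (compE (.reg 13))))
      (wr 2 0 (.reg 13) 0)) with hL1
  set L2 := Prog.loop 12 (.reg 0) (intProg ;; foldProg ;; evalProg ;; storeProg) with hL2
  set L3 := Prog.loop 13 (nodesE + .reg 0) (wr 8 0 (compE (.reg 13)) (rd 2 (.reg 0) (.reg 13)))
    with hL3
  set s1 := L1.exec O s with hs1
  set s2 := L2.exec O s1 with hs2
  have e : coordProg.exec O s = L3.exec O s2 := rfl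
  have f1 : Fr [13] [2] s s1 := Prog.chk_frame O (by simp) L1 rfl s
  have f2 : Fr [12, 13, 14, 15, 16, 17, 18, 19] [1, 2, 4, 5, 7] s1 s2 :=
    Prog.chk_frame O (by simp) L2 rfl s1
  have f3 : Fr [13] [8] s2 (L3.exec O s2) := Prog.chk_frame O (by simp) L3 rfl s2
  have p1 := p.fr f1 (by simp)
  have p2 := p1.fr f2 (by simp)
  have hc1 : s1.regs 11 = c := by rw [f1.regs 11 (by simp), hc]
  have hc2 : s2.regs 11 = c := by rw [f2.regs 11 (by simp), hc1]
  have hv : ∀ l, s1.arr 5 j l = s.arr 5 j l := fun l => f1.arr 5 (by simp) (by simp) _ _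
  have hzero : ∀ u l, M + u ≤ l → rowCo s k d j h α β c u l = 0 := fun u l =>
    intIter_eq_zero (fun l hl => by simp [pieceCo, ← hMdef, hl]) u l
  have b1 : ∀ l ≤ n + 1, s1.arr 2 0 l = rowCo s k d j h α β c 0 l := by
    have key := exec_loop_frame O [13] [2] (r := 13) (e := nodesE + .reg 0 + 2)
      (P := .ifInt (.reg 13 + 1) nodesE (wr 2 0 (.reg 13) (rd 3 (.reg 9) (compE (.reg 13))))
        (wr 2 0 (.reg 13) 0)) (s := s) (by simp) (by simp) rfl
      (fun q s' => ∀ l < q, s'.arr 2 0 l = rowCo s k d j h α β c 0 l) (by simp) ?_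
    · have : (nodesE + .reg 0 + 2 : IExp).val s = n + 2 := by
        simp [nodesE, p.r0, p.r6, hn, hM2]
      rw [this] at key
      exact fun l hl => key l (by omega)
    · intro q hq s' hf hI l hl
      have p' := p.fr hf (by simp)
      have hc' : s'.regs 11 = c := by rw [hf.regs 11 (by simp), hc]
      rw [exec_ifInt]
      have hcond : ((IExp.reg 13 + 1 : IExp).val (s'.setR 13 q)
          ≤ nodesE.val (s'.setR 13 q)) ↔ q < M := by
        simp [nodesE, setR_regs, p'.r6, hM2]
      have hrow : rowCo s k d j h α β c 0 = pieceCo s d j h c := rfl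
      by_cases hqM : q < M
      · rw [if_pos (hcond.2 hqM), exec_wr]
        simp [setA_arr, setR_regs, setR_arr, rd_val, compE, p'.r9, p'.r1, hc']
        split_ifs with hlq
        · rw [hrow, pieceCo, if_pos (by rw [hlq]; exact hqM), hf.arr 3 (by simp) (by simp), hlq]
        · exact hI l (by omega)
      · rw [if_neg (mt hcond.1 hqM), exec_wr]
        simp [setA_arr, setR_regs, setR_arr]
        split_ifs with hlq
        · rw [hrow, pieceCo, if_neg (by rw [hlq]; exact hqM)]
        · exact hI l (by omega)
  have key := exec_loop_frame O [12, 13, 14, 15, 16, 17, 18, 19] [1, 2, 4, 5, 7] (r := 12)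
    (e := .reg 0) (P := intProg ;; foldProg ;; evalProg ;; storeProg) (s := s1)
    (by simp) (by simp) rfl
    -- The range includes l = n + 1 because computing coefficient n of the next row reads it.
    (fun u s' => (∀ l ≤ n + 1, s'.arr 2 u l = rowCo s k d j h α β c u l) ∧
      (∀ u' < u, ∀ r < M, s'.arr 4 r ((k - (u' + 1)) * d + c)
        = chebP (rowCo s k d j h α β c (u' + 1)) (n + 1) (cc (M + r))) ∧
      (∀ u' < u, s'.arr 5 (j + 1) (u' * d + c)
        = chebP (rowCo s k d j h α β c (u' + 1)) (n + 1) 1) ∧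
      (∀ x y, (∀ u, y ≠ u * d + c) → s'.arr 4 x y = s.arr 4 x y) ∧
      (∀ x y, (∀ u, y ≠ u * d + c) → s'.arr 5 x y = s.arr 5 x y) ∧
      (∀ x y, x ≠ j + 1 → s'.arr 5 x y = s.arr 5 x y)) ?_ ?_
  · rw [IExp.val_reg, p1.r0, ← hL2, ← hs2] at key
    obtain ⟨k1, k2, k3, k4, k5, k6⟩ := key
    have c3 := fill_loop O (e := nodesE + .reg 0) (ex := 0) (ey := compE (.reg 13))
      (r := 13) (ρ := 8) (rhs := rd 2 (.reg 0) (.reg 13)) (s := s2) (by simp) (by simp) rfl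
      (fun _ => 0) (fun l => l * d + c) (fun i => s2.arr 2 k i) ?_ (fun i hi s' hf _ => by
        have p' := p2.fr hf (by simp)
        simp [setR_regs, rd_val, setR_arr, compE, p'.r0, p'.r1, hf.regs 11, hc2, hf.arr 2])
    · have hv3 : (nodesE + .reg 0 : IExp).val s2 = n := by simp [nodesE, p2.r6, p2.r0, hn, hM2]
      rw [hv3, ← hL3, ← e] at c3
      rw [← e] at f3
      refine ⟨fun u hu r hr => ?_, fun u hu => ?_, fun l hl => ?_, ?_, fun x y hx => ?_⟩
      · rw [f3.arr 4 (by simp) (by simp), k2 u hu r hr]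
      · rw [f3.arr 5 (by simp) (by simp), k3 u hu]
      · rw [c3.1 l hl, k1 l (by omega)]
      · rintro ρ - (rfl | rfl | rfl) x y hy
        · rw [f3.arr 4 (by simp) (by simp), k4 x y hy]
        · rw [f3.arr 5 (by simp) (by simp), k5 x y hy]
        · rw [c3.2 x y (fun i _ hh => hy i hh.2), f2.arr 8 (by simp) (by simp),
            f1.arr 8 (by simp) (by simp)]
      · rw [f3.arr 5 (by simp) (by simp), k6 x y hx]
    · intro i hi i' hi' _ h2
      exact Nat.eq_of_mul_eq_mul_right hd (by simpa using h2)
  · refine ⟨b1, by simp, by simp, fun x y _ => f1.arr 4 (by simp) (by simp) _ _,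
      fun x y _ => f1.arr 5 (by simp) (by simp) _ _, fun x y _ => f1.arr 5 (by simp) (by simp) _ _⟩
  · rintro u hu s' hf ⟨k1, k2, k3, k4, k5, k6⟩
    rw [IExp.val_reg, p1.r0] at hu
    have p' := p1.fr hf (by simp)
    have hc' : s'.regs 11 = c := by rw [hf.regs 11 (by simp), hc1]
    simp only [exec_seq]
    set t0 := s'.setR 12 u with ht0
    set t1 := intProg.exec O t0 with ht1
    set t2 := foldProg.exec O t1 with ht2
    set t3 := evalProg.exec O t2 with ht3
    have g0 : Fr [12] [] s' t0 := Fr.setR (by simp) (by simp) u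
    have g1 : Fr [13] [2, 5, 7] t0 t1 := Prog.chk_frame O (by simp) intProg rfl t0
    have g2 : Fr [13, 17, 18] [1] t1 t2 := Prog.chk_frame O (by simp) foldProg rfl t1
    have g3 : Fr [13, 14, 15, 16, 17, 18, 19] [1] t2 t3 := Prog.chk_frame O (by simp) evalProg rfl t2
    have g4 : Fr [13] [4] t3 (storeProg.exec O t3) := Prog.chk_frame O (by simp) storeProg rfl t3
    have q0 := p'.fr g0 (by simp)
    have q1 := q0.fr g1 (by simp)
    have q2 := q1.fr g2 (by simp)
    have q3 := q2.fr g3 (by simp)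
    have u0 : t0.regs 12 = u := by simp [ht0, setR_regs]
    have u1 : t1.regs 12 = u := by rw [g1.regs 12 (by simp), u0]
    have u3 : t3.regs 12 = u := by rw [g3.regs 12 (by simp), g2.regs 12 (by simp), u1]
    have c0 : t0.regs 11 = c := by simp [ht0, setR_regs, hc']
    have c3 : t3.regs 11 = c := by
      rw [g3.regs 11 (by simp), g2.regs 11 (by simp), g1.regs 11 (by simp), c0]
    have hheap' : ∀ g, 1 ≤ g → g < 2 ^ (h + 2) → t2.arr 0 g 0 = cc g := by
      intro g a1 a2
      rw [g2.arr 0 (by simp) (by simp), g1.arr 0 (by simp) (by simp), g0.arr 0 (by simp) (by simp),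
        hf.arr 0 (by simp) (by simp), f1.arr 0 (by simp) (by simp), hheap g a1 a2]
    have hz : t0.arr 5 j (u * d + c) = s.arr 5 j (u * d + c) := by
      rw [g0.arr 5 (by simp) (by simp), k6 _ _ (by omega)]
    obtain ⟨i1, i2, i3⟩ := intProg_spec O t0 q0.r9 c0 u0 q0.r0 q0.r1
      (show n = 2 * t0.regs 6 + k by rw [q0.r6, hn, hM2]) q0.hlow (by omega)
      (show (β - α) / 4 = _ by rw [q0.left, q0.right]) (a := rowCo s k d j h α β c u)
      (fun l hl => by rw [g0.arr 2 (by simp) (by simp), k1 l hl])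
      (fun l hl => hzero u l (by omega))
    rw [hz, ← ht1] at i1 i2
    rw [← ht1] at i3
    have hnext : intCo ((β - α) / 4) (rowCo s k d j h α β c u) (s.arr 5 j (u * d + c)) n
        = rowCo s k d j h α β c (u + 1) := rfl
    rw [hnext] at i1 i2
    have hf4 : ∀ r < M, chebP (t2.arr 1 1) M (cc (M + r))
        = chebP (rowCo s k d j h α β c (u + 1)) (n + 1) (cc (M + r)) := by
      intro r hr
      rw [ht2, foldProg_spec O t1 u1 q1.r0 (show M = 2 * t1.regs 6 by rw [q1.r6, hM2]) hn hM1
        (chebT_root (h + 1) r hr)]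
      exact chebP_congr (fun l hl => i1 l (by omega)) _
    have hev := evalProg_spec O t2 q2.r7 q2.r6 hheap'
    rw [← ht3] at hev
    have hst := storeProg_spec O t3 (M := M) (p := (k - (u + 1)) * d + c) (by rw [q3.r6, hM2])
      (by rw [q3.r0, q3.r1, u3, c3])
    have l5 : ∀ x y, (storeProg.exec O t3).arr 5 x y = t1.arr 5 x y := fun x y => by
      rw [g4.arr 5 (by simp) (by simp), g3.arr 5 (by simp) (by simp), g2.arr 5 (by simp) (by simp)]
    have l4 : ∀ x y, t3.arr 4 x y = s'.arr 4 x y := fun x y => by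
      rw [g3.arr 4 (by simp) (by simp), g2.arr 4 (by simp) (by simp), g1.arr 4 (by simp) (by simp),
        g0.arr 4 (by simp) (by simp)]
    have l50 : ∀ x y, t0.arr 5 x y = s'.arr 5 x y := g0.arr 5 (by simp) (by simp)
    refine ⟨fun l hl => ?_, fun u' hu' r hr => ?_, fun u' hu' => ?_, fun x y hy => ?_,
      fun x y hy => ?_, fun x y hx => ?_⟩
    · rw [g4.arr 2 (by simp) (by simp), g3.arr 2 (by simp) (by simp), g2.arr 2 (by simp) (by simp),
        i1 l hl]
    · by_cases huu : (k - (u' + 1)) * d + c = (k - (u + 1)) * d + c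
      · rcases Nat.lt_succ_iff_lt_or_eq.1 hu' with hlt | rfl
        · have := Nat.eq_of_mul_eq_mul_right hd (Nat.add_right_cancel huu)
          omega
        · rw [hst.1 r hr, hev r hr, hf4 r hr]
      · have hlt : u' < u := by
          rcases Nat.lt_succ_iff_lt_or_eq.1 hu' with hlt | rfl
          · exact hlt
          · exact absurd rfl huu
        rw [hst.2 _ _ huu, l4, k2 u' hlt r hr]
    · rw [l5]
      rcases Nat.lt_succ_iff_lt_or_eq.1 hu' with hlt | rfl
      · rw [i3, l50, k3 u' hlt]
        rintro ⟨-, hh⟩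
        have := Nat.eq_of_mul_eq_mul_right hd (Nat.add_right_cancel hh)
        omega
      · rw [i2]
    · rw [hst.2 _ _ (hy _), l4, k4 x y hy]
    · rw [l5, i3 _ _ (fun hh => hy _ hh.2), l50, k5 x y hy]
    · rw [l5, i3 _ _ (fun hh => hx hh.1), l50, k6 x y hx]

theorem rowCo_congr {s s' : State} {d j h : ℕ} (h3 : ∀ y, s'.arr 3 j y = s.arr 3 j y)
    (h5 : ∀ y, s'.arr 5 j y = s.arr 5 j y) (k : ℕ) (α β : ℝ) :
    rowCo s' k d j h α β = rowCo s k d j h α β := by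
  funext c u
  have : pieceCo s' d j h c = pieceCo s d j h c := by
    funext l; simp only [pieceCo, h3]
  simp only [rowCo, this, h5]

/-- The cells of different coordinates have column numbers in different residue classes modulo d. -/
theorem coordLoop_spec (O : Oracle) (s : State) {k d j h : ℕ} {α β : ℝ}
    (p : PieceParams s k d j h α β)
    (hheap : ∀ g, 1 ≤ g → g < 2 ^ (h + 2) → s.arr 0 g 0 = cc g) :
    (∀ c < d, ∀ u < k, ∀ r < 2 ^ (h + 1),
      ((Prog.loop 11 (.reg 1) coordProg).exec O s).arr 4 r ((k - (u + 1)) * d + c)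
      = chebP (rowCo s k d j h α β c (u + 1)) (2 ^ (h + 1) + k + 1) (cc (2 ^ (h + 1) + r))) ∧
    (∀ c < d, ∀ u < k, ((Prog.loop 11 (.reg 1) coordProg).exec O s).arr 5 (j + 1) (u * d + c)
      = chebP (rowCo s k d j h α β c (u + 1)) (2 ^ (h + 1) + k + 1) 1) ∧
    (∀ c < d, ∀ l < 2 ^ (h + 1) + k,
      ((Prog.loop 11 (.reg 1) coordProg).exec O s).arr 8 0 (l * d + c)
      = rowCo s k d j h α β c k l) ∧
    (∀ x y, x ≠ j + 1 → ((Prog.loop 11 (.reg 1) coordProg).exec O s).arr 5 x y = s.arr 5 x y) := by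
  have key := exec_loop_frame O [11, 12, 13, 14, 15, 16, 17, 18, 19] [1, 2, 4, 5, 7, 8] (r := 11)
    (e := .reg 1) (P := coordProg) (s := s) (by simp) (by simp) rfl
    (fun m s' => (∀ c < m, ∀ u < k, ∀ r < 2 ^ (h + 1), s'.arr 4 r ((k - (u + 1)) * d + c)
      = chebP (rowCo s k d j h α β c (u + 1)) (2 ^ (h + 1) + k + 1) (cc (2 ^ (h + 1) + r))) ∧
    (∀ c < m, ∀ u < k, s'.arr 5 (j + 1) (u * d + c)
      = chebP (rowCo s k d j h α β c (u + 1)) (2 ^ (h + 1) + k + 1) 1) ∧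
    (∀ c < m, ∀ l < 2 ^ (h + 1) + k, s'.arr 8 0 (l * d + c) = rowCo s k d j h α β c k l) ∧
    (∀ x y, x ≠ j + 1 → s'.arr 5 x y = s.arr 5 x y)) ?_ ?_
  · rw [IExp.val_reg, p.r1] at key
    exact key
  · simp
  · rintro m hm s' hf ⟨k1, k2, k3, k4⟩
    rw [IExp.val_reg, p.r1] at hm
    have g0 : Fr [11] [] s' (s'.setR 11 m) := Fr.setR (by simp) (by simp) m
    have p' := (p.fr hf (by simp)).fr g0 (by simp)
    have ga : (s'.setR 11 m).arr = s'.arr := setR_arr _ (by simp) _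
    obtain ⟨c1, c2, c3, c4, c5⟩ := coordProg_spec O (s'.setR 11 m) p' (by omega) (c := m)
      (by simp [setR_regs]) (fun g a1 a2 => by
        rw [ga, hf.arr 0 (by simp) (by simp), hheap g a1 a2])
    rw [rowCo_congr (s := s) (fun y => by rw [ga, hf.arr 3 (by simp) (by simp)])
      (fun y => by rw [ga, k4 j y (by omega)])] at c1 c2 c3
    rw [ga] at c4 c5
    have hne : ∀ c < m, ∀ u u', u * d + c ≠ u' * d + m := fun c hc u u' hh => by
      have := mul_add_inj (by omega) hm hh
      omega
    refine ⟨fun c hc u hu r hr => ?_, fun c hc u hu => ?_, fun c hc l hl => ?_, fun x y hx => ?_⟩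
    · rcases Nat.lt_succ_iff_lt_or_eq.1 hc with hlt | rfl
      · rw [c4 4 (by simp) (by simp) _ _ (hne c hlt _), k1 c hlt u hu r hr]
      · exact c1 u hu r hr
    · rcases Nat.lt_succ_iff_lt_or_eq.1 hc with hlt | rfl
      · rw [c4 5 (by simp) (by simp) _ _ (hne c hlt _), k2 c hlt u hu]
      · exact c2 u hu
    · rcases Nat.lt_succ_iff_lt_or_eq.1 hc with hlt | rfl
      · rw [c4 8 (by simp) (by simp) _ _ (hne c hlt _), k3 c hlt l hl]
      · exact c3 l hl
    · rw [c5 x y hx, k4 x y hx]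

end RealRAM


namespace RealRAM

/-! ### Oracle calls, fitting and output -/

/-- A loop filling a block of consecutive cells. -/
theorem block_loop (O : Oracle) {r : ℕ} {e base : IExp} {rhs : RExp} {s : State} (b : ℕ)
    (V : ℕ → ℝ)
    (h : ∀ i < e.val s, ∀ s' : State, (∀ r', r' ≠ r → s'.regs r' = s.regs r') → s'.ints = s.ints →
      (∀ x, ¬ (b ≤ x ∧ x < b + e.val s) → s'.reals x = s.reals x) →
      base.val (s'.setR r i) = b + i ∧ rhs.val (s'.setR r i) = V i) :
    (∀ r', r' ≠ r → ((Prog.loop r e (.setReal base rhs)).exec O s).regs r' = s.regs r') ∧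
    ((Prog.loop r e (.setReal base rhs)).exec O s).ints = s.ints ∧
    (∀ x, ¬ (b ≤ x ∧ x < b + e.val s) →
      ((Prog.loop r e (.setReal base rhs)).exec O s).reals x = s.reals x) ∧
    ∀ i < e.val s, ((Prog.loop r e (.setReal base rhs)).exec O s).reals (b + i) = V i := by
  refine exec_loop_rule O (s := s) (fun q s' => (∀ r', r' ≠ r → s'.regs r' = s.regs r') ∧
      s'.ints = s.ints ∧ (∀ x, ¬ (b ≤ x ∧ x < b + e.val s) → s'.reals x = s.reals x) ∧
      ∀ i < q, s'.reals (b + i) = V i) ?_ ?_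
  · exact ⟨fun _ _ => rfl, rfl, fun _ _ => rfl, by simp⟩
  · rintro q hq s' ⟨h1, h2, h3, h4⟩
    obtain ⟨e1, e2⟩ := h q hq s' h1 h2 h3
    simp only [Prog.exec, e1, e2]
    refine ⟨fun r' hr' => ?_, h2, fun x hx => ?_, fun i hi => ?_⟩
    · change (s'.setR r q).regs r' = _
      rw [setR_regs, if_neg hr', h1 r' hr']
    · simp only [State.setM, Function.update_apply, setR_reals]
      rw [if_neg (by omega), h3 x hx]
    · simp only [State.setM, Function.update_apply, setR_reals]
      split_ifs with hh
      · congr 1; omega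
      · exact h4 i (by omega)

variable {E : Type*} [NormedAddCommGroup E] [NormedSpace ℝ E]

theorem ask_odeOracle {k d : ℕ} (e : Module.Basis (Fin d) ℝ E) (F : (Fin k → E) → ℝ → E)
    (s : State) (a b : ℕ) :
    (∀ c (hc : c < d), (s.ask (odeOracle e F) a b).reals (b + c)
      = e.repr (F (fun i => ∑ c' : Fin d, s.reals (a + ((i : ℕ) * d + c')) • e c')
        (s.reals (a + k * d))) ⟨c, hc⟩) ∧
    ∀ x, ¬ (b ≤ x ∧ x < b + d) → (s.ask (odeOracle e F) a b).reals x = s.reals x := by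
  constructor
  · intro c hc
    have hcond : b ≤ b + c ∧ b + c - b < (odeOracle e F).outSize :=
      ⟨by omega, by simpa [odeOracle] using hc⟩
    simp only [State.ask]
    rw [dif_pos hcond]
    simp only [odeOracle, vecAt]
    -- All offsets lie inside the argument block, so the default value 0 of the padded argument is
    -- never read.
    have hi : ∀ (i : Fin k) (c' : Fin d), (i : ℕ) * d + c' < k * d + 1 := by
      intro i c'
      calc (i : ℕ) * d + c' < i * d + d := by have := c'.2; omega
        _ = (i + 1) * d := by ring
        _ ≤ k * d := Nat.mul_le_mul_right _ i.2
        _ < k * d + 1 := by omega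
    simp only [hi, dif_pos, show k * d < k * d + 1 by omega]
    congr 2
    simp
  · intro x hx
    simp only [State.ask]
    rw [dif_neg]
    simp only [odeOracle]
    omega

/-- The states agree except for local registers, array `6` and the low memory between `B` and
`R`. -/
structure AskFr (B R : ℕ) (s s' : State) : Prop where
  regs : ∀ r, r ≠ 13 → r ≠ 20 → s'.regs r = s.regs r
  ints : s'.ints = s.ints
  low : ∀ a < s.regs 5, a < B ∨ R ≤ a → s'.reals a = s.reals a
  arr : ∀ ρ < 16, ρ ≠ 6 → ∀ x y, s'.arr ρ x y = s.arr ρ x y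

theorem AskFr.refl (B R : ℕ) (s : State) : AskFr B R s s :=
  ⟨fun _ _ _ => rfl, rfl, fun _ _ _ => rfl, fun _ _ _ _ _ => rfl⟩

theorem AskFr.trans {B R : ℕ} {s s' s'' : State} (h : AskFr B R s s') (h' : AskFr B R s' s'') :
    AskFr B R s s'' :=
  ⟨fun r h1 h2 => (h'.regs r h1 h2).trans (h.regs r h1 h2), h'.ints.trans h.ints,
    fun a h1 h2 => (h'.low a (by rw [h.regs 5 (by simp) (by simp)]; exact h1) h2).trans
      (h.low a h1 h2),
    fun ρ h1 h2 x y => (h'.arr ρ h1 h2 x y).trans (h.arr ρ h1 h2 x y)⟩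

theorem AskFr.setR (B R : ℕ) (s : State) {r : ℕ} (hr : r = 13 ∨ r = 20) (v : ℕ) :
    AskFr B R s (s.setR r v) :=
  ⟨fun r' h1 h2 => by rw [setR_regs, if_neg]; omega, rfl, fun _ _ _ => rfl,
    fun ρ _ _ x y => by rw [setR_arr _ (by omega)]⟩

theorem PieceParams.askFr {s s' : State} {k d j h B R : ℕ} {α β : ℝ}
    (p : PieceParams s k d j h α β) (hf : AskFr B R s s') (hB : j + 1 < B) :
    PieceParams s' k d j h α β := by
  have key : ∀ r < 10, s'.regs r = s.regs r := fun r hr => hf.regs r (by omega) (by omega)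
  have hl := p.hlow
  exact ⟨(key 0 (by norm_num)).trans p.r0, (key 1 (by norm_num)).trans p.r1,
    (key 6 (by norm_num)).trans p.r6, (key 7 (by norm_num)).trans p.r7,
    (key 9 (by norm_num)).trans p.r9, by rw [key 5 (by norm_num)]; exact hl,
    (hf.low _ (by omega) (Or.inl (by omega))).trans p.left, (hf.low _ hl (Or.inl hB)).trans p.right⟩

/-- The `r`-th node on the piece `[α, β]`. -/
noncomputable def nodeAt (α β : ℝ) (h r : ℕ) : ℝ :=
  α + (β - α) / 2 * (1 + cc (2 ^ (h + 1) + r))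

/-- The argument and result blocks occupy the scratch area between `B` and the output region, below
the arrays. Outside it only array `6` and local registers change, which is what `AskFr` records. -/
theorem askProg_spec {k d : ℕ} (e : Module.Basis (Fin d) ℝ E) (F : (Fin k → E) → ℝ → E)
    (s : State) {j h r B : ℕ} {α β : ℝ} (p : PieceParams s k d j h α β)
    (hB : B = s.regs 2 + 1 + k * d) (hZ : B + (k * d + 1) + d ≤ s.regs 5) (hj : j + 1 < B)
    (hr : s.regs 20 = r) (hheap : s.arr 0 (2 ^ (h + 1) + r) 0 = cc (2 ^ (h + 1) + r)) :
    (∀ c (hc : c < d), (askProg.exec (odeOracle e F) s).arr 6 r c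
      = e.repr (F (fun i => ∑ c' : Fin d, s.arr 4 r ((i : ℕ) * d + c') • e c')
        (nodeAt α β h r)) ⟨c, hc⟩) ∧
    (∀ x y, x ≠ r → (askProg.exec (odeOracle e F) s).arr 6 x y = s.arr 6 x y) ∧
    AskFr B (B + (k * d + 1) + d) s (askProg.exec (odeOracle e F) s) := by
  set O := odeOracle e F with hO
  have hargE : ∀ s' : State, s'.regs 0 = k → s'.regs 1 = d → s'.regs 2 = s.regs 2 →
      argE.val s' = B := by
    intro s' h0 h1 h2; simp [argE, h0, h1, h2, hB]
  have hresE : ∀ s' : State, s'.regs 0 = k → s'.regs 1 = d → s'.regs 2 = s.regs 2 →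
      resE.val s' = B + (k * d + 1) := by
    intro s' h0 h1 h2; simp [resE, hargE s' h0 h1 h2, h0, h1]
  set s1 := (Prog.loop 13 (.reg 0 * .reg 1)
    (.setReal (argE + .reg 13) (rd 4 (.reg 20) (.reg 13)))).exec O s with hs1
  have hv1 : (IExp.reg 0 * IExp.reg 1 : IExp).val s = k * d := by simp [p.r0, p.r1]
  obtain ⟨a1, a2, a3, a4⟩ := block_loop O (r := 13) (e := .reg 0 * .reg 1)
    (base := argE + .reg 13) (rhs := rd 4 (.reg 20) (.reg 13)) (s := s) B
    (fun i => s.arr 4 r i) (fun i hi s' h1 h2 h3 => by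
      rw [hv1] at hi h3
      constructor
      · rw [IExp.val_add, hargE _ (by simp [setR_regs, h1, p.r0]) (by simp [setR_regs, h1, p.r1])
          (by simp [setR_regs, h1])]
        simp [setR_regs]
      · simp only [rd_val, setR_arr _ (show 13 ≠ 5 by simp), IExp.val_reg, setR_regs]
        simp only [h1 20 (by simp), hr, if_true]
        norm_num
        simp only [State.arr, h1 5 (by simp)]
        exact h3 _ (by omega))
  rw [hv1, ← hs1] at a3 a4
  rw [← hs1] at a1 a2
  set t := α + 2 * ((β - α) / 4) * (1 + cc (2 ^ (h + 1) + r)) with ht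
  have hl := p.hlow
  have hM : 2 * 2 ^ h = 2 ^ (h + 1) := by rw [pow_succ, mul_comm]
  have e1 : (Prog.setReal (argE + .reg 0 * .reg 1)
      (.mem (.reg 9) + 2 * quarterE * (1 + rd 0 (nodesE + .reg 20) 0))).exec O s1
      = s1.setM (B + k * d) t := by
    simp only [Prog.exec]
    have q1 : (argE + .reg 0 * .reg 1 : IExp).val s1 = B + k * d := by
      rw [IExp.val_add, hargE s1 (by rw [a1 0 (by simp), p.r0]) (by rw [a1 1 (by simp), p.r1])
        (a1 2 (by simp))]
      simp [a1, p.r0, p.r1]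
    have q2 : (RExp.mem (.reg 9) + 2 * quarterE * (1 + rd 0 (nodesE + .reg 20) 0)).val s1 = t := by
      simp only [RExp.val_add, RExp.val_mem, RExp.val_mul, RExp.val_two, RExp.val_one, quarterE,
        RExp.val_div, RExp.val_sub, RExp.val_four, rd_val, IExp.val_reg, IExp.val_add, IExp.val_one,
        IExp.val_zero, nodesE, IExp.val_mul, IExp.val_two]
      simp only [a1 9 (by simp), a1 6 (by simp), a1 20 (by simp), p.r9, p.r6, hr, hM]
      rw [a3 j (by omega), a3 (j + 1) (by omega), p.left, p.right]
      simp only [State.arr, a1 5 (by simp)]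
      rw [a3 _ (by omega)]
      have := hheap
      simp only [State.arr] at this
      rw [this]
    rw [q1, q2]
  set s2 := s1.setM (B + k * d) t with hs2
  have b1 : ∀ r', r' ≠ 13 → s2.regs r' = s.regs r' := a1
  have e2 : (Prog.call argE resE).exec O s2 = s2.ask O B (B + (k * d + 1)) := by
    simp only [Prog.exec]
    rw [hargE s2 (by rw [b1 0 (by simp), p.r0]) (by rw [b1 1 (by simp), p.r1]) (b1 2 (by simp)),
      hresE s2 (by rw [b1 0 (by simp), p.r0]) (by rw [b1 1 (by simp), p.r1]) (b1 2 (by simp))]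
  set s3 := s2.ask O B (B + (k * d + 1)) with hs3
  have c1 : ∀ r', r' ≠ 13 → s3.regs r' = s.regs r' := a1
  obtain ⟨ask1, ask2⟩ := ask_odeOracle e F s2 B (B + (k * d + 1))
  rw [← hO, ← hs3] at ask1 ask2
  have hs2r : ∀ x, ¬ (B ≤ x ∧ x < B + (k * d + 1)) → s2.reals x = s.reals x := by
    intro x hx
    rw [hs2]
    simp only [State.setM]
    rw [Function.update_of_ne (by omega), a3 x (by omega)]
  have hlow3 : ∀ x, ¬ (B ≤ x ∧ x < B + (k * d + 1) + d) → s3.reals x = s.reals x := by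
    intro x hx
    rw [ask2 x (by omega), hs2r x (by omega)]
  have harr3 : ∀ ρ x y, s3.arr ρ x y = s.arr ρ x y := by
    intro ρ x y
    simp only [State.arr, c1 5 (by simp)]
    exact hlow3 _ (by omega)
  have e4 : askProg.exec O s = (Prog.loop 13 (.reg 1)
      (wr 6 (.reg 20) (.reg 13) (.mem (resE + .reg 13)))).exec O s3 := by
    rw [askProg, exec_seq, exec_seq, exec_seq, ← hs1, e1, e2]
  have hv3 : (IExp.reg 1).val s3 = d := by simp [c1, p.r1]
  have f4 : Fr [13] [6] s3 (askProg.exec O s) := by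
    rw [e4]
    exact Prog.chk_frame O (W := [13]) (A := [6]) (by simp) (Prog.loop 13 (.reg 1)
      (wr 6 (.reg 20) (.reg 13) (.mem (resE + .reg 13)))) rfl s3
  have c4 := fill_loop O (e := .reg 1) (ex := .reg 20) (ey := .reg 13) (r := 13) (ρ := 6)
    (rhs := .mem (resE + .reg 13)) (s := s3) (by simp) (by simp) rfl
    (fun _ => r) id (fun i => s3.reals (B + (k * d + 1) + i)) (fun i _ i' _ _ hh => hh)
    (fun i hi s' hf _ => by
      rw [hv3] at hi
      refine ⟨?_, ?_, ?_⟩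
      · simp [setR_regs, hf.regs 20, c1, hr]
      · simp [setR_regs]
      · rw [RExp.val_mem, IExp.val_add, hresE _ (by simp [setR_regs, hf.regs, c1, p.r0])
          (by simp [setR_regs, hf.regs, c1, p.r1]) (by simp [setR_regs, hf.regs, c1])]
        simp only [IExp.val_reg, setR_regs, if_true, setR_reals]
        exact hf.low _ (by rw [c1 5 (by simp)]; omega))
  rw [hv3, ← e4] at c4
  refine ⟨fun c hc => ?_, fun x y hx => ?_, ?_⟩
  · have := c4.1 c hc
    simp only [id] at this
    rw [this, ask1 c hc]
    have h1 : s2.reals (B + k * d) = nodeAt α β h r := by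
      rw [hs2]
      simp only [State.setM, Function.update_self, nodeAt, ht]
      ring
    have h2 : ∀ (i : Fin k) (c' : Fin d), s2.reals (B + ((i : ℕ) * d + c'))
        = s.arr 4 r ((i : ℕ) * d + c') := by
      intro i c'
      have hlt : (i : ℕ) * d + c' < k * d :=
        calc (i : ℕ) * d + c' < i * d + d := by have := c'.2; omega
        _ = (i + 1) * d := by ring
        _ ≤ k * d := Nat.mul_le_mul_right _ i.2
      rw [hs2]
      simp only [State.setM]
      rw [Function.update_of_ne (by omega), a4 _ hlt]
    simp only [h1, h2]
  · rw [c4.2 x y (fun i _ hh => hx hh.1), harr3]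
  · refine ⟨fun r' h1 h2 => ?_, ?_, fun a h1 h2 => ?_, fun ρ h1 h2 x y => ?_⟩
    · rw [f4.regs r' (by simpa using h1), c1 r' h1]
    · rw [f4.ints]; exact a2
    · rw [f4.low a (by rw [c1 5 (by simp)]; exact h1), hlow3 a (by omega)]
    · rw [f4.arr ρ h1 (by simpa using h2), harr3]

theorem askLoop_spec {k d : ℕ} (e : Module.Basis (Fin d) ℝ E) (F : (Fin k → E) → ℝ → E)
    (s : State) {j h B : ℕ} {α β : ℝ} (p : PieceParams s k d j h α β)
    (hB : B = s.regs 2 + 1 + k * d) (hZ : B + (k * d + 1) + d ≤ s.regs 5) (hj : j + 1 < B)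
    (hheap : ∀ g, 1 ≤ g → g < 2 ^ (h + 2) → s.arr 0 g 0 = cc g) :
    (∀ r < 2 ^ (h + 1), ∀ c (hc : c < d),
      ((Prog.loop 20 nodesE askProg).exec (odeOracle e F) s).arr 6 r c
      = e.repr (F (fun i => ∑ c' : Fin d, s.arr 4 r ((i : ℕ) * d + c') • e c')
        (nodeAt α β h r)) ⟨c, hc⟩) ∧
    AskFr B (B + (k * d + 1) + d) s ((Prog.loop 20 nodesE askProg).exec (odeOracle e F) s) := by
  have key := exec_loop_rule (odeOracle e F) (r := 20) (e := nodesE) (P := askProg) (s := s)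
    (fun q s' => (∀ r < q, ∀ c (hc : c < d), s'.arr 6 r c
      = e.repr (F (fun i => ∑ c' : Fin d, s.arr 4 r ((i : ℕ) * d + c') • e c')
        (nodeAt α β h r)) ⟨c, hc⟩) ∧ AskFr B (B + (k * d + 1) + d) s s')
    ⟨by simp, AskFr.refl _ _ _⟩ ?_
  · have hv : nodesE.val s = 2 ^ (h + 1) := by simp [nodesE, p.r6, pow_succ, mul_comm]
    rw [hv] at key
    exact key
  · rintro q hq s' ⟨h1, h2⟩
    have hv : nodesE.val s = 2 ^ (h + 1) := by simp [nodesE, p.r6, pow_succ, mul_comm]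
    rw [hv] at hq
    have g := h2.trans (AskFr.setR B (B + (k * d + 1) + d) s' (r := 20) (Or.inr rfl) q)
    have p' := p.askFr g hj
    obtain ⟨a1, a2, a3⟩ := askProg_spec e F (s'.setR 20 q) (r := q) p'
      (by rw [g.regs 2 (by simp) (by simp)]; exact hB)
      (by rw [g.regs 5 (by simp) (by simp)]; exact hZ) hj (by simp [setR_regs])
      (by rw [g.arr 0 (by simp) (by simp), hheap _ (by omega) (by rw [pow_succ 2 (h + 1)]; omega)])
    refine ⟨fun r hr c hc => ?_, g.trans a3⟩
    rcases Nat.lt_succ_iff_lt_or_eq.1 hr with hlt | rfl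
    · rw [a2 r c (by omega), setR_arr _ (by simp), h1 r hlt c hc]
    · rw [a1 c hc]
      simp only [g.arr 4 (by simp) (by simp)]

/-- Interpolating and then scaling coefficients is the action of the kernel on the oracle values, by
`chebP_filter`. -/
theorem filterProg_spec (O : Oracle) (s : State) {k d j h c : ℕ} {α β : ℝ}
    (p : PieceParams s k d j h α β) (hd : 0 < d) (hc : s.regs 11 = c)
    (hheap : ∀ g, 1 ≤ g → g < 2 ^ (h + 2) → s.arr 0 g 0 = cc g) :
    (∀ x, chebP (pieceCo (filterProg.exec O s) d j h c) (2 ^ (h + 1)) x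
      = ∑ r ∈ Finset.range (2 ^ (h + 1)),
        nodeKernel (h + 1) (vpW (2 ^ h)) x (cc (2 ^ (h + 1) + r)) * s.arr 6 r c) ∧
    ∀ x y, (x ≠ j ∨ ∀ l, y ≠ l * d + c) → (filterProg.exec O s).arr 3 x y = s.arr 3 x y := by
  set M := 2 ^ (h + 1) with hMdef
  have hM2 : M = 2 * 2 ^ h := by rw [hMdef, pow_succ, mul_comm]
  set L1 := Prog.loop 13 nodesE (wr 1 (nodesE + .reg 13) 0 (rd 6 (.reg 13) (.reg 11))) with hL1
  set s1 := L1.exec O s with hs1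
  set s2 := fitProg.exec O s1 with hs2
  have f1 : Fr [13] [1] s s1 := Prog.chk_frame O (by simp) L1 rfl s
  have f2 : Fr [13, 14, 15, 16, 17, 18, 19] [1] s1 s2 := Prog.chk_frame O (by simp) fitProg rfl s1
  have p1 := p.fr f1 (by simp)
  have p2 := p1.fr f2 (by simp)
  have hv : nodesE.val s = M := by simp [nodesE, p.r6, hM2]
  have c1 := (fill_loop O (e := nodesE) (ex := nodesE + .reg 13) (ey := 0) (r := 13) (ρ := 1)
    (rhs := rd 6 (.reg 13) (.reg 11)) (s := s) (by simp) (by simp) rfl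
    (fun i => M + i) (fun _ => 0) (fun i => s.arr 6 i c) (fun i _ i' _ hh _ => by omega)
    (fun i hi s' hf _ => by
      have p' := p.fr hf (by simp)
      have hc' : s'.regs 11 = c := by rw [hf.regs 11 (by simp), hc]
      simp [setR_regs, rd_val, setR_arr, nodesE, p'.r6, hc', hf.arr 6, hM2])).1
  rw [hv, ← hL1, ← hs1] at c1
  have c2 := fitProg_spec O s1 p1.r7 p1.r6 (fun g a1 a2 => by
    rw [f1.arr 0 (by simp) (by simp), hheap g a1 a2])
  rw [← hs2, ← hMdef] at c2
  have hc2 : s2.regs 11 = c := by rw [f2.regs 11 (by simp), f1.regs 11 (by simp), hc]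
  have h3 : ∀ x y, s2.arr 3 x y = s.arr 3 x y := fun x y => by
    rw [f2.arr 3 (by simp) (by simp), f1.arr 3 (by simp) (by simp)]
  have c3 := exec_loop_frame O [13] [3] (r := 13) (e := nodesE)
    (P := .ifInt (.reg 13) (.reg 6) (wr 3 (.reg 9) (compE (.reg 13)) (rd 1 1 (.reg 13)))
      (wr 3 (.reg 9) (compE (.reg 13))
        ((2 - .ofInt (.reg 13) / .ofInt (.reg 6)) * rd 1 1 (.reg 13)))) (s := s2)
    (by simp) (by simp) rfl
    (fun q s' => (∀ l < q, s'.arr 3 j (l * d + c) = vpW (2 ^ h) l * s2.arr 1 1 l) ∧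
      ∀ x y, (x ≠ j ∨ ∀ l, y ≠ l * d + c) → s'.arr 3 x y = s2.arr 3 x y) ?_ ?_
  · have hv2 : nodesE.val s2 = M := by simp [nodesE, p2.r6, hM2]
    rw [hv2] at c3
    have e : filterProg.exec O s = (Prog.loop 13 nodesE
      (.ifInt (.reg 13) (.reg 6) (wr 3 (.reg 9) (compE (.reg 13)) (rd 1 1 (.reg 13)))
      (wr 3 (.reg 9) (compE (.reg 13))
        ((2 - .ofInt (.reg 13) / .ofInt (.reg 6)) * rd 1 1 (.reg 13))))).exec O s2 := rfl
    rw [← e] at c3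
    refine ⟨fun x => ?_, fun x y hxy => by rw [c3.2 x y hxy, h3]⟩
    rw [chebP_congr (b := fun l => vpW (2 ^ h) l * s2.arr 1 1 l), hMdef, chebP_filter]
    · refine Finset.sum_congr rfl fun r hr => ?_
      have hr' := Finset.mem_range.1 hr
      rw [← hMdef] at hr' ⊢
      rw [c2 r hr', c1 r hr']
    · intro l hl
      rw [pieceCo, ← hMdef, if_pos hl, c3.1 l hl]
  · exact ⟨by simp, fun _ _ _ => rfl⟩
  · rintro q hq s' hf ⟨k1, k2⟩
    have p' := p2.fr hf (by simp)
    have hc' : s'.regs 11 = c := by rw [hf.regs 11 (by simp), hc2]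
    have h1 : ∀ x y, s'.arr 1 x y = s2.arr 1 x y := hf.arr 1 (by simp) (by simp)
    have key : Prog.exec O (.ifInt (.reg 13) (.reg 6) (wr 3 (.reg 9) (compE (.reg 13))
        (rd 1 1 (.reg 13))) (wr 3 (.reg 9) (compE (.reg 13))
        ((2 - .ofInt (.reg 13) / .ofInt (.reg 6)) * rd 1 1 (.reg 13)))) (s'.setR 13 q)
        = (s'.setR 13 q).setA 3 j (q * d + c) (vpW (2 ^ h) q * s2.arr 1 1 q) := by
      rw [exec_ifInt]
      by_cases hq2 : q ≤ 2 ^ h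
      · rw [if_pos (by simpa [setR_regs, p'.r6] using hq2), exec_wr]
        simp [setR_regs, p'.r9, compE, p'.r1, hc', rd_val, setR_arr, h1, vpW, hq2]
      · rw [if_neg (by simpa [setR_regs, p'.r6] using hq2), exec_wr]
        simp [setR_regs, p'.r9, compE, p'.r1, p'.r6, hc', rd_val, setR_arr, h1, vpW, hq2]
    rw [key]
    refine ⟨fun l hl => ?_, fun x y hxy => ?_⟩
    · rw [setA_arr _ (by simp) (by simp)]
      rcases Nat.lt_succ_iff_lt_or_eq.1 hl with hlt | rfl
      · rw [if_neg, setR_arr _ (by simp), k1 l hlt]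
        rintro ⟨-, -, hh⟩
        have := Nat.eq_of_mul_eq_mul_right hd (Nat.add_right_cancel hh)
        omega
      · rw [if_pos ⟨rfl, rfl, rfl⟩]
    · rw [setA_arr _ (by simp) (by simp), if_neg, setR_arr _ (by simp), k2 x y hxy]
      rintro ⟨-, hx, hy⟩
      rcases hxy with hxy | hxy
      · exact hxy hx
      · exact hxy q hy

theorem filterLoop_spec (O : Oracle) (s : State) {k d j h : ℕ} {α β : ℝ}
    (p : PieceParams s k d j h α β)
    (hheap : ∀ g, 1 ≤ g → g < 2 ^ (h + 2) → s.arr 0 g 0 = cc g) :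
    (∀ c < d, ∀ x, chebP (pieceCo ((Prog.loop 11 (.reg 1) filterProg).exec O s) d j h c)
        (2 ^ (h + 1)) x
      = ∑ r ∈ Finset.range (2 ^ (h + 1)),
        nodeKernel (h + 1) (vpW (2 ^ h)) x (cc (2 ^ (h + 1) + r)) * s.arr 6 r c) ∧
    ∀ x y, x ≠ j → ((Prog.loop 11 (.reg 1) filterProg).exec O s).arr 3 x y = s.arr 3 x y := by
  have key := exec_loop_frame O [11, 13, 14, 15, 16, 17, 18, 19] [1, 3] (r := 11)
    (e := .reg 1) (P := filterProg) (s := s) (by simp) (by simp) rfl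
    (fun m s' => (∀ c < m, ∀ x, chebP (pieceCo s' d j h c) (2 ^ (h + 1)) x
      = ∑ r ∈ Finset.range (2 ^ (h + 1)),
        nodeKernel (h + 1) (vpW (2 ^ h)) x (cc (2 ^ (h + 1) + r)) * s.arr 6 r c) ∧
    ∀ x y, x ≠ j → s'.arr 3 x y = s.arr 3 x y) ⟨by simp, fun _ _ _ => rfl⟩ ?_
  · rw [IExp.val_reg, p.r1] at key
    exact key
  · rintro m hm s' hf ⟨k1, k2⟩
    rw [IExp.val_reg, p.r1] at hm
    have g0 : Fr [11] [] s' (s'.setR 11 m) := Fr.setR (by simp) (by simp) m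
    have p' := (p.fr hf (by simp)).fr g0 (by simp)
    have ga : (s'.setR 11 m).arr = s'.arr := setR_arr _ (by simp) _
    obtain ⟨c1, c2⟩ := filterProg_spec O (s'.setR 11 m) p' (by omega) (c := m)
      (by simp [setR_regs]) (fun g a1 a2 => by
        rw [ga, hf.arr 0 (by simp) (by simp), hheap g a1 a2])
    rw [ga] at c1 c2
    refine ⟨fun c hc x => ?_, fun x y hx => by rw [c2 x y (Or.inl hx), k2 x y hx]⟩
    rcases Nat.lt_succ_iff_lt_or_eq.1 hc with hlt | rfl
    · rw [← k1 c hlt x]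
      refine chebP_congr (fun l hl => ?_) x
      rw [pieceCo, pieceCo, if_pos hl, if_pos hl, c2 _ _ (Or.inr fun l' hh => ?_)]
      have := mul_add_inj (by omega) hm hh
      omega
    · rw [c1 x]
      simp only [hf.arr 6 (by simp) (by simp)]

theorem dumpProg_spec (O : Oracle) (s : State) {k d j h R : ℕ} {α β : ℝ}
    (p : PieceParams s k d j h α β) (hR : R = outE.val s)
    (hZ : R + (2 ^ (h + 1) + k) * d ≤ s.regs 5) :
    (∀ q < (2 ^ (h + 1) + k) * d, (dumpProg.exec O s).reals (R + q) = s.arr 8 0 q) ∧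
    (∀ x, ¬ (R ≤ x ∧ x < R + (2 ^ (h + 1) + k) * d) →
      (dumpProg.exec O s).reals x = s.reals x) ∧
    (∀ r, r ≠ 13 → (dumpProg.exec O s).regs r = s.regs r) ∧
    (dumpProg.exec O s).ints = Function.update (Function.update s.ints (s.regs 2 + 2 * j) R)
      (s.regs 2 + (2 * j + 1)) (2 ^ (h + 1) + k) := by
  have hM2 : 2 ^ (h + 1) = 2 * 2 ^ h := by rw [pow_succ, mul_comm]
  have hv : ((nodesE + .reg 0) * .reg 1 : IExp).val s = (2 ^ (h + 1) + k) * d := by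
    simp [nodesE, p.r0, p.r1, p.r6, hM2]
  have hout : ∀ s' : State, (∀ r, r ≠ 13 → s'.regs r = s.regs r) → outE.val s' = R := by
    intro s' h1
    rw [hR]
    simp [outE, resE, argE, h1]
  obtain ⟨a1, a2, a3, a4⟩ := block_loop O (r := 13) (e := (nodesE + .reg 0) * .reg 1)
    (base := outE + .reg 13) (rhs := rd 8 0 (.reg 13)) (s := s) R
    (fun i => s.arr 8 0 i) (fun i hi s' h1 h2 h3 => by
      rw [hv] at hi h3
      constructor
      · rw [IExp.val_add, hout _ (fun r hr => by rw [setR_regs, if_neg hr, h1 r hr])]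
        simp [setR_regs]
      · simp only [rd_val, setR_arr _ (show 13 ≠ 5 by simp), IExp.val_reg, setR_regs, IExp.val_zero,
          if_true]
        simp only [State.arr, h1 5 (by simp)]
        exact h3 _ (by omega))
  rw [hv] at a3 a4
  set s1 := (Prog.loop 13 ((nodesE + .reg 0) * .reg 1)
    (.setReal (outE + .reg 13) (rd 8 0 (.reg 13)))).exec O s with hs1
  have e : dumpProg.exec O s = ((s1.setI (s.regs 2 + 2 * j) R).setI (s.regs 2 + (2 * j + 1))
      (2 ^ (h + 1) + k)) := by
    have q1 : (Prog.setInt (.reg 2 + 2 * .reg 9) outE).exec O s1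
        = s1.setI (s.regs 2 + 2 * j) R := by
      simp only [Prog.exec, hout s1 a1]
      simp [a1, p.r9]
    have q2 : (Prog.setInt (.reg 2 + (2 * .reg 9 + 1)) (nodesE + .reg 0)).exec O
        (s1.setI (s.regs 2 + 2 * j) R) = ((s1.setI (s.regs 2 + 2 * j) R).setI
          (s.regs 2 + (2 * j + 1)) (2 ^ (h + 1) + k)) := by
      have b1 : ∀ r, r ≠ 13 → (s1.setI (s.regs 2 + 2 * j) R).regs r = s.regs r := a1
      simp only [Prog.exec]
      congr 1
      · simp [b1, p.r9]
      · simp [b1, nodesE, p.r0, p.r6, hM2]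
    rw [dumpProg, exec_seq, exec_seq, ← hs1, q1, q2]
  rw [e]
  refine ⟨a4, a3, a1, ?_⟩
  simp [State.setI, a2]

end RealRAM


namespace RealRAM

variable {E : Type*} [NormedAddCommGroup E] [NormedSpace ℝ E]

/-! ### One piece -/

theorem sizeProg_spec (O : Oracle) (s : State) {D : ℕ} (hD : s.regs 8 = D) :
    (sizeProg.exec O s).regs 6 = 2 ^ Nat.clog 2 D ∧
    (sizeProg.exec O s).regs 7 = Nat.clog 2 D + 1 ∧
    Fr [6, 7, 13] [] s (sizeProg.exec O s) := by
  have f : Fr [6, 7, 13] [] s (sizeProg.exec O s) := Prog.chk_frame O (by simp) sizeProg rfl s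
  set s1 := (s.setR 6 1).setR 7 1 with hs1
  have key := exec_loop_frame O [6, 7, 13] [] (r := 13) (e := .reg 8)
    (P := .ifInt (.reg 8) (.reg 6) .skip
      (.setReg 6 (.reg 6 + .reg 6) ;; .setReg 7 (.reg 7 + 1))) (s := s1) (by simp) (by simp) rfl
    (fun q s' => s'.regs 6 = 2 ^ min q (Nat.clog 2 D) ∧ s'.regs 7 = min q (Nat.clog 2 D) + 1)
    (by simp [hs1, setR_regs]) ?_
  · have hv : (IExp.reg 8).val s1 = D := by simp [hs1, setR_regs, hD]
    rw [hv] at key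
    -- The loop makes D rounds, at least as many as the doublings required; later rounds do nothing.
    have hle : Nat.clog 2 D ≤ D := by
      rw [Nat.clog_le_iff_le_pow (by norm_num)]
      exact Nat.lt_two_pow_self.le
    rw [min_eq_right hle] at key
    exact ⟨key.1, key.2, f⟩
  · rintro q - s' hf ⟨h6, h7⟩
    have h8 : s'.regs 8 = D := by rw [hf.regs 8 (by simp)]; simp [hs1, setR_regs, hD]
    rw [exec_ifInt]
    have hc : (IExp.reg 8).val (s'.setR 13 q) ≤ (IExp.reg 6).val (s'.setR 13 q)
        ↔ Nat.clog 2 D ≤ q := by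
      simp only [IExp.val_reg, setR_regs]
      norm_num
      rw [h8, h6, ← Nat.clog_le_iff_le_pow (by norm_num)]
      simp
    by_cases hq : Nat.clog 2 D ≤ q
    · rw [if_pos (hc.2 hq), exec_skip]
      rw [min_eq_right hq] at h6 h7
      rw [min_eq_right (by omega)]
      simp [setR_regs, h6, h7]
    · rw [if_neg (mt hc.1 hq)]
      rw [min_eq_left (by omega)] at h6 h7
      rw [min_eq_left (by omega)]
      simp [exec_seq, exec_setReg, setR_regs, h6, h7, pow_succ, mul_two]

/-- Rounding up to a power of two loses at most a factor 2; the summand 1 covers D = 0. Output size,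
memory layout and number of evaluations all rest on this. -/
theorem two_pow_clog_le (D : ℕ) : 2 ^ Nat.clog 2 D ≤ 2 * D + 1 := by
  rcases Nat.lt_or_ge 1 D with h | h
  · have h1 := Nat.pow_pred_clog_lt_self (b := 2) (by norm_num) h
    have h2 : 0 < Nat.clog 2 D := Nat.clog_pos (by norm_num) h
    obtain ⟨m, hm⟩ := Nat.exists_eq_add_of_le' h2
    rw [hm] at h1 ⊢
    simp only [Nat.pred_succ] at h1
    change 2 ^ (m + 1) ≤ _
    rw [pow_succ]
    omega
  · rw [Nat.clog_of_right_le_one h]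
    omega

/-- The coefficients of iterated antiderivatives, for the coefficients `A` and the left values `V`
of all coordinates. -/
noncomputable def iterCo (k d h : ℕ) (α β : ℝ) (A V : ℕ → ℝ) (c u : ℕ) : ℕ → ℝ :=
  intIter ((β - α) / 4) (fun l => if l < 2 ^ (h + 1) then A (l * d + c) else 0)
    (fun u => V (u * d + c)) (2 ^ (h + 1) + k) u

theorem mainProg_spec {k d : ℕ} (e : Module.Basis (Fin d) ℝ E) (F : (Fin k → E) → ℝ → E)
    (s : State) {n j h B R S : ℕ} {α β : ℝ} (p : PieceParams s k d j h α β)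
    (hn : s.regs 2 = n) (hS : s.regs 4 = S) (hB : B = n + 1 + k * d)
    (hR : R = B + (k * d + 1) + d) (hZ : s.regs 5 = R + n * S) (hj : j < n)
    (hM : (2 ^ (h + 1) + k) * d ≤ S) :
    (∀ c (hc : c < d), ∀ x,
      chebP (pieceCo (mainProg.exec (odeOracle e F) s) d j h c) (2 ^ (h + 1)) x
      = ∑ r ∈ Finset.range (2 ^ (h + 1)),
        nodeKernel (h + 1) (vpW (2 ^ h)) x (cc (2 ^ (h + 1) + r)) *
        e.repr (F (fun i => ∑ c' : Fin d,
          chebP (iterCo k d h α β (s.arr 3 j) (s.arr 5 j) c' (k - i)) (2 ^ (h + 1) + k + 1)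
            (cc (2 ^ (h + 1) + r)) • e c') (nodeAt α β h r)) ⟨c, hc⟩) ∧
    (∀ x y, x ≠ j → (mainProg.exec (odeOracle e F) s).arr 3 x y = s.arr 3 x y) ∧
    (∀ c < d, ∀ u < k, (mainProg.exec (odeOracle e F) s).arr 5 (j + 1) (u * d + c)
      = chebP (iterCo k d h α β (s.arr 3 j) (s.arr 5 j) c (u + 1)) (2 ^ (h + 1) + k + 1) 1) ∧
    (∀ x y, x ≠ j + 1 → (mainProg.exec (odeOracle e F) s).arr 5 x y = s.arr 5 x y) ∧
    (∀ c < d, ∀ l < 2 ^ (h + 1) + k,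
      (mainProg.exec (odeOracle e F) s).reals (R + j * S + (l * d + c))
        = iterCo k d h α β (s.arr 3 j) (s.arr 5 j) c k l) ∧
    (∀ a < s.regs 5, a < B ∨ R ≤ a → a < R + j * S ∨ R + (j + 1) * S ≤ a →
      (mainProg.exec (odeOracle e F) s).reals a = s.reals a) ∧
    (∀ r, r < 11 → (mainProg.exec (odeOracle e F) s).regs r = s.regs r) ∧
    (mainProg.exec (odeOracle e F) s).ints = Function.update (Function.update s.ints
      (n + 2 * j) (R + j * S)) (n + (2 * j + 1)) (2 ^ (h + 1) + k) := by
  set O := odeOracle e F with hO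
  set s1 := heapProg.exec O s with hs1
  set s2 := (Prog.loop 11 (.reg 1) coordProg).exec O s1 with hs2
  set s3 := (Prog.loop 20 nodesE askProg).exec O s2 with hs3
  set s4 := (Prog.loop 11 (.reg 1) filterProg).exec O s3 with hs4
  set s5 := dumpProg.exec O s4 with hs5
  have e5 : mainProg.exec O s = s5 := rfl
  rw [e5]
  have f1 : Fr [13] [0] s s1 := Prog.chk_frame O (by simp) heapProg rfl s
  have f2 : Fr [11, 12, 13, 14, 15, 16, 17, 18, 19] [1, 2, 4, 5, 7, 8] s1 s2 :=
    Prog.chk_frame O (by simp) (Prog.loop 11 (.reg 1) coordProg) rfl s1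
  have f4 : Fr [11, 13, 14, 15, 16, 17, 18, 19] [1, 3] s3 s4 :=
    Prog.chk_frame O (by simp) (Prog.loop 11 (.reg 1) filterProg) rfl s3
  have p1 := p.fr f1 (by simp)
  have p2 := p1.fr f2 (by simp)
  have heap1 : ∀ g, 1 ≤ g → g < 2 ^ (h + 2) → s1.arr 0 g 0 = cc g := fun g h1 h2 =>
    heapProg_spec O s g h1 (by rw [p.r6]; rw [pow_add] at h2; omega)
  have heap2 : ∀ g, 1 ≤ g → g < 2 ^ (h + 2) → s2.arr 0 g 0 = cc g := fun g h1 h2 => by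
    rw [f2.arr 0 (by simp) (by simp), heap1 g h1 h2]
  obtain ⟨a1, a2, a3, a4⟩ := coordLoop_spec O s1 p1 heap1
  rw [← hs2] at a1 a2 a3 a4
  have hrow : rowCo s1 k d j h α β = iterCo k d h α β (s.arr 3 j) (s.arr 5 j) := by
    rw [rowCo_congr (s := s) (fun y => f1.arr 3 (by simp) (by simp) _ _)
      (fun y => f1.arr 5 (by simp) (by simp) _ _)]
    rfl
  rw [hrow] at a1 a2 a3
  have r2 : ∀ r, r < 11 → s2.regs r = s.regs r := fun r hr => by
    rw [f2.regs r (by simp; omega), f1.regs r (by simp; omega)]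
  have hl2 : ∀ a < s.regs 5, s2.reals a = s.reals a := fun a ha => by
    rw [f2.low a (by rw [f1.regs 5 (by simp)]; exact ha), f1.low a ha]
  have hZ' : R ≤ s.regs 5 := by omega
  obtain ⟨b1, b2⟩ := askLoop_spec e F s2 p2 (B := B) (by rw [r2 2 (by simp), hn, hB])
    (by rw [r2 5 (by simp)]; omega) (by omega) heap2
  rw [← hO, ← hs3] at b1 b2
  rw [← hR] at b2
  have p3 := p2.askFr b2 (by omega)
  have heap3 : ∀ g, 1 ≤ g → g < 2 ^ (h + 2) → s3.arr 0 g 0 = cc g := fun g h1 h2 => by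
    rw [b2.arr 0 (by simp) (by simp), heap2 g h1 h2]
  obtain ⟨c1, c2⟩ := filterLoop_spec O s3 p3 heap3
  rw [← hs4] at c1 c2
  have p4 := p3.fr f4 (by simp)
  have r4 : ∀ r, r < 11 → s4.regs r = s.regs r := fun r hr => by
    rw [f4.regs r (by simp; omega), b2.regs r (by omega) (by omega), r2 r hr]
  have hjS : (j + 1) * S ≤ n * S := Nat.mul_le_mul_right _ hj
  have hjS' : (j + 1) * S = j * S + S := by ring
  have hR4 : R + j * S = outE.val s4 := by
    simp [outE, resE, argE, r4, p.r0, p.r1, p.r9, hn, hS, hR, hB]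
  obtain ⟨d1, d2, d3, d4⟩ := dumpProg_spec O s4 p4 hR4 (by rw [r4 5 (by simp)]; omega)
  rw [← hs5] at d1 d2 d3 d4
  have harr5 : ∀ ρ x y, s5.arr ρ x y = s4.arr ρ x y := fun ρ x y => by
    simp only [State.arr, d3 5 (by simp)]
    exact d2 _ (by rw [r4 5 (by simp)]; omega)
  have hlow4 : ∀ a < s.regs 5, a < B ∨ R ≤ a → s4.reals a = s.reals a := fun a ha hab => by
    rw [f4.low a (by rw [b2.regs 5 (by simp) (by simp), r2 5 (by simp)]; exact ha),
      b2.low a (by rw [r2 5 (by simp)]; exact ha) hab, hl2 a ha]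
  refine ⟨fun c hc x => ?_, fun x y hx => ?_, fun c hc u hu => ?_, fun x y hx => ?_,
    fun c hc l hl => ?_, fun a ha h1 h2 => ?_, fun r hr => ?_, ?_⟩
  · have : pieceCo s5 d j h c = pieceCo s4 d j h c := by funext l; simp only [pieceCo, harr5]
    rw [this, c1 c hc x]
    refine Finset.sum_congr rfl fun r hr => ?_
    rw [b1 r (Finset.mem_range.1 hr) c hc]
    congr 4
    funext i
    refine Finset.sum_congr rfl fun c' _ => ?_
    -- Slot i of the argument is the derivative of order i, obtained after k - i integrations.
    have := a1 c' c'.2 (k - i - 1) (by have := i.2; omega) r (Finset.mem_range.1 hr)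
    have hi := i.2
    rw [show k - (k - (i : ℕ) - 1 + 1) = i by omega,
      show k - (i : ℕ) - 1 + 1 = k - i by omega] at this
    rw [this]
  · rw [harr5, c2 x y hx, b2.arr 3 (by simp) (by simp), f2.arr 3 (by simp) (by simp),
      f1.arr 3 (by simp) (by simp)]
  · rw [harr5, f4.arr 5 (by simp) (by simp), b2.arr 5 (by simp) (by simp), a2 c hc u hu]
  · rw [harr5, f4.arr 5 (by simp) (by simp), b2.arr 5 (by simp) (by simp), a4 x y hx,
      f1.arr 5 (by simp) (by simp)]
  · have hlt : l * d + c < (2 ^ (h + 1) + k) * d :=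
      calc l * d + c < l * d + d := by omega
        _ = (l + 1) * d := by ring
        _ ≤ _ := Nat.mul_le_mul_right _ hl
    rw [d1 _ hlt, f4.arr 8 (by simp) (by simp), b2.arr 8 (by simp) (by simp), a3 c hc l hl]
  · rw [d2 a (by omega), hlow4 a ha h1]
  · by_cases h13 : r = 13
    · omega
    · rw [d3 r h13, r4 r hr]
  · rw [d4, r4 2 (by simp), hn, f4.ints, b2.ints, f2.ints, f1.ints]

end RealRAM


namespace RealRAM

variable {E : Type*} [NormedAddCommGroup E] [NormedSpace ℝ E]

/-! ### One pass -/

/-- The memory layout between two pieces. -/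
structure Layout (s : State) (k d n N S R : ℕ) (D : ℕ → ℕ) (m : ℕ → ℝ) : Prop where
  r0 : s.regs 0 = k
  r1 : s.regs 1 = d
  r2 : s.regs 2 = n
  r3 : s.regs 3 = N
  r4 : s.regs 4 = S
  r5 : s.regs 5 = R + n * S
  deg : ∀ i < n, s.ints i = D i
  low : ∀ a < n + 1 + k * d, s.reals a = m a

/-- The contents of the memory of `s'` concerning piece `j`, after this piece was treated in a pass
that started from `s`. -/
structure PieceDone {k d : ℕ} (e : Module.Basis (Fin d) ℝ E) (F : (Fin k → E) → ℝ → E)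
    (s s' : State) (n S R j h : ℕ) (α β : ℝ) : Prop where
  fit : ∀ c (hc : c < d), ∀ x, chebP (pieceCo s' d j h c) (2 ^ (h + 1)) x
      = ∑ r ∈ Finset.range (2 ^ (h + 1)),
        nodeKernel (h + 1) (vpW (2 ^ h)) x (cc (2 ^ (h + 1) + r)) *
        e.repr (F (fun i => ∑ c' : Fin d,
          chebP (iterCo k d h α β (s.arr 3 j) (s'.arr 5 j) c' (k - i)) (2 ^ (h + 1) + k + 1)
            (cc (2 ^ (h + 1) + r)) • e c') (nodeAt α β h r)) ⟨c, hc⟩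
  next : ∀ c < d, ∀ u < k, s'.arr 5 (j + 1) (u * d + c)
      = chebP (iterCo k d h α β (s.arr 3 j) (s'.arr 5 j) c (u + 1)) (2 ^ (h + 1) + k + 1) 1
  out : ∀ c < d, ∀ l < 2 ^ (h + 1) + k, s'.reals (R + j * S + (l * d + c))
      = iterCo k d h α β (s.arr 3 j) (s'.arr 5 j) c k l
  addr : s'.ints (n + 2 * j) = R + j * S
  size : s'.ints (n + (2 * j + 1)) = 2 ^ (h + 1) + k

theorem pieceProg_spec {k d n N S R : ℕ} {D : ℕ → ℕ} {m : ℕ → ℝ} (e : Module.Basis (Fin d) ℝ E)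
    (F : (Fin k → E) → ℝ → E) (s : State) {j : ℕ} (lay : Layout s k d n N S R D m)
    (h9 : s.regs 9 = j) (hR : R = n + 1 + k * d + (k * d + 1) + d) (hj : j < n)
    (hM : (2 ^ (Nat.clog 2 (D j) + 1) + k) * d ≤ S) :
    Layout (pieceProg.exec (odeOracle e F) s) k d n N S R D m ∧
    PieceDone e F s (pieceProg.exec (odeOracle e F) s) n S R j (Nat.clog 2 (D j)) (m j) (m (j + 1)) ∧
    (∀ x y, x ≠ j → (pieceProg.exec (odeOracle e F) s).arr 3 x y = s.arr 3 x y) ∧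
    (∀ x y, x ≠ j + 1 → (pieceProg.exec (odeOracle e F) s).arr 5 x y = s.arr 5 x y) ∧
    (∀ a < s.regs 5, R ≤ a → a < R + j * S ∨ R + (j + 1) * S ≤ a →
      (pieceProg.exec (odeOracle e F) s).reals a = s.reals a) ∧
    (∀ i, i ≠ n + 2 * j → i ≠ n + (2 * j + 1) →
      (pieceProg.exec (odeOracle e F) s).ints i = s.ints i) := by
  set h := Nat.clog 2 (D j) with hh
  set s1 := (s.setR 8 (D j)) with hs1
  set s2 := sizeProg.exec (odeOracle e F) s1 with hs2
  have e1 : pieceProg.exec (odeOracle e F) s = mainProg.exec (odeOracle e F) s2 := by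
    have : (Prog.setReg 8 (.mem (.reg 9))).exec (odeOracle e F) s = s1 := by
      rw [exec_setReg, hs1, IExp.val_mem, IExp.val_reg, h9, lay.deg j hj]
    rw [pieceProg, exec_seq, exec_seq, this]
  rw [e1]
  obtain ⟨z6, z7, f2⟩ := sizeProg_spec (odeOracle e F) s1 (D := D j) (by simp [hs1, setR_regs])
  rw [← hs2] at z6 z7 f2
  have f1 : Fr [6, 7, 8, 13] [] s s2 :=
    (Fr.setR (W := [6, 7, 8, 13]) (A := []) (by simp) (r := 8) (by simp) (D j)).trans (by simp)
      (f2.mono (by simp) (by simp))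
  have r5 := lay.r5
  have lowlt : ∀ a < n + 1 + k * d, a < s.regs 5 := fun a ha => by omega
  have p : PieceParams s2 k d j h (m j) (m (j + 1)) := by
    refine ⟨by rw [f1.regs 0 (by simp), lay.r0], by rw [f1.regs 1 (by simp), lay.r1], z6, z7,
      by rw [f1.regs 9 (by simp), h9], ?_, ?_, ?_⟩
    · rw [f1.regs 5 (by simp)]; omega
    · rw [f1.low _ (by omega), lay.low _ (by omega)]
    · rw [f1.low _ (by omega), lay.low _ (by omega)]
  obtain ⟨a1, a2, a3, a4, a5, a6, a7, a8⟩ := mainProg_spec e F s2 (n := n) (R := R) (S := S) p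
    (by rw [f1.regs 2 (by simp), lay.r2]) (by rw [f1.regs 4 (by simp), lay.r4]) rfl hR
    (by rw [f1.regs 5 (by simp), r5]) hj hM
  set s3 := mainProg.exec (odeOracle e F) s2 with hs3
  have i3 : s2.arr 3 = s.arr 3 := by
    funext x y; exact f1.arr 3 (by simp) (by simp) x y
  have i5 : s2.arr 5 = s.arr 5 := by
    funext x y; exact f1.arr 5 (by simp) (by simp) x y
  have i5' : s3.arr 5 j = s.arr 5 j := by
    funext y; rw [a4 j y (by omega), i5]
  have hr : ∀ r < 6, s3.regs r = s.regs r := fun r hr => by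
    rw [a7 r (by omega), f1.regs r (by simp; omega)]
  have hi : ∀ i, i ≠ n + 2 * j → i ≠ n + (2 * j + 1) → s3.ints i = s.ints i := fun i h1 h2 => by
    rw [a8, Function.update_of_ne h2, Function.update_of_ne h1, f1.ints]
  refine ⟨⟨?_, ?_, ?_, ?_, ?_, ?_, ?_, ?_⟩, ⟨?_, ?_, ?_, ?_, ?_⟩, ?_, ?_, ?_, hi⟩
  · rw [hr 0 (by simp), lay.r0]
  · rw [hr 1 (by simp), lay.r1]
  · rw [hr 2 (by simp), lay.r2]
  · rw [hr 3 (by simp), lay.r3]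
  · rw [hr 4 (by simp), lay.r4]
  · rw [hr 5 (by simp), lay.r5]
  · intro i hi'
    rw [hi i (by omega) (by omega), lay.deg i hi']
  · intro a ha
    rw [a6 a (by rw [f1.regs 5 (by simp)]; exact lowlt a ha) (Or.inl ha) (Or.inl (by omega)),
      f1.low a (lowlt a ha), lay.low a ha]
  · rw [i5', ← i5, ← i3]; exact a1
  · rw [i5', ← i5, ← i3]; exact a3
  · rw [i5', ← i5, ← i3]; exact a5
  · rw [a8, Function.update_of_ne (by omega), Function.update_self]
  · rw [a8, Function.update_self]
  · intro x y hx; rw [a2 x y hx, i3]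
  · intro x y hx; rw [a4 x y hx, i5]
  · intro a ha h1 h2
    rw [a6 a (by rw [f1.regs 5 (by simp)]; exact ha) (Or.inr h1) h2, f1.low a ha]

theorem startProg_spec (O : Oracle) (s : State) {k d n : ℕ} (r0 : s.regs 0 = k) (r1 : s.regs 1 = d)
    (r2 : s.regs 2 = n) (h5 : n + 1 + k * d ≤ s.regs 5) :
    (∀ u < k, ∀ c < d, (startProg.exec O s).arr 5 0 (u * d + c)
      = s.reals (n + 1 + ((k - (u + 1)) * d + c))) ∧
    Fr [11, 12] [5] s (startProg.exec O s) := by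
  have f : Fr [11, 12] [5] s (startProg.exec O s) := Prog.chk_frame O (by simp) startProg rfl s
  refine ⟨?_, f⟩
  have key := exec_loop_frame O [11, 12] [5] (r := 12) (e := .reg 0)
    (P := .loop 11 (.reg 1)
    (wr 5 0 (compE (.reg 12))
      (.mem (.reg 2 + 1 + ((.reg 0 - (.reg 12 + 1)) * .reg 1 + .reg 11))))) (s := s)
    (by simp) (by simp) rfl
    (fun q s' => ∀ u < q, ∀ c < d, s'.arr 5 0 (u * d + c)
      = s.reals (n + 1 + ((k - (u + 1)) * d + c))) (by simp) ?_
  · rw [IExp.val_reg, r0] at key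
    exact key
  · intro q hq s' hf hI
    rw [IExp.val_reg, r0] at hq
    set t := s'.setR 12 q with ht
    have ft : Fr [11, 12] [5] s t := hf.trans (by simp) (Fr.setR (by simp) (by simp) q)
    have hv : (IExp.reg 1).val t = d := by rw [IExp.val_reg, ft.regs 1 (by simp), r1]
    have c1 := fill_loop O (e := .reg 1) (ex := 0) (ey := compE (.reg 12)) (r := 11) (ρ := 5)
      (rhs := .mem (.reg 2 + 1 + ((.reg 0 - (.reg 12 + 1)) * .reg 1 + .reg 11))) (s := t)
      (by simp) (by simp) rfl (fun _ => 0) (fun c => q * d + c)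
      (fun c => s.reals (n + 1 + ((k - (q + 1)) * d + c))) (fun i _ i' _ _ hh => by omega)
      (fun i hi s'' hg _ => by
        rw [hv] at hi
        have hlt : (k - (q + 1)) * d + i < k * d :=
          calc (k - (q + 1)) * d + i < (k - (q + 1)) * d + d := by omega
            _ = (k - (q + 1) + 1) * d := by ring
            _ ≤ _ := Nat.mul_le_mul_right _ (by omega)
        have h12 : t.regs 12 = q := by simp [ht, setR_regs]
        refine ⟨by simp, ?_, ?_⟩
        · simp [compE, setR_regs, hg.regs, ft.regs 1, r1, h12]
        · simp only [RExp.val_mem, IExp.val_add, IExp.val_mul, IExp.val_sub, IExp.val_reg,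
            IExp.val_one, setR_regs, setR_reals]
          norm_num
          simp only [hg.regs 2 (by simp), hg.regs 0 (by simp), hg.regs 12 (by simp),
            hg.regs 1 (by simp), ft.regs 2 (by simp), ft.regs 0 (by simp), ft.regs 1 (by simp),
            h12, r0, r1, r2]
          rw [hg.low _ (by rw [ft.regs 5 (by simp)]; omega), ft.low _ (by omega)])
    rw [hv] at c1
    intro u hu c hc
    rcases Nat.lt_succ_iff_lt_or_eq.1 hu with hlt | rfl
    · rw [c1.2 0 (u * d + c), ht, setR_arr _ (by simp), hI u hlt c hc]
      rintro i hi ⟨-, hh⟩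
      have := mul_add_inj hc hi hh
      omega
    · exact c1.1 c hc

theorem passProg_spec {k d n N S R : ℕ} {D : ℕ → ℕ} {m : ℕ → ℝ} (e : Module.Basis (Fin d) ℝ E)
    (F : (Fin k → E) → ℝ → E) (s : State) (lay : Layout s k d n N S R D m)
    (hR : R = n + 1 + k * d + (k * d + 1) + d)
    (hM : ∀ j < n, (2 ^ (Nat.clog 2 (D j) + 1) + k) * d ≤ S) :
    Layout (passProg.exec (odeOracle e F) s) k d n N S R D m ∧
    (∀ u < k, ∀ c < d, (passProg.exec (odeOracle e F) s).arr 5 0 (u * d + c)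
      = m (n + 1 + ((k - (u + 1)) * d + c))) ∧
    ∀ j < n, PieceDone e F s (passProg.exec (odeOracle e F) s) n S R j (Nat.clog 2 (D j))
      (m j) (m (j + 1)) := by
  set O := odeOracle e F with hO
  set s1 := startProg.exec O s with hs1
  have r5 := lay.r5
  obtain ⟨st, f⟩ := startProg_spec O s lay.r0 lay.r1 lay.r2 (by omega)
  rw [← hs1] at st f
  have key := exec_loop_rule O (r := 9) (e := .reg 2) (P := pieceProg) (s := s1)
    -- Coefficients of untreated pieces are still those from before the pass, while the left values
    -- in array `5` are those of the current pass, since piece j writes row j + 1 just before piece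
    -- j + 1 reads it.
    (fun q s' => Layout s' k d n N S R D m ∧
      (∀ u < k, ∀ c < d, s'.arr 5 0 (u * d + c) = m (n + 1 + ((k - (u + 1)) * d + c))) ∧
      (∀ j, q ≤ j → s'.arr 3 j = s.arr 3 j) ∧
      ∀ j < q, PieceDone e F s s' n S R j (Nat.clog 2 (D j)) (m j) (m (j + 1))) ?_ ?_
  · rw [IExp.val_reg, f.regs 2 (by simp), lay.r2] at key
    have e1 : passProg.exec O s = (Prog.loop 9 (.reg 2) pieceProg).exec O s1 := rfl
    rw [e1]
    exact ⟨key.1, key.2.1, key.2.2.2⟩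
  · refine ⟨⟨?_, ?_, ?_, ?_, ?_, ?_, ?_, ?_⟩, fun u hu c hc => ?_, fun j _ => ?_, by simp⟩
    · rw [f.regs 0 (by simp), lay.r0]
    · rw [f.regs 1 (by simp), lay.r1]
    · rw [f.regs 2 (by simp), lay.r2]
    · rw [f.regs 3 (by simp), lay.r3]
    · rw [f.regs 4 (by simp), lay.r4]
    · rw [f.regs 5 (by simp), lay.r5]
    · intro i hi; rw [f.ints, lay.deg i hi]
    · intro a ha; rw [f.low a (by omega), lay.low a ha]
    · rw [st u hu c hc, lay.low]
      have : (k - (u + 1)) * d + c < k * d :=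
          calc (k - (u + 1)) * d + c < (k - (u + 1)) * d + d := by omega
            _ = (k - (u + 1) + 1) * d := by ring
            _ ≤ _ := Nat.mul_le_mul_right _ (by omega)
      omega
    · funext y; exact f.arr 3 (by simp) (by simp) j y
  · rintro q hq s' ⟨h1, h2, h3, h4⟩
    rw [IExp.val_reg, f.regs 2 (by simp), lay.r2] at hq
    have hreg : ∀ r < 9, (s'.setR 9 q).regs r = s'.regs r := fun r hr => by
      rw [setR_regs, if_neg (by omega)]
    have lay' : Layout (s'.setR 9 q) k d n N S R D m :=
      ⟨by rw [hreg 0 (by simp), h1.r0], by rw [hreg 1 (by simp), h1.r1],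
        by rw [hreg 2 (by simp), h1.r2], by rw [hreg 3 (by simp), h1.r3],
        by rw [hreg 4 (by simp), h1.r4], by rw [hreg 5 (by simp), h1.r5], h1.deg, h1.low⟩
    have ga : (s'.setR 9 q).arr = s'.arr := setR_arr _ (by simp) _
    obtain ⟨b1, b2, b3, b4, b5, b6⟩ := pieceProg_spec e F (s'.setR 9 q) lay' (j := q)
      (by simp [setR_regs]) hR hq (hM q hq)
    rw [← hO] at b1 b2 b3 b4 b5 b6
    set s'' := pieceProg.exec O (s'.setR 9 q) with hs''
    rw [ga] at b3 b4
    refine ⟨b1, fun u hu c hc => by rw [b4 _ _ (by omega), h2 u hu c hc], fun j hj => ?_,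
      fun j hj => ?_⟩
    · funext y; rw [b3 j y (by omega), h3 j (by omega)]
    · rcases Nat.lt_succ_iff_lt_or_eq.1 hj with hlt | rfl
      · have g := h4 j hlt
        have i5 : s''.arr 5 j = s'.arr 5 j := by funext y; exact b4 j y (by omega)
        have i5' : s''.arr 5 (j + 1) = s'.arr 5 (j + 1) := by funext y; exact b4 _ y (by omega)
        have hqS : (j + 1) * S ≤ q * S := Nat.mul_le_mul_right _ hlt
        have hqn : q * S ≤ n * S := Nat.mul_le_mul_right _ hq.le
        have hjS : (j + 1) * S = j * S + S := by ring
        refine ⟨?_, ?_, ?_, ?_, ?_⟩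
        · have : ∀ c, pieceCo s'' d j (Nat.clog 2 (D j)) c = pieceCo s' d j (Nat.clog 2 (D j)) c :=
            fun c => by funext l; simp only [pieceCo, b3 j _ (by omega : j ≠ q)]
          simp only [this, i5]
          exact g.fit
        · simp only [i5, i5']
          exact g.next
        · intro c hc l hl
          have hlt : l * d + c < (2 ^ (Nat.clog 2 (D j) + 1) + k) * d :=
            calc l * d + c < l * d + d := by omega
              _ = (l + 1) * d := by ring
              _ ≤ _ := Nat.mul_le_mul_right _ hl
          have := hM j (by omega)
          rw [i5, ← g.out c hc l hl]
          refine b5 _ ?_ (by omega) (Or.inl (by omega))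
          rw [hreg 5 (by simp), h1.r5]
          omega
        · rw [b6 _ (by omega) (by omega)]; exact g.addr
        · rw [b6 _ (by omega) (by omega)]; exact g.size
      · have i3 : (s'.setR 9 j).arr 3 j = s.arr 3 j := by rw [ga, h3 j le_rfl]
        refine ⟨?_, ?_, ?_, b2.addr, b2.size⟩
        · rw [← i3]; exact b2.fit
        · rw [← i3]; exact b2.next
        · rw [← i3]; exact b2.out

end RealRAM


namespace RealRAM

variable {E : Type*} [NormedAddCommGroup E] [NormedSpace ℝ E]

/-! ### The iteration in terms of functions -/

/-- One Picard step on `n` pieces: `X j u` is the `u`-fold antiderivative of `y j`, and `y' j` is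
the filtered right-hand side. -/
structure PicardStep {k : ℕ} (F : (Fin k → E) → ℝ → E) (v : Fin k → E) (n : ℕ) (τ : ℕ → ℝ)
    (h : ℕ → ℕ) (y y' : ℕ → ℝ → E) (X : ℕ → ℕ → ℝ → E) : Prop where
  zero : ∀ j < n, X j 0 = y j
  deriv : ∀ j < n, ∀ u < k, ∀ t, HasDerivAt (X j (u + 1)) (X j u t) t
  start : 0 < n → ∀ i : Fin k, X 0 (k - i) (τ 0) = v i
  glue : ∀ j, j + 1 < n → ∀ u < k, X (j + 1) (u + 1) (τ (j + 1)) = X j (u + 1) (τ (j + 1))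
  fit : ∀ j < n, ∀ t, y' j t = ∑ r ∈ Finset.range (2 ^ (h j + 1)),
    nodeKernel (h j + 1) (vpW (2 ^ h j)) ((2 * t - τ j - τ (j + 1)) / (τ (j + 1) - τ j))
      (cc (2 ^ (h j + 1) + r)) •
      F (fun i => X j (k - i) (nodeAt (τ j) (τ (j + 1)) (h j) r))
        (nodeAt (τ j) (τ (j + 1)) (h j) r)

/-- The function with the given coefficients on a piece. -/
noncomputable def pieceFun {d : ℕ} (e : Module.Basis (Fin d) ℝ E) (α β : ℝ) (a : ℕ → ℕ → ℝ)
    (n : ℕ) (t : ℝ) : E :=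
  ∑ c : Fin d, chebP (a c) n ((2 * t - α - β) / (β - α)) • e c

theorem iterCo_eq_zero (k d h : ℕ) (α β : ℝ) (A V : ℕ → ℝ) (c u l : ℕ)
    (hl : 2 ^ (h + 1) + u ≤ l) : iterCo k d h α β A V c u l = 0 :=
  intIter_eq_zero (fun l hl => if_neg (by omega)) u l hl

theorem hasDerivAt_pieceFun {k d : ℕ} (e : Module.Basis (Fin d) ℝ E) {α β : ℝ} (hαβ : α < β)
    (h : ℕ) (A V : ℕ → ℝ) {u : ℕ} (hu : u < k) (t : ℝ) :
    HasDerivAt (pieceFun e α β (fun c => iterCo k d h α β A V c (u + 1)) (2 ^ (h + 1) + k + 1))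
      (pieceFun e α β (fun c => iterCo k d h α β A V c u) (2 ^ (h + 1) + k + 1) t) t := by
  have hne : β - α ≠ 0 := by linarith
  have hx : HasDerivAt (fun t : ℝ => (2 * t - α - β) / (β - α)) (2 / (β - α)) t := by
    have := ((((hasDerivAt_id t).const_mul 2).sub_const α).sub_const β).div_const (β - α)
    simpa using this
  refine HasDerivAt.fun_sum fun c _ => HasDerivAt.smul_const ?_ (e c)
  have h0 : ∀ l, 2 ^ (h + 1) + k ≤ l → iterCo k d h α β A V c u l = 0 := fun l hl =>
    iterCo_eq_zero _ _ _ _ _ _ _ _ _ _ (by omega)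
  have h1 := hasDerivAt_chebP_intCo (q := (β - α) / 4) (v := V (u * d + c))
    (n := 2 ^ (h + 1) + k) (by have := Nat.one_le_two_pow (n := h + 1); omega) h0 ((2 * t - α - β) / (β - α))
  have h2 := h1.comp t hx
  have e1 : 2 * ((β - α) / 4) * chebP (iterCo k d h α β A V c u) (2 ^ (h + 1) + k)
      ((2 * t - α - β) / (β - α)) * (2 / (β - α))
      = chebP (iterCo k d h α β A V c u) (2 ^ (h + 1) + k + 1)
      ((2 * t - α - β) / (β - α)) := by
    rw [chebP, chebP, Finset.sum_range_succ, h0 _ le_rfl]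
    field_simp
    ring
  rw [e1] at h2
  exact h2

theorem affine_left {α β : ℝ} (h : α < β) : (2 * α - α - β) / (β - α) = -1 := by
  have : β - α ≠ 0 := by linarith
  field_simp
  ring

theorem affine_right {α β : ℝ} (h : α < β) : (2 * β - α - β) / (β - α) = 1 := by
  have : β - α ≠ 0 := by linarith
  field_simp
  ring

theorem affine_nodeAt {α β : ℝ} (hαβ : α < β) (h r : ℕ) :
    (2 * nodeAt α β h r - α - β) / (β - α) = cc (2 ^ (h + 1) + r) := by
  have : β - α ≠ 0 := by linarith
  rw [nodeAt]
  field_simp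
  ring

/-- The memory is forgotten here: coordinates are assembled into vectors, and right end values
stored for one piece become the gluing condition for the next. -/
theorem picardStep_of_pieceDone {k d n S R : ℕ} (e : Module.Basis (Fin d) ℝ E)
    (F : (Fin k → E) → ℝ → E) (v : Fin k → E) (τ : ℕ → ℝ) (h : ℕ → ℕ)
    (hτ : ∀ j < n, τ j < τ (j + 1)) (s s' : State)
    (hst : ∀ i : Fin k, ∀ c : Fin d, s'.arr 5 0 ((k - (i + 1)) * d + c) = e.repr (v i) c)
    (hp : ∀ j < n, PieceDone e F s s' n S R j (h j) (τ j) (τ (j + 1))) :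
    PicardStep F v n τ h
      (fun j => pieceFun e (τ j) (τ (j + 1)) (pieceCo s d j (h j)) (2 ^ (h j + 1)))
      (fun j => pieceFun e (τ j) (τ (j + 1)) (pieceCo s' d j (h j)) (2 ^ (h j + 1)))
      (fun j u => pieceFun e (τ j) (τ (j + 1)) (fun c => iterCo k d (h j) (τ j) (τ (j + 1))
        (s.arr 3 j) (s'.arr 5 j) c u) (2 ^ (h j + 1) + k + 1)) := by
  have hleft : ∀ j < n, ∀ u, pieceFun e (τ j) (τ (j + 1)) (fun c => iterCo k d (h j) (τ j)
      (τ (j + 1)) (s.arr 3 j) (s'.arr 5 j) c (u + 1)) (2 ^ (h j + 1) + k + 1) (τ j)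
      = ∑ c : Fin d, s'.arr 5 j (u * d + c) • e c := by
    intro j hj u
    simp only [pieceFun, affine_left (hτ j hj)]
    refine Finset.sum_congr rfl fun c _ => ?_
    rw [iterCo, intIter, chebP_intCo_left]
  refine ⟨fun j hj => ?_, fun j hj u hu t => hasDerivAt_pieceFun e (hτ j hj) _ _ _ hu t,
    fun hn i => ?_, fun j hj u hu => ?_, fun j hj t => ?_⟩
  · funext t
    refine Finset.sum_congr rfl fun c _ => ?_
    change chebP (pieceCo s d j (h j) c) (2 ^ (h j + 1) + k + 1) _ • e c = _
    rw [add_assoc, chebP, Finset.sum_range_add, Finset.sum_eq_zero (s := Finset.range (k + 1)),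
      add_zero, chebP]
    intro l _
    simp [pieceCo]
  · have hi := i.2
    have := hleft 0 hn (k - (i + 1))
    rw [show k - ((i : ℕ) + 1) + 1 = k - i by omega] at this
    simp only [this, hst]
    exact e.sum_repr (v i)
  · simp only [hleft (j + 1) hj]
    simp only [pieceFun, affine_right (hτ j (by omega))]
    refine Finset.sum_congr rfl fun c _ => ?_
    rw [(hp j (by omega)).next c c.2 u hu]
  · simp only [pieceFun, affine_nodeAt (hτ j hj)]
    refine e.repr.injective (Finsupp.ext fun c => ?_)
    have h1 : ∀ a : Fin d → ℝ, e.repr (∑ c, a c • e c) c = a c := fun a =>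
      congrFun (e.repr_sum_self a) c
    rw [h1, (hp j hj).fit c c.2, map_sum, Finsupp.finsetSum_apply]
    refine Finset.sum_congr rfl fun r _ => ?_
    rw [map_smul, Finsupp.smul_apply, smul_eq_mul]

theorem outputPiece_of_pieceDone {k d n S R j h : ℕ} {α β : ℝ} (e : Module.Basis (Fin d) ℝ E)
    (F : (Fin k → E) → ℝ → E) (s s' s'' : State) (hp : PieceDone e F s s' n S R j h α β)
    (hn : s''.regs 0 = n) (hi : s''.ints = s'.ints) (hr : s''.reals = s'.reals) :
    outputSize s'' j = 2 ^ (h + 1) + k ∧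
    outputPiece e s'' α β j = pieceFun e α β (fun c => iterCo k d h α β
        (s.arr 3 j) (s'.arr 5 j) c k) (2 ^ (h + 1) + k + 1) := by
  have h1 : outputSize s'' j = 2 ^ (h + 1) + k := by
    rw [outputSize, hn, hi, hp.size]
  refine ⟨h1, ?_⟩
  funext t
  rw [outputPiece, h1, hn, hi, hr, hp.addr, pieceFun]
  simp only [vecAt, Finset.smul_sum]
  rw [Finset.sum_comm]
  refine Finset.sum_congr rfl fun c _ => ?_
  rw [chebP, Finset.sum_range_succ, iterCo_eq_zero _ _ _ _ _ _ _ _ _ _ le_rfl, zero_mul, add_zero,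
    Finset.sum_smul]
  refine Finset.sum_congr rfl fun l hl => ?_
  rw [add_assoc, hp.out c c.2 l (Finset.mem_range.1 hl), smul_smul, mul_comm, chebT]

/-! ### The solver -/

theorem setupProg_spec (O : Oracle) (s : State) {k d n N : ℕ} (r0 : s.regs 0 = k)
    (r1 : s.regs 1 = d) (r2 : s.regs 2 = n) (r3 : s.regs 3 = N) :
    (setupProg.exec O s).reals = s.reals ∧
    Layout (setupProg.exec O s) k d n N ((4 * (∑ i ∈ Finset.range n, s.ints i) + k + 4) * d)
      (n + 1 + k * d + (k * d + 1) + d) s.ints s.reals := by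
  have key := exec_loop_rule O (r := 9) (e := .reg 2) (P := .setReg 8 (.reg 8 + .mem (.reg 9)))
    (s := s.setR 8 0)
    (fun q s' => (∀ r < 8, s'.regs r = s.regs r) ∧ s'.ints = s.ints ∧ s'.reals = s.reals ∧
      s'.regs 8 = ∑ i ∈ Finset.range q, s.ints i) ?_ ?_
  · set s1 := (Prog.loop 9 (.reg 2) (.setReg 8 (.reg 8 + .mem (.reg 9)))).exec O (s.setR 8 0)
      with hs1
    rw [IExp.val_reg, setR_regs, if_neg (by simp), r2] at key
    obtain ⟨k1, k2, k3, k4⟩ := key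
    have e1 : setupProg.exec O s = (Prog.setReg 4 ((4 * .reg 8 + .reg 0 + 4) * .reg 1) ;;
      .setReg 5 (resE + .reg 1 + .reg 2 * .reg 4)).exec O s1 := rfl
    rw [e1, exec_seq, exec_setReg, exec_setReg]
    refine ⟨k3, ⟨?_, ?_, ?_, ?_, ?_, ?_, ?_, ?_⟩⟩
    · simp [setR_regs, k1, r0]
    · simp [setR_regs, k1, r1]
    · simp [setR_regs, k1, r2]
    · simp [setR_regs, k1, r3]
    · simp [setR_regs, k1, k4, r0, r1]
    · simp [setR_regs, k1, k4, r0, r1, r2, resE, argE]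
    · intro i _; rw [← k2]; rfl
    · intro a _; rw [← k3]; rfl
  · refine ⟨fun r hr => ?_, rfl, rfl, by simp [setR_regs]⟩
    rw [setR_regs, if_neg (by omega)]
  · rintro q - s' ⟨k1, k2, k3, k4⟩
    rw [exec_setReg]
    refine ⟨fun r hr => ?_, k2, k3, ?_⟩
    · rw [setR_regs, if_neg (by omega), setR_regs, if_neg (by omega), k1 r hr]
    · rw [setR_regs, if_pos rfl, Finset.sum_range_succ]
      simp only [IExp.val_add, IExp.val_reg, IExp.val_mem, setR_regs]
      norm_num
      rw [k4]
      simp only [State.setR, k2]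

theorem solver_spec {k d n N : ℕ} (e : Module.Basis (Fin d) ℝ E) (F : (Fin k → E) → ℝ → E)
    (v : Fin k → E) (τ : Fin (n + 1) → ℝ) (hτ : StrictMono τ) (D : Fin n → ℕ) :
    ∃ (h : ℕ → ℕ) (τ' : ℕ → ℝ) (y : ℕ → ℕ → ℝ → E) (X : ℕ → ℕ → ℕ → ℝ → E),
      (∀ j : Fin n, h j = Nat.clog 2 (D j)) ∧ (∀ j : Fin (n + 1), τ' j = τ j) ∧
      (∀ j t, y 0 j t = 0) ∧
      (∀ p < N + 2, PicardStep F v n τ' h (y p) (y (p + 1)) (X p)) ∧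
      ∀ j : Fin n,
        outputSize (solver.exec (odeOracle e F) (odeInput e v τ D N)) j = 2 ^ (h j + 1) + k ∧
        outputPiece e (solver.exec (odeOracle e F) (odeInput e v τ D N)) (τ j.castSucc) (τ j.succ) j
          = X (N + 1) j k := by
  set O := odeOracle e F with hO
  set s0 := odeInput e v τ D N with hs0
  set D' := s0.ints with hD'
  set m := s0.reals with hm
  have hDj : ∀ j : Fin n, D' j = D j := fun j => by
    simp [hD', hs0, odeInput]
  have hmj : ∀ j : Fin (n + 1), m j = τ j := fun j => by
    simp only [hm, hs0, odeInput, dif_pos j.2]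
  have hmj' : ∀ j < n, m j < m (j + 1) := fun j hj => by
    have h1 := hmj (Fin.castSucc ⟨j, hj⟩)
    have h2 := hmj (Fin.succ ⟨j, hj⟩)
    simp only [Fin.val_castSucc, Fin.val_succ] at h1 h2
    rw [h1, h2]
    exact hτ (Fin.castSucc_lt_succ)
  have hv : ∀ i : Fin k, ∀ c : Fin d, m (n + 1 + ((i : ℕ) * d + c)) = e.repr (v i) c := by
    intro i c
    have hne : ¬ (n + 1 + ((i : ℕ) * d + c) < n + 1) := by omega
    simp only [hm, hs0, odeInput, dif_neg hne]
    rw [Finset.sum_eq_single i, Finset.sum_eq_single c]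
    · simp
    · intro c' _ hc
      rw [if_neg]
      intro hh
      exact hc (Fin.ext (by omega))
    · simp
    · intro i' _ hi
      refine Finset.sum_eq_zero fun c' _ => if_neg fun hh => hi (Fin.ext ?_)
      have := mul_add_inj c.2 c'.2 (Nat.add_left_cancel hh)
      omega
    · simp
  -- The arrays lie beyond the input and are zero initially, so the iteration starts from the zero
  -- polynomial without any initialization.
  have hbig : ∀ a, n + 1 + k * d ≤ a → m a = 0 := by
    intro a ha
    have hne : ¬ (a < n + 1) := by omega
    simp only [hm, hs0, odeInput, dif_neg hne]
    refine Finset.sum_eq_zero fun i _ => Finset.sum_eq_zero fun c _ => if_neg fun hh => ?_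
    have : (i : ℕ) * d + c < k * d :=
      calc (i : ℕ) * d + c < i * d + d := by have := c.2; omega
        _ = (i + 1) * d := by ring
        _ ≤ k * d := Nat.mul_le_mul_right _ i.2
    omega
  obtain ⟨hre, lay⟩ := setupProg_spec O s0 (k := k) (d := d) (n := n) (N := N)
    (by simp [hs0, odeInput]) (by simp [hs0, odeInput]) (by simp [hs0, odeInput])
    (by simp [hs0, odeInput])
  set s1 := setupProg.exec O s0 with hs1
  set S := (4 * (∑ i ∈ Finset.range n, s0.ints i) + k + 4) * d with hS
  set R := n + 1 + k * d + (k * d + 1) + d with hR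
  have hM : ∀ j < n, (2 ^ (Nat.clog 2 (D' j) + 1) + k) * d ≤ S := by
    intro j hj
    refine Nat.mul_le_mul_right _ ?_
    have h1 := two_pow_clog_le (D' j)
    have h2 : D' j ≤ ∑ i ∈ Finset.range n, s0.ints i :=
      Finset.single_le_sum (f := D') (fun _ _ => Nat.zero_le _) (Finset.mem_range.2 hj)
    rw [pow_succ]
    omega
  -- The states between passes, named once so that every pass can be related to the next.
  let st : ℕ → State := fun p => Nat.rec s1 (fun q s => passProg.exec O (s.setR 10 q)) p
  have st0 : st 0 = s1 := rfl
  have st_succ : ∀ q, st (q + 1) = passProg.exec O ((st q).setR 10 q) := fun _ => rfl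
  have hloop : (Prog.loop 10 (.reg 3 + 2) passProg).exec O s1 = st (N + 2) := by
    have hv : (IExp.reg 3 + 2 : IExp).val s1 = N + 2 := by simp [lay.r3]
    rw [← hv]
    refine exec_loop_rule O (fun q s' => s' = st q) rfl ?_
    rintro q - s' rfl
    rfl
  clear_value st
  have setR_lay : ∀ {s : State} (q : ℕ), Layout s k d n N S R D' m →
      Layout (s.setR 10 q) k d n N S R D' m := by
    intro s q hl
    have hreg : ∀ r < 9, (s.setR 10 q).regs r = s.regs r := fun r hr => by
      rw [setR_regs, if_neg (by omega)]
    exact ⟨by rw [hreg 0 (by simp), hl.r0], by rw [hreg 1 (by simp), hl.r1],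
        by rw [hreg 2 (by simp), hl.r2], by rw [hreg 3 (by simp), hl.r3],
        by rw [hreg 4 (by simp), hl.r4], by rw [hreg 5 (by simp), hl.r5], hl.deg, hl.low⟩
  have st_lay : ∀ q, Layout (st q) k d n N S R D' m := by
    intro q
    induction q with
    | zero => rw [st0]; exact lay
    | succ q ih =>
      rw [st_succ]
      exact (passProg_spec e F _ (setR_lay q ih) hR hM).1
  have st_start : ∀ q, ∀ i : Fin k, ∀ c : Fin d,
      (st (q + 1)).arr 5 0 ((k - (i + 1)) * d + c) = e.repr (v i) c := by
    intro q i c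
    have hi := i.2
    have := (passProg_spec e F _ (setR_lay q (st_lay q)) hR hM).2.1 (k - (i + 1)) (by omega) c c.2
    rw [← hO, ← st_succ, show k - (k - ((i : ℕ) + 1) + 1) = i by omega, hv] at this
    exact this
  have st_piece : ∀ q, ∀ j < n, PieceDone e F (st q) (st (q + 1)) n S R j (Nat.clog 2 (D' j))
      (m j) (m (j + 1)) := by
    intro q j hj
    have := (passProg_spec e F _ (setR_lay q (st_lay q)) hR hM).2.2 j hj
    rw [← hO, ← st_succ] at this
    have ga : ((st q).setR 10 q).arr = (st q).arr := setR_arr _ (by simp) _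
    refine ⟨?_, ?_, ?_, this.addr, this.size⟩
    · rw [← ga]; exact this.fit
    · rw [← ga]; exact this.next
    · rw [← ga]; exact this.out
  refine ⟨fun j => Nat.clog 2 (D' j), m, fun p j => pieceFun e (m j) (m (j + 1))
    (pieceCo (st p) d j (Nat.clog 2 (D' j))) (2 ^ (Nat.clog 2 (D' j) + 1)),
    fun p j u => pieceFun e (m j) (m (j + 1)) (fun c => iterCo k d (Nat.clog 2 (D' j)) (m j)
      (m (j + 1)) ((st p).arr 3 j) ((st (p + 1)).arr 5 j) c u) (2 ^ (Nat.clog 2 (D' j) + 1) + k + 1),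
    fun j => congrArg (Nat.clog 2) (hDj j), hmj, fun j t => ?_, fun p _ => ?_, fun j => ?_⟩
  · refine Finset.sum_eq_zero fun c _ => ?_
    rw [chebP, Finset.sum_eq_zero, zero_smul]
    intro l _
    have : (st 0).arr 3 j (l * d + c) = 0 := by
      rw [State.arr, st0, hre]
      refine hbig _ ?_
      have := lay.r5
      omega
    rw [pieceCo, this, ite_self, zero_mul]
  · exact picardStep_of_pieceDone e F v m (fun j => Nat.clog 2 (D' j)) hmj' (st p) (st (p + 1))
      (st_start p) (st_piece p)
  · have e1 : solver.exec O s0 = (st (N + 2)).setR 0 n := by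
      have : solver.exec O s0 = (Prog.setReg 0 (.reg 2)).exec O
        ((Prog.loop 10 (.reg 3 + 2) passProg).exec O s1) := rfl
      rw [this, hloop, exec_setReg, IExp.val_reg, (st_lay _).r2]
    rw [e1]
    have h1 := hmj (Fin.castSucc j)
    have h2 := hmj (Fin.succ j)
    simp only [Fin.val_castSucc, Fin.val_succ] at h1 h2
    rw [← h1, ← h2]
    -- The output is the k-fold antiderivative formed in the last pass, which still belongs to the
    -- coefficients from the pass before.
    exact outputPiece_of_pieceDone e F (st (N + 1)) (st (N + 2)) _ (st_piece (N + 1) j j.2)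
      (by simp [setR_regs]) rfl rfl

end RealRAM


/-! ### Error analysis -/

namespace RealRAM

variable {E : Type*} [NormedAddCommGroup E] [NormedSpace ℝ E]

/-- A mean value inequality that needs the bound in the interior only. -/
theorem norm_sub_left_le_of_norm_deriv_Ioo {f f' : ℝ → E} {a b C : ℝ}
    (hf : ∀ x ∈ Icc a b, HasDerivWithinAt f (f' x) (Icc a b) x)
    (hC : ∀ x ∈ Ioo a b, ‖f' x‖ ≤ C) {t : ℝ} (ht : t ∈ Icc a b) :
    ‖f t - f a‖ ≤ C * (t - a) := by
  rcases ht.1.eq_or_lt with rfl | hat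
  · simp
  have hcont : ContinuousWithinAt f (Ioo a t) a :=
    (hf a ⟨le_rfl, ht.1.trans ht.2⟩).continuousWithinAt.mono
      fun x hx => ⟨hx.1.le, hx.2.le.trans ht.2⟩
  refine ContinuousWithinAt.closure_le (s := Ioo a t) (f := fun s => ‖f t - f s‖)
    (g := fun s => C * (t - s)) ?_ ?_ ?_ ?_
  · rw [closure_Ioo hat.ne]; exact ⟨le_rfl, hat.le⟩
  · exact (continuousWithinAt_const.sub hcont).norm
  · exact (continuous_const.mul (continuous_const.sub continuous_id)).continuousWithinAt
  · intro s hs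
    have hsub : Icc s t ⊆ Icc a b := Icc_subset_Icc hs.1.le ht.2
    exact norm_image_sub_le_of_norm_deriv_le_segment'
      (fun x hx => (hf x (hsub hx)).mono hsub)
      (fun x hx => hC x ⟨hs.1.trans_le hx.1, hx.2.trans_le ht.2⟩) t ⟨hs.2.le, le_rfl⟩

theorem le_of_steps {τ : ℕ → ℝ} {n : ℕ} (hτ : ∀ j < n, τ j < τ (j + 1)) {i j : ℕ} (hij : i ≤ j)
    (hj : j ≤ n) : τ i ≤ τ j := by
  induction j, hij using Nat.le_induction with
  | base => exact le_rfl
  | succ j hij ih => exact (ih (by omega)).trans (hτ j (by omega)).le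

/-- `g i` is the `i`-th derivative of a function on `[0, T]`, for `i ≤ k`. -/
def DerivChain (k : ℕ) (T : ℝ) (g : ℕ → ℝ → E) : Prop :=
  ∀ i < k, ∀ t ∈ Icc 0 T, HasDerivWithinAt (g i) (g (i + 1) t) (Icc 0 T) t

/-! ### Propagation of errors through one Picard step -/

section

variable {k n : ℕ} {F : (Fin k → E) → ℝ → E} {v : Fin k → E} {τ : ℕ → ℝ} {h : ℕ → ℕ}
  {y y' : ℕ → ℝ → E} {X : ℕ → ℕ → ℝ → E} {T : ℝ} {g : ℕ → ℝ → E}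

/-- On a piece the error grows by at most B (t - τ_j), by the mean value inequality; gluing hands
over the error at most B τ_j from the left, and at 0 it vanishes. The bound B is needed on open
pieces only, as the approximation hypothesis says nothing at breakpoints. -/
theorem PicardStep.close_succ (P : PicardStep F v n τ h y y' X) (hτ : ∀ j < n, τ j < τ (j + 1))
    (h0 : τ 0 = 0) (hT : τ n = T) (hg : DerivChain k T g) (hv : ∀ i : Fin k, g i 0 = v i)
    {u : ℕ} (hu : u < k) {B : ℝ}
    (hB : ∀ j < n, ∀ t ∈ Ioo (τ j) (τ (j + 1)), ‖X j u t - g (k - u) t‖ ≤ B) :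
    ∀ j < n, ∀ t ∈ Icc (τ j) (τ (j + 1)), ‖X j (u + 1) t - g (k - (u + 1)) t‖ ≤ B * t := by
  have step : ∀ j < n, ‖X j (u + 1) (τ j) - g (k - (u + 1)) (τ j)‖ ≤ B * τ j →
      ∀ t ∈ Icc (τ j) (τ (j + 1)), ‖X j (u + 1) t - g (k - (u + 1)) t‖ ≤ B * t := by
    intro j hj hl t ht
    have hsub : Icc (τ j) (τ (j + 1)) ⊆ Icc 0 T := by
      rw [← h0, ← hT]
      exact Icc_subset_Icc (le_of_steps hτ (Nat.zero_le _) hj.le) (le_of_steps hτ hj le_rfl)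
    have hd := norm_sub_left_le_of_norm_deriv_Ioo
      (f := fun t => X j (u + 1) t - g (k - (u + 1)) t) (f' := fun t => X j u t - g (k - u) t)
      (fun x hx => by
        have := (hg (k - (u + 1)) (by omega) x (hsub hx)).mono hsub
        rw [show k - (u + 1) + 1 = k - u by omega] at this
        exact (P.deriv j hj u hu x).hasDerivWithinAt.sub this) (hB j hj) ht
    calc ‖X j (u + 1) t - g (k - (u + 1)) t‖ = ‖(X j (u + 1) t - g (k - (u + 1)) t
          - (X j (u + 1) (τ j) - g (k - (u + 1)) (τ j)))
          + (X j (u + 1) (τ j) - g (k - (u + 1)) (τ j))‖ := by rw [sub_add_cancel]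
      _ ≤ B * (t - τ j) + B * τ j := (norm_add_le _ _).trans (add_le_add hd hl)
      _ = B * t := by ring
  intro j
  induction j with
  | zero =>
    intro hj
    refine step 0 hj ?_
    have h1 := P.start hj ⟨k - (u + 1), by omega⟩
    have h2 := hv ⟨k - (u + 1), by omega⟩
    simp only [show k - (k - (u + 1)) = u + 1 by omega] at h1 h2
    rw [h1, h0, h2]
    simp
  | succ j ih =>
    intro hj
    refine step (j + 1) hj ?_
    rw [P.glue j hj u hu]
    exact ih (by omega) _ ⟨(hτ j (by omega)).le, le_rfl⟩

theorem PicardStep.close_all (P : PicardStep F v n τ h y y' X) (hτ : ∀ j < n, τ j < τ (j + 1))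
    (h0 : τ 0 = 0) (hT : τ n = T) (hg : DerivChain k T g) (hv : ∀ i : Fin k, g i 0 = v i)
    {δ : ℝ} (hδ : 0 ≤ δ) (hT0 : 0 ≤ T)
    (h1 : ∀ j < n, ∀ t ∈ Icc (τ j) (τ (j + 1)), ‖X j 1 t - g (k - 1) t‖ ≤ T * δ) :
    ∀ u < k, ∀ j < n, ∀ t ∈ Icc (τ j) (τ (j + 1)),
      ‖X j (u + 1) t - g (k - (u + 1)) t‖ ≤ T ^ (u + 1) * δ := by
  intro u
  induction u with
  | zero => intro _ j hj t ht; simpa using h1 j hj t ht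
  | succ u ih =>
    intro hu j hj t ht
    refine (P.close_succ hτ h0 hT hg hv hu
      (fun j hj t ht => ih (by omega) j hj t (Ioo_subset_Icc_self ht)) j hj t ht).trans ?_
    have : t ≤ T := by rw [← hT]; exact ht.2.trans (le_of_steps hτ hj le_rfl)
    calc T ^ (u + 1) * δ * t ≤ T ^ (u + 1) * δ * T := by gcongr
      _ = T ^ (u + 1 + 1) * δ := by ring

theorem nodeAt_mem {α β : ℝ} (hαβ : α < β) (h r : ℕ) : nodeAt α β h r ∈ Ioo α β := by
  obtain ⟨h1, h2⟩ := cc_mem (2 ^ (h + 1) + r)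
  rw [nodeAt]
  constructor <;> nlinarith

/-- The filter leaves the approximating polynomial Q fixed, so only F - Q at the nodes passes
through it. That difference is at most δ/16000 + ε, the kernel multiplies it by at most 3, and Q
itself is within ε of the k-th derivative. -/
theorem PicardStep.fit_close (P : PicardStep F v n τ h y y' X) (hτ : ∀ j < n, τ j < τ (j + 1))
    (h0 : τ 0 = 0) (hT : τ n = T) {L : Fin k → ℝ} (hL : ∀ i, 0 ≤ L i)
    (ode : ∀ t ∈ Icc 0 T, g k t = F (fun i => g i t) t)
    (lip : ∀ t ∈ Icc 0 T, ∀ y z : Fin k → E, ‖F y t - F z t‖ ≤ ∑ i, L i * ‖y i - z i‖)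
    (hsum : ∑ i : Fin k, L i * T ^ (k - i) ≤ 1 / 16000) {ε δ : ℝ} (hδ : 0 ≤ δ)
    (poly : ∀ j < n, ∃ q : ℕ → E, ∃ D ≤ 2 ^ h j, ∀ t ∈ Ioo (τ j) (τ (j + 1)),
      ‖∑ l ∈ Finset.range (D + 1), t ^ l • q l - g k t‖ ≤ ε)
    (hX : ∀ u < k, ∀ j < n, ∀ t ∈ Icc (τ j) (τ (j + 1)),
      ‖X j (u + 1) t - g (k - (u + 1)) t‖ ≤ T ^ (u + 1) * δ) :
    ∀ j < n, ∀ t ∈ Ioo (τ j) (τ (j + 1)), ‖y' j t - g k t‖ ≤ 3 / 16000 * δ + 4 * ε := by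
  intro j hj t ht
  have hαβ := hτ j hj
  set α := τ j
  set β := τ (j + 1)
  obtain ⟨q, D, hD, hq⟩ := poly j hj
  have hsub : Icc α β ⊆ Icc 0 T := by
    rw [← h0, ← hT]
    exact Icc_subset_Icc (le_of_steps hτ (Nat.zero_le _) hj.le) (le_of_steps hτ hj le_rfl)
  set x := (2 * t - α - β) / (β - α) with hx
  have hne : β - α ≠ 0 := by linarith
  have hpos : 0 < β - α := by linarith
  have hxmem : x ∈ Icc (-1 : ℝ) 1 := by
    rw [hx]
    constructor
    · rw [le_div_iff₀ hpos]; linarith [ht.1]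
    · rw [div_le_iff₀ hpos]; linarith [ht.2]
  set κ : ℕ → ℝ := fun r =>
    nodeKernel (h j + 1) (vpW (2 ^ h j)) x (cc (2 ^ (h j + 1) + r)) with hκ
  set t' : ℕ → ℝ := fun r => nodeAt α β (h j) r with ht'
  set Q : ℝ → E := fun t => ∑ l ∈ Finset.range (D + 1), t ^ l • q l with hQ
  have hexact : ∑ r ∈ Finset.range (2 ^ (h j + 1)), κ r • Q (t' r) = Q t := by
    simp only [hQ, Finset.smul_sum]
    rw [Finset.sum_comm]
    refine Finset.sum_congr rfl fun l hl => ?_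
    have hl' : l ≤ 2 ^ h j := by have := Finset.mem_range.1 hl; omega
    have := vp_exact (h j) (α + (β - α) / 2) ((β - α) / 2) hl' x
    have e1 : α + (β - α) / 2 + (β - α) / 2 * x = t := by rw [hx]; field_simp; ring
    rw [e1] at this
    rw [← this, Finset.sum_smul]
    refine Finset.sum_congr rfl fun r _ => ?_
    rw [smul_smul, ht']
    simp only [nodeAt, hκ]
    congr 3
    ring
  have hnode : ∀ r, ‖F (fun i => X j (k - i) (t' r)) (t' r) - Q (t' r)‖ ≤ δ / 16000 + ε := by
    intro r
    have hm := nodeAt_mem hαβ (h j) r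
    have hm' := hsub (Ioo_subset_Icc_self hm)
    have h1 : ‖F (fun i => X j (k - i) (t' r)) (t' r) - g k (t' r)‖ ≤ δ / 16000 := by
      rw [ode _ hm']
      refine (lip _ hm' _ _).trans ?_
      calc ∑ i : Fin k, L i * ‖X j (k - i) (t' r) - g i (t' r)‖
          ≤ ∑ i : Fin k, L i * T ^ (k - (i : ℕ)) * δ := by
            refine Finset.sum_le_sum fun i _ => ?_
            rw [mul_assoc]
            refine mul_le_mul_of_nonneg_left ?_ (hL i)
            have hi := i.2
            have := hX (k - (i + 1)) (by omega) j hj (t' r) (Ioo_subset_Icc_self hm)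
            rwa [show k - ((i : ℕ) + 1) + 1 = k - i by omega,
              show k - (k - (i : ℕ)) = i by omega] at this
        _ = (∑ i : Fin k, L i * T ^ (k - (i : ℕ))) * δ := by rw [Finset.sum_mul]
        _ ≤ 1 / 16000 * δ := by gcongr
        _ = δ / 16000 := by ring
    have h2 := hq (t' r) hm
    rw [norm_sub_rev] at h2
    calc _ = ‖(F (fun i => X j (k - i) (t' r)) (t' r) - g k (t' r)) + (g k (t' r) - Q (t' r))‖ := by
          rw [sub_add_sub_cancel]
      _ ≤ _ := (norm_add_le _ _).trans (add_le_add h1 h2)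
  have hε : 0 ≤ δ / 16000 + ε := (norm_nonneg _).trans (hnode 0)
  have hfit : y' j t - g k t = ∑ r ∈ Finset.range (2 ^ (h j + 1)),
      κ r • (F (fun i => X j (k - i) (t' r)) (t' r) - Q (t' r)) + (Q t - g k t) := by
    simp only [smul_sub, Finset.sum_sub_distrib, hexact]
    rw [P.fit j hj t]
    abel
  rw [hfit]
  calc _ ≤ ∑ r ∈ Finset.range (2 ^ (h j + 1)), |κ r| * (δ / 16000 + ε) + ε := by
        refine (norm_add_le _ _).trans (add_le_add ((norm_sum_le _ _).trans ?_) (hq t ht))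
        refine Finset.sum_le_sum fun r _ => ?_
        rw [norm_smul, Real.norm_eq_abs]
        exact mul_le_mul_of_nonneg_left (hnode r) (abs_nonneg _)
    _ = (∑ r ∈ Finset.range (2 ^ (h j + 1)), |κ r|) * (δ / 16000 + ε) + ε := by
        rw [Finset.sum_mul]
    _ ≤ 3 * (δ / 16000 + ε) + ε := by
        gcongr
        exact vp_abs_sum (h j) hxmem
    _ = _ := by ring

/-- The first antiderivative of 0 is constant on every piece, and gluing makes it one constant. The
error of pass 0 is thus the variation of the (k-1)-st derivative, the quantity bounded by
`lintegral_deriv_le`. -/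
theorem PicardStep.const_of_zero (P : PicardStep F v n τ h y y' X) (hk : 1 ≤ k) (hn : 0 < n)
    (hy : ∀ j t, y j t = 0) : ∀ j < n, ∀ t, X j 1 t = v ⟨k - 1, by omega⟩ := by
  have hc : ∀ j < n, ∀ s t, X j 1 s = X j 1 t := by
    intro j hj s t
    have hd := P.deriv j hj 0 (by omega)
    refine is_const_of_deriv_eq_zero (fun x => (hd x).differentiableAt) (fun x => ?_) s t
    rw [(hd x).deriv, P.zero j hj, hy]
  intro j
  induction j with
  | zero =>
    intro hj t
    have := P.start hn ⟨k - 1, by omega⟩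
    simp only [show k - (k - 1) = 1 by omega] at this
    rw [hc 0 hj t (τ 0), this]
  | succ j ih =>
    intro hj t
    rw [hc (j + 1) hj t (τ (j + 1)), P.glue j hj 0 (by omega), ih (by omega)]

end

/-- The a priori bound for the solution. -/
theorem lintegral_deriv_le [CompleteSpace E] {k : ℕ} (hk : 1 ≤ k) {F : (Fin k → E) → ℝ → E}
    {v : Fin k → E} {T : ℝ} (hT : 0 < T) {g : ℕ → ℝ → E} (hg : DerivChain k T g)
    (hv : ∀ i : Fin k, g i 0 = v i) {L : Fin k → ℝ} (hL : ∀ i, 0 ≤ L i)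
    (ode : ∀ t ∈ Icc 0 T, g k t = F (fun i => g i t) t)
    (lip : ∀ t ∈ Icc 0 T, ∀ y z : Fin k → E, ‖F y t - F z t‖ ≤ ∑ i, L i * ‖y i - z i‖)
    (hsum : ∑ i : Fin k, L i * T ^ (k - i) ≤ 1 / 16000) {C : ℝ} (hC0 : 0 ≤ C)
    (hC : ENNReal.ofReal (T ^ (k - 1)) * (∫⁻ s in Icc 0 T, ‖F v s‖ₑ)
        + ENNReal.ofReal (∑ i : Fin k, if (i : ℕ) = 0 then 0 else T ^ (i : ℕ) * ‖v i‖)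
        ≤ ENNReal.ofReal C) :
    ∃ A : ℝ, 0 ≤ A ∧ T ^ (k - 1) * A ≤ 2 * C ∧
      ∀ t ∈ Icc 0 T, ‖g (k - 1) t - g (k - 1) 0‖ ≤ A := by
  set σ := ∑ i : Fin k, if (i : ℕ) = 0 then 0 else T ^ (i : ℕ) * ‖v i‖ with hσ
  have hσ0 : 0 ≤ σ := Finset.sum_nonneg fun i _ => by split_ifs <;> positivity
  set c0 := ∫⁻ s in Icc 0 T, ‖F v s‖ₑ with hc0
  have hTk : 0 < T ^ (k - 1) := by positivity
  have hfin : c0 ≠ ⊤ := by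
    intro htop
    rw [htop, ENNReal.mul_top (by simpa using hTk), top_add, top_le_iff] at hC
    exact ENNReal.ofReal_ne_top hC
  have hCr : T ^ (k - 1) * c0.toReal + σ ≤ C := by
    rw [← ENNReal.ofReal_le_ofReal_iff hC0, ENNReal.ofReal_add (by positivity) hσ0,
      ENNReal.ofReal_mul hTk.le, ENNReal.ofReal_toReal hfin]
    exact hC
  set I := Icc (0 : ℝ) T with hI
  have hgc : ∀ i < k, ContinuousOn (g i) I := fun i hi t ht => (hg i hi t ht).continuousWithinAt
  have h0I : (0 : ℝ) ∈ I := ⟨le_rfl, hT.le⟩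
  set φ : ℝ → ℝ := fun s => ∑ i : Fin k, T ^ (i : ℕ) * ‖g i s - v i‖ with hφ
  have hφc : ContinuousOn φ I := by
    refine continuousOn_finsetSum _ fun i _ => ?_
    exact continuousOn_const.mul ((hgc i i.2).sub continuousOn_const).norm
  obtain ⟨Mb, hMb⟩ := isCompact_Icc.bddAbove_image hφc
  -- Weighting order i by T^i makes all orders comparable. The supremum U is bounded in terms of
  -- itself with the small factor 1/16000, in place of a Grönwall argument.
  set Sset : Set ℝ := {r | ∃ i : Fin k, ∃ s ∈ I, r = T ^ (i : ℕ) * ‖g i s - v i‖} with hSset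
  have hbdd : BddAbove Sset := by
    refine ⟨Mb, ?_⟩
    rintro r ⟨i, s, hs, rfl⟩
    refine le_trans ?_ (hMb (mem_image_of_mem φ hs))
    exact Finset.single_le_sum (f := fun i : Fin k => T ^ (i : ℕ) * ‖g i s - v i‖)
      (fun i _ => by positivity) (Finset.mem_univ i)
  set U := sSup Sset with hU
  have hUle : ∀ i : Fin k, ∀ s ∈ I, T ^ (i : ℕ) * ‖g i s - v i‖ ≤ U := fun i s hs =>
    le_csSup hbdd ⟨i, s, hs, rfl⟩
  have hne : Sset.Nonempty := ⟨_, ⟨0, by omega⟩, 0, h0I, rfl⟩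
  have hU0 : 0 ≤ U := le_trans (by positivity) (hUle ⟨0, by omega⟩ 0 h0I)
  set κ := ∑ i : Fin k, L i / T ^ (i : ℕ) with hκ
  have hκ0 : 0 ≤ κ := Finset.sum_nonneg fun i _ => div_nonneg (hL i) (by positivity)
  have hκT : T ^ (k - 1) * (κ * T) ≤ 1 / 16000 := by
    refine le_trans (le_of_eq ?_) hsum
    rw [hκ, Finset.sum_mul, Finset.mul_sum]
    refine Finset.sum_congr rfl fun i _ => ?_
    have hi := i.2
    have : T ^ (k - 1) * T = T ^ (k - (i : ℕ)) * T ^ (i : ℕ) := by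
      rw [← pow_succ, ← pow_add]; congr 1; omega
    field_simp
    linear_combination L i * this
  have hbound : ∀ s ∈ I, ‖g k s‖ ≤ ‖F v s‖ + κ * U := by
    intro s hs
    have h1 : ‖F (fun i => g i s) s - F v s‖ ≤ κ * U := by
      refine (lip s hs _ _).trans ?_
      rw [hκ, Finset.sum_mul]
      refine Finset.sum_le_sum fun i _ => ?_
      rw [div_mul_eq_mul_div, mul_div_assoc]
      refine mul_le_mul_of_nonneg_left ?_ (hL i)
      rw [le_div_iff₀ (by positivity), mul_comm]
      exact hUle i s hs
    rw [ode s hs]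
    calc _ = ‖F v s + (F (fun i => g i s) s - F v s)‖ := by rw [add_sub_cancel]
      _ ≤ _ := (norm_add_le _ _).trans (add_le_add le_rfl h1)
  -- The lower integral is additive when one summand is measurable, here the constant; so F need not
  -- be measurable.
  have hlint : ∫⁻ s in I, ‖g k s‖ₑ ≤ c0 + ENNReal.ofReal (κ * U * T) := by
    calc ∫⁻ s in I, ‖g k s‖ₑ ≤ ∫⁻ s in I, (‖F v s‖ₑ + ENNReal.ofReal (κ * U)) := by
          refine setLIntegral_mono' measurableSet_Icc fun s hs => ?_
          rw [← ofReal_norm, ← ofReal_norm, ← ENNReal.ofReal_add (norm_nonneg _)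
            (by positivity)]
          exact ENNReal.ofReal_le_ofReal (hbound s hs)
      _ = _ := by
          rw [MeasureTheory.lintegral_add_right _ measurable_const, setLIntegral_const, hI,
            Real.volume_Icc, sub_zero, ← ENNReal.ofReal_mul (by positivity)]
  set A0 := ∫⁻ s in I, ‖g k s‖ₑ with hA0
  have hA0fin : A0 ≠ ⊤ := ne_top_of_le_ne_top (by simp [hfin]) hlint
  have hAle : A0.toReal ≤ c0.toReal + κ * U * T := by
    have := ENNReal.toReal_mono (by simp [hfin]) hlint
    rwa [ENNReal.toReal_add hfin (by simp), ENNReal.toReal_ofReal (by positivity)] at this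
  have hA0nn : 0 ≤ A0.toReal := ENNReal.toReal_nonneg
  have hk1 : k - 1 + 1 = k := by omega
  have hgk : ∀ t ∈ Ioo 0 T, HasDerivAt (g (k - 1)) (g k t) t := by
    intro t ht
    have := hg (k - 1) (by omega) t (Ioo_subset_Icc_self ht)
    rw [hk1] at this
    exact this.hasDerivAt (Icc_mem_nhds ht.1 ht.2)
  -- Measurability comes from the left side of the equation: inside the interval this function is a
  -- derivative.
  have hmeas : AEStronglyMeasurable (g k) (volume.restrict I) := by
    rw [hI, ← restrict_Ioo_eq_restrict_Icc]
    refine (aestronglyMeasurable_deriv (g (k - 1)) _).congr ?_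
    filter_upwards [ae_restrict_mem measurableSet_Ioo] with t ht
    exact (hgk t ht).deriv
  have hint : IntegrableOn (g k) I := ⟨hmeas, hA0fin.lt_top⟩
  have hA : ∀ t ∈ I, ‖g (k - 1) t - g (k - 1) 0‖ ≤ A0.toReal := by
    intro t ht
    have hsub : Ioc 0 t ⊆ I := fun x hx => ⟨hx.1.le, hx.2.trans ht.2⟩
    have hii : IntervalIntegrable (g k) volume 0 t := by
      rw [intervalIntegrable_iff_integrableOn_Ioc_of_le ht.1]
      exact hint.mono_set hsub
    rw [← intervalIntegral.integral_eq_sub_of_hasDerivAt_of_le ht.1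
      ((hgc (k - 1) (by omega)).mono (Icc_subset_Icc le_rfl ht.2))
      (fun x hx => hgk x ⟨hx.1, hx.2.trans_le ht.2⟩) hii,
      intervalIntegral.integral_of_le ht.1]
    refine (norm_integral_le_integral_norm _).trans ?_
    refine (setIntegral_mono_set hint.norm (ae_of_all _ fun _ => norm_nonneg _)
      (Filter.Eventually.of_forall hsub)).trans ?_
    rw [integral_norm_eq_lintegral_enorm hmeas]
  -- Descending from order k - 1 to 0, each integration adds the initial value of the order just
  -- left.
  have hstep : ∀ m < k, ∀ s ∈ I, T ^ (k - 1 - m) * ‖g (k - 1 - m) s - g (k - 1 - m) 0‖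
      ≤ T ^ (k - 1) * A0.toReal + ∑ l ∈ Finset.Ico (k - 1 - m + 1) k, T ^ l * ‖g l 0‖ := by
    intro m
    induction m with
    | zero =>
      intro _ s hs
      rw [Nat.sub_zero, hk1, Finset.Ico_self, Finset.sum_empty, add_zero]
      exact mul_le_mul_of_nonneg_left (hA s hs) hTk.le
    | succ m ih =>
      intro hm s hs
      set i := k - 1 - (m + 1) with hi
      have hi1 : k - 1 - m = i + 1 := by omega
      have ih' := ih (by omega)
      rw [hi1] at ih'
      set W := T ^ (k - 1) * A0.toReal + ∑ l ∈ Finset.Ico (i + 1 + 1) k, T ^ l * ‖g l 0‖ with hW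
      rw [Finset.sum_eq_sum_Ico_succ_bot (by omega)]
      have hb : ∀ x ∈ Ioo 0 T, ‖g (i + 1) x‖ ≤ ‖g (i + 1) 0‖ + W / T ^ (i + 1) := by
        intro x hx
        have h1 : ‖g (i + 1) x - g (i + 1) 0‖ ≤ W / T ^ (i + 1) := by
          rw [le_div_iff₀ (by positivity), mul_comm]
          exact ih' x (Ioo_subset_Icc_self hx)
        calc _ = ‖g (i + 1) 0 + (g (i + 1) x - g (i + 1) 0)‖ := by rw [add_sub_cancel]
          _ ≤ _ := (norm_add_le _ _).trans (add_le_add le_rfl h1)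
      have hd := norm_sub_left_le_of_norm_deriv_Ioo (hg i (by omega)) hb hs
      have hW0 : 0 ≤ W := by
        refine add_nonneg (by positivity) (Finset.sum_nonneg fun l _ => by positivity)
      calc T ^ i * ‖g i s - g i 0‖
          ≤ T ^ i * ((‖g (i + 1) 0‖ + W / T ^ (i + 1)) * T) := by
            refine mul_le_mul_of_nonneg_left (hd.trans ?_) (by positivity)
            refine mul_le_mul_of_nonneg_left (by linarith [hs.2]) (by positivity)
        _ = T ^ (k - 1) * A0.toReal + (T ^ (i + 1) * ‖g (i + 1) 0‖
            + ∑ l ∈ Finset.Ico (i + 1 + 1) k, T ^ l * ‖g l 0‖) := by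
            have : T ^ i * (W / T ^ (i + 1) * T) = W := by rw [pow_succ]; field_simp
            rw [add_mul, mul_add, this, hW]
            ring
  have hUfin : U ≤ T ^ (k - 1) * A0.toReal + σ := by
    refine csSup_le hne ?_
    rintro r ⟨i, s, hs, rfl⟩
    have hi := i.2
    have := hstep (k - 1 - i) (by omega) s hs
    rw [show k - 1 - (k - 1 - (i : ℕ)) = i by omega] at this
    rw [← hv i]
    refine this.trans (add_le_add le_rfl ?_)
    have hσ' : σ = ∑ l ∈ Finset.range k, if l = 0 then 0 else T ^ l * ‖g l 0‖ := by
      rw [Finset.sum_range]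
      refine Finset.sum_congr rfl fun i _ => ?_
      rw [hv]
    rw [hσ', Finset.sum_congr rfl (g := fun l => if l = 0 then 0 else T ^ l * ‖g l 0‖)
      (fun l hl => by rw [if_neg (by have := (Finset.mem_Ico.1 hl).1; omega)])]
    refine Finset.sum_le_sum_of_subset_of_nonneg (fun l hl => ?_)
      (fun l _ _ => by split_ifs <;> positivity)
    exact Finset.mem_range.2 (Finset.mem_Ico.1 hl).2
  refine ⟨A0.toReal, hA0nn, ?_, hA⟩
  -- Together with `hUfin` the term with U is absorbed on the left; the exact factor would be
  -- 16000/15999, and 2 is enough.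
  have h1 : T ^ (k - 1) * A0.toReal ≤ T ^ (k - 1) * c0.toReal + U / 16000 := by
    calc T ^ (k - 1) * A0.toReal ≤ T ^ (k - 1) * (c0.toReal + κ * U * T) := by gcongr
      _ = T ^ (k - 1) * c0.toReal + (T ^ (k - 1) * (κ * T)) * U := by ring
      _ ≤ T ^ (k - 1) * c0.toReal + 1 / 16000 * U := by gcongr
      _ = _ := by ring
  linarith

/-- Every L_i^(1/(k-i)) T is at most 1, so raising it to the power k - i does not increase it. -/
theorem sum_mul_pow_le {k : ℕ} {L : Fin k → ℝ} (hL : ∀ i, 0 ≤ L i) {T : ℝ} (hT : 0 < T)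
    (h : (∑ i : Fin k, L i ^ ((1 : ℝ) / ((k : ℝ) - (i : ℕ)))) * T ≤ 1 / 16000) :
    ∑ i : Fin k, L i * T ^ (k - i) ≤ 1 / 16000 := by
  refine le_trans ?_ h
  rw [Finset.sum_mul] at h ⊢
  have hnn : ∀ i : Fin k, 0 ≤ L i ^ ((1 : ℝ) / ((k : ℝ) - (i : ℕ))) * T := fun i =>
    mul_nonneg (Real.rpow_nonneg (hL i) _) hT.le
  refine Finset.sum_le_sum fun i hi => ?_
  have h1 : L i ^ ((1 : ℝ) / ((k : ℝ) - (i : ℕ))) * T ≤ 1 :=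
    ((Finset.single_le_sum (fun i _ => hnn i) hi).trans h).trans (by norm_num)
  have hki : k - (i : ℕ) ≠ 0 := by have := i.2; omega
  have h2 : (L i ^ ((1 : ℝ) / ((k : ℝ) - (i : ℕ))) * T) ^ (k - (i : ℕ)) = L i * T ^ (k - (i : ℕ)) := by
    rw [mul_pow, ← Nat.cast_sub i.2.le, one_div, Real.rpow_inv_natCast_pow (hL i) hki]
  rw [← h2]
  exact pow_le_of_le_one (hnn i) h1 hki

/-- The accuracy of the iteration. -/
theorem picard_close [CompleteSpace E] {k n N : ℕ} (hk : 1 ≤ k) (hn : 1 ≤ n)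
    {F : (Fin k → E) → ℝ → E} {v : Fin k → E} {τ : ℕ → ℝ} {h : ℕ → ℕ} {y : ℕ → ℕ → ℝ → E}
    {X : ℕ → ℕ → ℕ → ℝ → E} (hy : ∀ j t, y 0 j t = 0)
    (P : ∀ p < N + 2, PicardStep F v n τ h (y p) (y (p + 1)) (X p))
    (hτ : ∀ j < n, τ j < τ (j + 1)) (h0 : τ 0 = 0) {T : ℝ} (hT : τ n = T) {g : ℕ → ℝ → E}
    (hg : DerivChain k T g) (hv : ∀ i : Fin k, g i 0 = v i) {L : Fin k → ℝ} (hL : ∀ i, 0 ≤ L i)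
    (ode : ∀ t ∈ Icc 0 T, g k t = F (fun i => g i t) t)
    (lip : ∀ t ∈ Icc 0 T, ∀ y z : Fin k → E, ‖F y t - F z t‖ ≤ ∑ i, L i * ‖y i - z i‖)
    (hsum : (∑ i : Fin k, L i ^ ((1 : ℝ) / ((k : ℝ) - (i : ℕ)))) * T ≤ 1 / 16000) {ε : ℝ}
    (hε : 0 < ε)
    (poly : ∀ j < n, ∃ q : ℕ → E, ∃ D ≤ 2 ^ h j, ∀ t ∈ Ioo (τ j) (τ (j + 1)),
      ‖∑ l ∈ Finset.range (D + 1), t ^ l • q l - g k t‖ ≤ ε / T ^ k)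
    (hC : ENNReal.ofReal (T ^ (k - 1)) * (∫⁻ s in Icc 0 T, ‖F v s‖ₑ)
        + ENNReal.ofReal (∑ i : Fin k, if (i : ℕ) = 0 then 0 else T ^ (i : ℕ) * ‖v i‖)
        ≤ ENNReal.ofReal (2 ^ N * ε)) :
    ∀ i < k, ∀ j < n, ∀ t ∈ Icc (τ j) (τ (j + 1)),
      ‖X (N + 1) j (k - i) t - g i t‖ ≤ 6 * (ε / T ^ i) := by
  have hT0 : 0 < T := by
    rw [← hT, ← h0]
    exact (hτ 0 hn).trans_le (le_of_steps hτ hn le_rfl)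
  have hsum' := sum_mul_pow_le hL hT0 hsum
  obtain ⟨A, hA0, hA1, hA2⟩ := lintegral_deriv_le hk hT0 hg hv hL ode lip hsum'
    (by positivity) hC
  have hTk : T ^ k = T ^ (k - 1) * T := by rw [← pow_succ]; congr 1; omega
  set η := ε / T ^ k with hη
  have hη0 : 0 < η := by positivity
  -- In units of η the error of pass p is a power of two that halves, plus the floor 5; at p = N + 1
  -- this is 1 + 5, the constant 6 of the conclusion.
  have key : ∀ p ≤ N + 1, ∀ u < k, ∀ j < n, ∀ t ∈ Icc (τ j) (τ (j + 1)),
      ‖X p j (u + 1) t - g (k - (u + 1)) t‖ ≤ T ^ (u + 1) * ((2 ^ (N + 1 - p) + 5) * η) := by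
    intro p
    induction p with
    | zero =>
      intro _
      refine (P 0 (by omega)).close_all hτ h0 hT hg hv (by positivity) hT0.le ?_
      intro j hj t ht
      have htI : t ∈ Icc 0 T := by
        rw [← h0, ← hT]
        exact ⟨(le_of_steps hτ (Nat.zero_le _) hj.le).trans ht.1,
          ht.2.trans (le_of_steps hτ hj le_rfl)⟩
      rw [(P 0 (by omega)).const_of_zero hk hn hy j hj t, ← hv, norm_sub_rev]
      refine (hA2 t htI).trans ?_
      have e1 : A ≤ T * (2 ^ (N + 1) * η) := by
        rw [hη, hTk, pow_succ]
        have : T * (2 ^ N * 2 * (ε / (T ^ (k - 1) * T))) = 2 * (2 ^ N * ε) / T ^ (k - 1) := by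
          field_simp
        rw [this, le_div_iff₀ (by positivity), mul_comm]
        exact hA1
      refine e1.trans ?_
      rw [Nat.sub_zero]
      gcongr
      linarith
    | succ p ih =>
      intro hp
      have hX := ih (by omega)
      have hy' := (P p (by omega)).fit_close hτ h0 hT hL ode lip hsum' (by positivity) poly hX
      refine (P (p + 1) (by omega)).close_all hτ h0 hT hg hv (by positivity) hT0.le ?_
      intro j hj t ht
      have := (P (p + 1) (by omega)).close_succ hτ h0 hT hg hv (u := 0) (by omega)
        (fun j hj t ht => by rw [(P (p + 1) (by omega)).zero j hj]; exact hy' j hj t ht) j hj t ht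
      refine this.trans ?_
      have htT : t ≤ T := by rw [← hT]; exact ht.2.trans (le_of_steps hτ hj le_rfl)
      rw [mul_comm T]
      have e1 : N + 1 - p = N + 1 - (p + 1) + 1 := by omega
      rw [e1, pow_succ]
      set a : ℝ := 2 ^ (N + 1 - (p + 1)) with ha
      have ha0 : 0 < a := by positivity
      -- The contraction 3/16000 is far stronger than halving; the floor 5 only has to exceed 4 +
      -- 15/16000.
      have e2 : 3 / 16000 * ((a * 2 + 5) * η) + 4 * η ≤ (a + 5) * η := by nlinarith
      calc (3 / 16000 * ((a * 2 + 5) * η) + 4 * η) * t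
          ≤ (3 / 16000 * ((a * 2 + 5) * η) + 4 * η) * T := by gcongr
        _ ≤ (a + 5) * η * T := by gcongr
  intro i hi j hj t ht
  have := key (N + 1) le_rfl (k - (i + 1)) (by omega) j hj t ht
  rw [show k - (i + 1) + 1 = k - i by omega, show k - (k - i) = i by omega, Nat.sub_self] at this
  refine this.trans (le_of_eq ?_)
  have : T ^ k = T ^ (k - i) * T ^ i := by rw [← pow_add]; congr 1; omega
  rw [hη, this]
  field_simp
  norm_num

end RealRAM


/-! ### Running time -/

namespace RealRAM

/-- Started from a state with the contents of `s`, the program takes at most `c` time steps and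
`m` oracle calls. -/
def Prog.Takes (O : Oracle) (P : Prog) (s : State) (c m : ℕ) : Prop :=
  ∀ s' : State, s'.Same s →
    (P.run O s').time ≤ s'.time + c ∧ (P.run O s').evals ≤ s'.evals + m

theorem Prog.Takes.mono {O : Oracle} {P : Prog} {s : State} {c m c' m' : ℕ}
    (h : P.Takes O s c m) (hc : c ≤ c') (hm : m ≤ m') : P.Takes O s c' m' := fun s' hs => by
  have := h s' hs
  omega

theorem Prog.takes_cost (O : Oracle) (W : List ℕ) (P : Prog) (hW : P.wregs W = true)
    (hS : P.static W = true) (s : State) : P.Takes O s (P.cost O s) (P.calls s) := fun s' hs => by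
  have h1 := P.time_le_cost O hW hS s'
  have h2 := P.cost_congr O (s := s') (s' := s) (fun r _ => congrFun hs.1 r) hS
  rw [h2.1, h2.2] at h1
  exact h1

theorem Prog.takes_seq {O : Oracle} {P Q : Prog} {s : State} {c m c' m' : ℕ}
    (h : P.Takes O s c m) (h' : Q.Takes O (P.exec O s) c' m') :
    (P ;; Q).Takes O s (c + c') (m + m') := fun s' hs => by
  have h1 := h s' hs
  have h2 := h' _ (P.run_same_exec O s' s hs)
  simp only [run]
  omega

/-- Unlike the syntactic bound, this allows the cost to vary from round to round, with the invariant
following the clockless execution. Pieces have different numbers of nodes, so the loop over pieces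
needs it. -/
theorem Prog.takes_loop {O : Oracle} {r : ℕ} {e : IExp} {P : Prog} {s : State}
    (I : ℕ → State → Prop) (h0 : I 0 s) (c m : ℕ → ℕ)
    (hs : ∀ i < e.val s, ∀ s', I i s' →
      I (i + 1) (P.exec O (s'.setR r i)) ∧ P.Takes O (s'.setR r i) (c i) (m i)) :
    (Prog.loop r e P).Takes O s (e.cost + 1 + ∑ i ∈ Finset.range (e.val s), (1 + c i))
      (∑ i ∈ Finset.range (e.val s), m i) := by
  intro s' hss
  simp only [run, IExp.val_same hss e]
  generalize e.val s = q at *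
  have h2 : (s'.tick (e.cost + 1)).Same s := hss
  have h3 : (s'.tick (e.cost + 1)).time = s'.time + (e.cost + 1) := rfl
  have h4 : (s'.tick (e.cost + 1)).evals = s'.evals := rfl
  generalize s'.tick (e.cost + 1) = t at *
  rw [← add_assoc, ← h3, ← h4]
  suffices h : ∃ t', I q t' ∧ ((List.range q).foldl (fun s' i => P.run O
      { s'.tick 1 with regs := Function.update s'.regs r i }) t).Same t' ∧
      ((List.range q).foldl (fun s' i => P.run O
      { s'.tick 1 with regs := Function.update s'.regs r i }) t).time
        ≤ t.time + ∑ i ∈ Finset.range q, (1 + c i) ∧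
      ((List.range q).foldl (fun s' i => P.run O
      { s'.tick 1 with regs := Function.update s'.regs r i }) t).evals
        ≤ t.evals + ∑ i ∈ Finset.range q, m i by
    obtain ⟨_, -, -, h5, h6⟩ := h
    exact ⟨h5, h6⟩
  induction q with
  | zero => exact ⟨s, h0, h2, by simp, by simp⟩
  | succ q ih =>
    obtain ⟨t', i1, i2, i3, i4⟩ := ih fun i hi => hs i (by omega)
    simp only [List.range_succ, List.foldl_append, List.foldl_cons, List.foldl_nil,
      Finset.sum_range_succ]
    generalize (List.range q).foldl (fun s' i => P.run O
      { s'.tick 1 with regs := Function.update s'.regs r i }) t = w at *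
    obtain ⟨k1, k2⟩ := hs q (Nat.lt_succ_self q) t' i1
    have hsame : State.Same { w.tick 1 with regs := Function.update w.regs r q } (t'.setR r q) :=
      ⟨congrArg (fun f => Function.update f r q) i2.1, i2.2.1, i2.2.2⟩
    obtain ⟨k3, k4⟩ := k2 _ hsame
    refine ⟨_, k1, P.run_same_exec O _ _ hsame, k3.trans ?_, k4.trans ?_⟩
    · simp only [State.tick]; omega
    · simp only [State.tick]; omega

section cost

variable (O : Oracle) (s : State)

-- The cost is a structural recursion on a concrete text, so the constants here and below come out
-- by definitional unfolding.
set_option maxRecDepth 4000 in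
theorem heapProg_cost : heapProg.cost O s = 21 + 2 * s.regs 6 * 120 := by
  change 17 + (4 + 2 * s.regs 6 * 120) = _
  omega

set_option maxRecDepth 4000 in
theorem evalProg_cost : evalProg.cost O s
    = 4 + s.regs 7 * (15 + s.regs 7 * 12 + s.regs 6 * 403) := by
  change 2 + (2 + s.regs 7 * (1 + (2 + (2 + s.regs 7 * 12)
    + (2 + (2 + (2 + s.regs 6 * 403 + 4)))))) = _
  ring

set_option maxRecDepth 4000 in
theorem fitProg_cost : fitProg.cost O s
    = 4 + s.regs 7 * (15 + s.regs 7 * 12 + s.regs 6 * 428) := by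
  change 2 + (2 + s.regs 7 * (1 + (2 + (2 + s.regs 7 * 12)
    + (2 + (2 + (2 + s.regs 6 * 428 + 4)))))) = _
  ring

set_option maxRecDepth 4000 in
theorem intProg_cost : intProg.cost O s = 216 + (2 * s.regs 6 + s.regs 0) * 318 := by
  change 109 + (6 + (2 * s.regs 6 + s.regs 0) * 318 + 101) = _
  omega

set_option maxRecDepth 4000 in
theorem foldProg_cost : foldProg.cost O s
    = 53 + (2 * s.regs 6 + s.regs 0) * 39 + s.regs 0 * 74 + 2 * s.regs 6 * 33 := by
  change 8 + (2 * s.regs 6 + s.regs 0 + 1) * 39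
    + (2 + s.regs 0 * 74 + (4 + 2 * s.regs 6 * 33)) = _
  omega

set_option maxRecDepth 4000 in
theorem storeProg_cost : storeProg.cost O s = 4 + 2 * s.regs 6 * 61 := rfl

set_option maxRecDepth 4000 in
theorem askProg_cost : askProg.cost O s
    = 84 + s.regs 0 * s.regs 1 * 27 + (O.inSize + O.outSize) + s.regs 1 * 33 := by
  change 4 + s.regs 0 * s.regs 1 * 27
    + (57 + (20 + (O.inSize + O.outSize + 1) + (2 + s.regs 1 * 33))) = _
  omega

theorem dumpProg_cost : dumpProg.cost O s
    = 46 + (2 * s.regs 6 + s.regs 0) * s.regs 1 * 39 := by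
  change 8 + (2 * s.regs 6 + s.regs 0) * s.regs 1 * 39 + 38 = _
  omega

theorem sizeProg_cost : sizeProg.cost O s = 6 + s.regs 8 * 12 := by
  change 2 + (2 + (2 + s.regs 8 * 12)) = _
  omega

set_option maxRecDepth 4000 in
theorem coordProg_cost : coordProg.cost O s
    = 16 + (2 * s.regs 6 + s.regs 0 + 2) * 65 + s.regs 0 * (1 + (intProg.cost O s
      + (foldProg.cost O s + (evalProg.cost O s + storeProg.cost O s))))
      + (2 * s.regs 6 + s.regs 0) * 41 := by
  change 8 + (2 * s.regs 6 + s.regs 0 + 2) * 65 + (2 + s.regs 0 * (1 + (intProg.cost O s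
      + (foldProg.cost O s + (evalProg.cost O s + storeProg.cost O s))))
      + (6 + (2 * s.regs 6 + s.regs 0) * 41)) = _
  ring

set_option maxRecDepth 4000 in
theorem filterProg_cost : filterProg.cost O s
    = 8 + 2 * s.regs 6 * 137 + fitProg.cost O s := by
  change 4 + 2 * s.regs 6 * 45 + (fitProg.cost O s + (4 + 2 * s.regs 6 * 92)) = _
  ring

theorem mainProg_cost : mainProg.cost O s = 8 + heapProg.cost O s
    + s.regs 1 * (2 + coordProg.cost O s + filterProg.cost O s)
    + 2 * s.regs 6 * (1 + askProg.cost O s) + dumpProg.cost O s := by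
  change heapProg.cost O s + (2 + s.regs 1 * (1 + coordProg.cost O s) + (4 + 2 * s.regs 6 *
    (1 + askProg.cost O s) + (2 + s.regs 1 * (1 + filterProg.cost O s) + dumpProg.cost O s))) = _
  ring

theorem mainProg_calls : mainProg.calls s = 2 * s.regs 6 := by
  simp [Prog.calls, mainProg, heapProg, wr, nodesE, evalStep, fitStep, askProg, coordProg, intProg,
    intHead, intBody, intCoef, stepProg, foldProg, evalProg, powProg, storeProg, filterProg,
    fitProg, dumpProg]

theorem sizeProg_calls : sizeProg.calls s = 0 := by
  simp [Prog.calls, sizeProg]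

theorem startProg_cost : startProg.cost O s = 2 + s.regs 0 * (3 + s.regs 1 * 39) := by
  change 2 + s.regs 0 * (1 + (2 + s.regs 1 * 39)) = _
  ring

theorem startProg_calls : startProg.calls s = 0 := by
  simp [Prog.calls, startProg, wr]

theorem setupProg_cost : setupProg.cost O s = 34 + s.regs 2 * 6 := by
  change 2 + (2 + s.regs 2 * 6 + 30) = _
  ring

theorem setupProg_calls : setupProg.calls s = 0 := by
  simp [Prog.calls, setupProg]

end cost

/-- The transforms cost O(qm) for each of kd coordinates and integrations. The term quadratic in q,
from recomputing powers of two on each level, is absorbed by q ≤ 2m. -/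
theorem mainProg_cost_le (O : Oracle) (s : State) {k d q m : ℕ} (r0 : s.regs 0 = k)
    (r1 : s.regs 1 = d) (r6 : s.regs 6 = m) (r7 : s.regs 7 = q) (hi : O.inSize = k * d + 1)
    (ho : O.outSize = d) (hk : 1 ≤ k) (hd : 1 ≤ d) (hm : 1 ≤ m) (hq : 1 ≤ q) (hqm : q ≤ 2 * m) :
    mainProg.cost O s ≤ 4000 * (k * d * (q * (2 * m + k))) := by
  set W := q * (2 * m + k) with hW
  have w1 : 2 * m + k ≤ W := Nat.le_mul_of_pos_left _ hq
  have w2 : q * m ≤ W := Nat.mul_le_mul_left _ (by omega)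
  have eval_le : q * (15 + q * 12 + m * 428) ≤ 469 * (q * m) := by
    calc q * (15 + q * 12 + m * 428) ≤ q * (469 * m) := Nat.mul_le_mul_left _ (by omega)
      _ = 469 * (q * m) := by ring
  have eval_le' : q * (15 + q * 12 + m * 403) ≤ 469 * (q * m) :=
    le_trans (Nat.mul_le_mul_left _ (by omega)) eval_le
  have body : 1 + (intProg.cost O s
      + (foldProg.cost O s + (evalProg.cost O s + storeProg.cost O s))) ≤ 1400 * W := by
    rw [intProg_cost, foldProg_cost, evalProg_cost, storeProg_cost, r0, r6, r7]
    omega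
  have coord : 2 + coordProg.cost O s + filterProg.cost O s ≤ 2500 * (k * W) := by
    rw [coordProg_cost, filterProg_cost, fitProg_cost, r0, r6, r7]
    have h1 := Nat.mul_le_mul_left k body
    have h2 : W ≤ k * W := Nat.le_mul_of_pos_left _ hk
    have h3 : k * (1400 * W) = 1400 * (k * W) := by ring
    omega
  have kd : 1 ≤ k * d := Nat.mul_pos hk hd
  have dkd : d ≤ k * d := Nat.le_mul_of_pos_left _ hk
  have ask : 1 + askProg.cost O s ≤ 148 * (k * d) := by
    rw [askProg_cost, r0, r1, hi, ho]
    omega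
  rw [mainProg_cost, heapProg_cost, dumpProg_cost, r0, r1, r6]
  set V := k * d * W with hV
  have v1 : W ≤ V := Nat.le_mul_of_pos_left _ kd
  have v2 : d * (2500 * (k * W)) = 2500 * V := by rw [hV]; ring
  have v3 := Nat.mul_le_mul_left d coord
  have v4 := Nat.mul_le_mul_left (2 * m) ask
  have v5 : 2 * m * (148 * (k * d)) ≤ 148 * V := by
    calc 2 * m * (148 * (k * d)) = 148 * (k * d * (2 * m)) := by ring
      _ ≤ _ := Nat.mul_le_mul_left _ (Nat.mul_le_mul_left _ (by omega))
  have v6 : (2 * m + k) * d * 39 ≤ 39 * V := by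
    calc (2 * m + k) * d * 39 = 39 * (d * (2 * m + k)) := by ring
      _ ≤ _ := Nat.mul_le_mul_left _ (Nat.mul_le_mul dkd w1)
  omega

variable {E : Type*} [NormedAddCommGroup E] [NormedSpace ℝ E]

/-- The piece is cut where its size is known: registers `6` and `7` bound loops of `mainProg`, whose
cost is therefore evaluated in the state after `sizeProg`. -/
theorem pieceProg_takes {k d n N S R : ℕ} {D : ℕ → ℕ} {m : ℕ → ℝ} (e : Module.Basis (Fin d) ℝ E)
    (F : (Fin k → E) → ℝ → E) (s : State) {j : ℕ} (lay : Layout s k d n N S R D m)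
    (h9 : s.regs 9 = j) (hj : j < n) (hk : 1 ≤ k) (hd : 1 ≤ d) {Q : ℕ}
    (hQ : Nat.clog 2 (D j) + 1 ≤ Q) :
    pieceProg.Takes (odeOracle e F) s (16100 * (k * d * (Q * (k + D j)))) (4 * (1 + D j)) := by
  set O := odeOracle e F with hO
  set s1 := (s.setR 8 (D j)) with hs1
  set s2 := sizeProg.exec O s1 with hs2
  have e1 : (Prog.setReg 8 (.mem (.reg 9))).exec O s = s1 := by
    rw [exec_setReg, hs1, IExp.val_mem, IExp.val_reg, h9, lay.deg j hj]
  obtain ⟨z6, z7, f2⟩ := sizeProg_spec O s1 (D := D j) (by simp [hs1, setR_regs])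
  rw [← hs2] at z6 z7 f2
  have t1 := Prog.takes_cost O [8] (.setReg 8 (.mem (.reg 9))) rfl rfl s
  have t2 := Prog.takes_cost O [6, 7, 13] sizeProg rfl rfl s1
  have t3 := Prog.takes_cost O [11, 12, 13, 14, 15, 16, 17, 18, 19, 20] mainProg rfl rfl s2
  have t := Prog.takes_seq t1 (by rw [e1]; exact Prog.takes_seq t2 t3)
  have hM := two_pow_clog_le (D j)
  set a := Nat.clog 2 (D j) with ha
  refine t.mono ?_ ?_
  · have c1 : Prog.cost O s (.setReg 8 (.mem (.reg 9))) = 3 := rfl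
    have c3 := mainProg_cost_le O s2 (k := k) (d := d)
      (by rw [f2.regs 0 (by simp)]; simp [hs1, setR_regs, lay.r0])
      (by rw [f2.regs 1 (by simp)]; simp [hs1, setR_regs, lay.r1]) z6 z7 rfl rfl hk hd
      Nat.one_le_two_pow (by omega)
      (by have := Nat.lt_two_pow_self (n := a); omega)
    rw [c1, sizeProg_cost]
    have r8 : s1.regs 8 = D j := by simp [hs1, setR_regs]
    rw [r8]
    have w1 : (a + 1) * (2 * 2 ^ a + k) ≤ Q * (4 * (k + D j)) := Nat.mul_le_mul hQ (by omega)
    have w2 : k * d * ((a + 1) * (2 * 2 ^ a + k)) ≤ 4 * (k * d * (Q * (k + D j))) := by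
      calc _ ≤ k * d * (Q * (4 * (k + D j))) := Nat.mul_le_mul_left _ w1
        _ = _ := by ring
    have w3 : k + D j ≤ k * d * (Q * (k + D j)) :=
      (Nat.le_mul_of_pos_left _ (show 0 < Q by omega)).trans
        (Nat.le_mul_of_pos_left _ (Nat.mul_pos hk hd))
    omega
  · rw [sizeProg_calls, mainProg_calls, z6]
    simp only [Prog.calls]
    omega

theorem passProg_takes {k d n N S R : ℕ} {D : ℕ → ℕ} {m : ℕ → ℝ} (e : Module.Basis (Fin d) ℝ E)
    (F : (Fin k → E) → ℝ → E) (s : State) (lay : Layout s k d n N S R D m)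
    (hR : R = n + 1 + k * d + (k * d + 1) + d)
    (hM : ∀ j < n, (2 ^ (Nat.clog 2 (D j) + 1) + k) * d ≤ S) (hk : 1 ≤ k) (hd : 1 ≤ d)
    (hn : 1 ≤ n) {Q : ℕ} (hQ : ∀ j < n, Nat.clog 2 (D j) + 1 ≤ Q) :
    passProg.Takes (odeOracle e F) s
      (16200 * (k * d * (Q * ∑ j ∈ Finset.range n, (k + D j))))
      (4 * ∑ j ∈ Finset.range n, (1 + D j)) := by
  set O := odeOracle e F with hO
  set s1 := startProg.exec O s with hs1
  have r5 := lay.r5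
  obtain ⟨-, f⟩ := startProg_spec O s lay.r0 lay.r1 lay.r2 (by omega)
  rw [← hs1] at f
  have t1 := Prog.takes_cost O [11, 12] startProg rfl rfl s
  have hlay1 : Layout s1 k d n N S R D m := by
    refine ⟨?_, ?_, ?_, ?_, ?_, ?_, ?_, ?_⟩
    · rw [f.regs 0 (by simp), lay.r0]
    · rw [f.regs 1 (by simp), lay.r1]
    · rw [f.regs 2 (by simp), lay.r2]
    · rw [f.regs 3 (by simp), lay.r3]
    · rw [f.regs 4 (by simp), lay.r4]
    · rw [f.regs 5 (by simp), lay.r5]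
    · intro i hi; rw [f.ints, lay.deg i hi]
    · intro a ha; rw [f.low a (by omega), lay.low a ha]
  have t2 := Prog.takes_loop (O := O) (r := 9) (e := .reg 2) (P := pieceProg) (s := s1)
    (fun _ s' => Layout s' k d n N S R D m) hlay1
    (fun j => 16100 * (k * d * (Q * (k + D j)))) (fun j => 4 * (1 + D j)) (by
      intro j hj s' h1
      rw [IExp.val_reg, hlay1.r2] at hj
      have hreg : ∀ r < 9, (s'.setR 9 j).regs r = s'.regs r := fun r hr => by
        rw [setR_regs, if_neg (by omega)]
      have lay' : Layout (s'.setR 9 j) k d n N S R D m :=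
        ⟨by rw [hreg 0 (by simp), h1.r0], by rw [hreg 1 (by simp), h1.r1],
          by rw [hreg 2 (by simp), h1.r2], by rw [hreg 3 (by simp), h1.r3],
          by rw [hreg 4 (by simp), h1.r4], by rw [hreg 5 (by simp), h1.r5], h1.deg, h1.low⟩
      exact ⟨(pieceProg_spec e F _ lay' (by simp [setR_regs]) hR hj (hM j hj)).1,
        pieceProg_takes e F _ lay' (by simp [setR_regs]) hj hk hd (hQ j hj)⟩)
  rw [IExp.val_reg, hlay1.r2] at t2
  refine (Prog.takes_seq t1 t2).mono ?_ ?_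
  · rw [startProg_cost, lay.r0, lay.r1, Finset.sum_add_distrib, ← Finset.mul_sum, ← Finset.mul_sum,
      ← Finset.mul_sum]
    simp only [Finset.sum_const, Finset.card_range, smul_eq_mul, mul_one]
    have hQ0 : 0 < Q := by have := hQ 0 hn; omega
    have hkd : 0 < k * d := Nat.mul_pos hk hd
    have h1 : n ≤ ∑ j ∈ Finset.range n, (k + D j) := by
      calc n = ∑ j ∈ Finset.range n, 1 := by simp
        _ ≤ _ := Finset.sum_le_sum fun j _ => by omega
    set G := ∑ j ∈ Finset.range n, (k + D j) with hG
    have h2 : G ≤ Q * G := Nat.le_mul_of_pos_left _ hQ0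
    have h3 : Q * G ≤ k * d * (Q * G) := Nat.le_mul_of_pos_left _ hkd
    have h4 : k * d ≤ k * d * (Q * G) := Nat.le_mul_of_pos_right _ (by omega)
    have h5 : k ≤ k * d := Nat.le_mul_of_pos_right _ hd
    have h6 : k * (3 + d * 39) = 3 * k + 39 * (k * d) := by ring
    have h7 : IExp.cost (.reg 2) = 1 := rfl
    omega
  · rw [startProg_calls, ← Finset.mul_sum]
    omega

end RealRAM


/-! ### Total running time and the final assembly -/

namespace RealRAM

variable {E : Type*} [NormedAddCommGroup E] [NormedSpace ℝ E]

/-- N + 2 ≤ 2 (N + 1) passes double the constant 16200; the remainder up to 33000 pays for setup and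
loop overhead. A single logarithm, of the sum of the degrees, serves all pieces. -/
theorem solver_takes {k d n N : ℕ} (e : Module.Basis (Fin d) ℝ E) (F : (Fin k → E) → ℝ → E)
    (v : Fin k → E) (τ : Fin (n + 1) → ℝ) (D : Fin n → ℕ) (hk : 1 ≤ k) (hd : 1 ≤ d) (hn : 1 ≤ n) :
    solver.Takes (odeOracle e F) (odeInput e v τ D N)
      (33000 * (N + 1) * ((Nat.clog 2 (∑ j, D j) + 1) * (k * d * ∑ j, (k + D j))))
      (8 * (N + 1) * ∑ j, (1 + D j)) := by
  set O := odeOracle e F with hO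
  set s0 := odeInput e v τ D N with hs0
  have hsum : ∀ G : ℕ → ℕ, ∑ j ∈ Finset.range n, G (s0.ints j) = ∑ j, G (D j) := by
    intro G
    rw [Finset.sum_range]
    refine Finset.sum_congr rfl fun j _ => ?_
    simp [hs0, odeInput]
  obtain ⟨-, lay⟩ := setupProg_spec O s0 (k := k) (d := d) (n := n) (N := N)
    (by simp [hs0, odeInput]) (by simp [hs0, odeInput]) (by simp [hs0, odeInput])
    (by simp [hs0, odeInput])
  set s1 := setupProg.exec O s0 with hs1
  set S := (4 * (∑ i ∈ Finset.range n, s0.ints i) + k + 4) * d with hS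
  set R := n + 1 + k * d + (k * d + 1) + d with hR
  set D' := s0.ints with hD'
  have hle : ∀ j < n, D' j ≤ ∑ i ∈ Finset.range n, D' i := fun j hj =>
    Finset.single_le_sum (f := D') (fun _ _ => Nat.zero_le _) (Finset.mem_range.2 hj)
  have hM : ∀ j < n, (2 ^ (Nat.clog 2 (D' j) + 1) + k) * d ≤ S := by
    intro j hj
    refine Nat.mul_le_mul_right _ ?_
    have h1 := two_pow_clog_le (D' j)
    have h2 := hle j hj
    rw [pow_succ]
    change _ ≤ 4 * (∑ i ∈ Finset.range n, D' i) + k + 4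
    omega
  set Q := Nat.clog 2 (∑ i ∈ Finset.range n, D' i) + 1 with hQ
  have hQ' : ∀ j < n, Nat.clog 2 (D' j) + 1 ≤ Q := fun j hj =>
    Nat.succ_le_succ (Nat.clog_mono_right 2 (hle j hj))
  have t1 := Prog.takes_cost O [4, 5, 8, 9] setupProg rfl rfl s0
  have t2 := Prog.takes_loop (O := O) (r := 10) (e := .reg 3 + 2) (P := passProg) (s := s1)
    (fun _ s' => Layout s' k d n N S R D' s0.reals) lay
    (fun _ => 16200 * (k * d * (Q * ∑ j ∈ Finset.range n, (k + D' j))))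
    (fun _ => 4 * ∑ j ∈ Finset.range n, (1 + D' j)) (by
      intro q _ s' h1
      have hreg : ∀ r < 9, (s'.setR 10 q).regs r = s'.regs r := fun r hr => by
        rw [setR_regs, if_neg (by omega)]
      have lay' : Layout (s'.setR 10 q) k d n N S R D' s0.reals :=
        ⟨by rw [hreg 0 (by simp), h1.r0], by rw [hreg 1 (by simp), h1.r1],
          by rw [hreg 2 (by simp), h1.r2], by rw [hreg 3 (by simp), h1.r3],
          by rw [hreg 4 (by simp), h1.r4], by rw [hreg 5 (by simp), h1.r5], h1.deg, h1.low⟩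
      exact ⟨(passProg_spec e F _ lay' hR hM).1, passProg_takes e F _ lay' hR hM hk hd hn hQ'⟩)
  have hv : (IExp.reg 3 + 2 : IExp).val s1 = N + 2 := by simp [lay.r3]
  rw [hv] at t2
  have t3 := Prog.takes_cost O [0] (.setReg 0 (.reg 2)) rfl rfl
    ((Prog.loop 10 (.reg 3 + 2) passProg).exec O s1)
  have t := Prog.takes_seq t1 (Prog.takes_seq t2 t3)
  refine t.mono ?_ ?_
  · have c1 : (IExp.reg 3 + 2 : IExp).cost = 3 := rfl
    have c2 : Prog.cost O ((Prog.loop 10 (.reg 3 + 2) passProg).exec O s1)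
      (.setReg 0 (.reg 2)) = 2 := rfl
    have r2 : s0.regs 2 = n := by simp [hs0, odeInput]
    rw [setupProg_cost, c1, c2, r2, ← hsum fun i => i, ← hsum fun i => k + i, ← hQ]
    simp only [Finset.sum_const, Finset.card_range, smul_eq_mul]
    have h1 : n ≤ ∑ j ∈ Finset.range n, (k + D' j) := by
      calc n = ∑ j ∈ Finset.range n, 1 := by simp
        _ ≤ _ := Finset.sum_le_sum fun j _ => by omega
    set G := ∑ j ∈ Finset.range n, (k + D' j) with hG
    have h2 : G ≤ Q * G := Nat.le_mul_of_pos_left _ (by omega)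
    have h3 : Q * G ≤ k * d * (Q * G) := Nat.le_mul_of_pos_left _ (Nat.mul_pos hk hd)
    have h4 : Q * (k * d * G) = k * d * (Q * G) := by ring
    rw [h4]
    set V := k * d * (Q * G) with hV
    have h5 : V ≤ (N + 1) * V := Nat.le_mul_of_pos_left _ (by omega)
    have h6 : (N + 2) * (1 + 16200 * V) = 16200 * ((N + 1) * V) + 16200 * V + N + 2 := by ring
    have h7 : 33000 * (N + 1) * V = 33000 * ((N + 1) * V) := by ring
    have h8 : N + 1 ≤ (N + 1) * V := Nat.le_mul_of_pos_right _ (by omega)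
    omega
  · have c2 : Prog.calls ((Prog.loop 10 (.reg 3 + 2) passProg).exec O s1)
      (.setReg 0 (.reg 2)) = 0 := rfl
    rw [setupProg_calls, c2, ← hsum fun i => 1 + i]
    simp only [Finset.sum_const, Finset.card_range, smul_eq_mul]
    set G := ∑ j ∈ Finset.range n, (1 + D' j)
    have h1 : 8 * (N + 1) * G = (N + 2) * (4 * G) + N * (4 * G) := by ring
    omega

/-- If the binary logarithm rounds up to a + 1, then 2^a < m, so a is at most log (2 + f) / log 2.
The additive constants are absorbed by log (2 + f) ≥ log 3 > 1. -/
theorem clog_le_log {m : ℕ} {f : ℝ} (hf : 1 ≤ f) (hm : (m : ℝ) ≤ f) :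
    ((Nat.clog 2 m + 1 : ℕ) : ℝ) ≤ 4 * Real.log (2 + f) := by
  have hlog1 : 1 ≤ Real.log (2 + f) := by
    rw [Real.le_log_iff_exp_le (by linarith)]
    linarith [Real.exp_one_lt_d9]
  rcases Nat.lt_or_ge 1 m with h | h
  · have h1 := Nat.pow_pred_clog_lt_self (b := 2) (by norm_num) h
    have h2 : 0 < Nat.clog 2 m := Nat.clog_pos (by norm_num) h
    obtain ⟨a, ha⟩ := Nat.exists_eq_add_of_le' h2
    rw [ha] at h1 ⊢
    simp only [Nat.pred_succ] at h1
    have h3 : (2 : ℝ) ^ a ≤ 2 + f := by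
      have : ((2 ^ a : ℕ) : ℝ) ≤ m := by exact_mod_cast h1.le
      push_cast at this
      linarith
    have h4 := Real.log_le_log (by positivity) h3
    rw [Real.log_pow] at h4
    have h5 := Real.log_two_gt_d9
    have ha0 : (0 : ℝ) ≤ a := Nat.cast_nonneg a
    push_cast
    nlinarith
  · rw [Nat.clog_of_right_le_one h]
    push_cast
    linarith

theorem derivChain_of_isODESolution {k : ℕ} {F : (Fin k → E) → ℝ → E} {v : Fin k → E} {T : ℝ}
    {x : ℝ → E} (hx : IsODESolution F v T x) :
    DerivChain k T (fun i => iteratedDerivWithin i x (Icc 0 T)) := fun i hi t ht => by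
  simp only [iteratedDerivWithin_succ]
  exact (hx.differentiableOn i hi t ht).hasDerivWithinAt

theorem PicardStep.iteratedDeriv_eq {k n : ℕ} {F : (Fin k → E) → ℝ → E} {v : Fin k → E}
    {τ : ℕ → ℝ} {h : ℕ → ℕ} {y y' : ℕ → ℝ → E} {X : ℕ → ℕ → ℝ → E}
    (P : PicardStep F v n τ h y y' X) {j : ℕ} (hj : j < n) :
    ∀ i ≤ k, iteratedDeriv i (X j k) = X j (k - i) := by
  intro i
  induction i with
  | zero => intro _; rw [iteratedDeriv_zero, Nat.sub_zero]
  | succ i ih =>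
    intro hi
    rw [iteratedDeriv_succ, ih (by omega)]
    funext t
    have := P.deriv j hj (k - (i + 1)) (by omega) t
    rw [show k - (i + 1) + 1 = k - i by omega] at this
    exact this.deriv

end RealRAM

open RealRAM in
theorem mainTheorem3 :
    -- one program and absolute constants, for all problems
    ∃ (P : RealRAM.Prog) (K p : ℕ),
      ∀ (k d n : ℕ), 1 ≤ k → 1 ≤ d → 1 ≤ n →
      -- a `d`-dimensional space, with any norm, in coordinates
      ∀ (E : Type*) [NormedAddCommGroup E] [NormedSpace ℝ E] (e : Module.Basis (Fin d) ℝ E)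
        (F : (Fin k → E) → ℝ → E) (v : Fin k → E) (x : ℝ → E)
        (τ : Fin (n + 1) → ℝ) (D : Fin n → ℕ) (T ε : ℝ) (L : Fin k → ℝ) (N : ℕ),
      StrictMono τ → τ 0 = 0 → τ (Fin.last n) = T → 0 < ε →
      IsODESolution F v T x →
      -- the `k`-th derivative of the solution is `ε / T ^ k`-close to a piecewise polynomial
      (∃ q : Fin n → ℕ → E, ∀ j : Fin n, ∀ t ∈ Ioo (τ j.castSucc) (τ j.succ),
        ‖∑ l ∈ Finset.range (D j + 1), t ^ l • q j l
          - iteratedDerivWithin k x (Icc 0 T) t‖ ≤ ε / T ^ k) →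
      -- `F` is Lipschitz, with constant `L i` in the argument for the `i`-th derivative
      (∀ i, 0 ≤ L i) →
      (∀ t ∈ Icc 0 T, ∀ y z : Fin k → E, ‖F y t - F z t‖ ≤ ∑ i, L i * ‖y i - z i‖) →
      (∑ i : Fin k, L i ^ ((1 : ℝ) / ((k : ℝ) - (i : ℕ)))) * T ≤ 1 / 16000 →
      -- `N` is at least the binary logarithm of `C / ε`
      ENNReal.ofReal (T ^ (k - 1)) * (∫⁻ s in Icc 0 T, ‖F v s‖ₑ)
        + ENNReal.ofReal (∑ i : Fin k, if (i : ℕ) = 0 then 0 else T ^ (i : ℕ) * ‖v i‖)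
        ≤ ENNReal.ofReal (2 ^ N * ε) →
      let s := P.run (odeOracle e F) (odeInput e v τ D N)
      let f : ℝ := k * d * ∑ j, ((k : ℝ) + D j)
      -- number of evaluations of `F` and running time
      s.evals ≤ K * (N + 1) * ∑ j, (1 + D j) ∧
      (s.time : ℝ) ≤ K * (N + 1) * (f * Real.log (2 + f) ^ p) ∧
      -- size and accuracy of the piecewise polynomial
      ∀ j : Fin n, outputSize s j ≤ K * (k + D j) ∧
        ∀ i < k, ∀ t ∈ Icc (τ j.castSucc) (τ j.succ),
          ‖iteratedDeriv i (outputPiece e s (τ j.castSucc) (τ j.succ) j) t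
            - iteratedDerivWithin i x (Icc 0 T) t‖ ≤ K * (ε / T ^ i) := by
  -- The running time dictates K: 33000 from the step count times 4 from `clog_le_log`, rounded up
  -- generously. The tree transforms contribute a single logarithm, so p = 1.
  refine ⟨solver, 200000, 1, ?_⟩
  intro k d n hk hd hn E _ _ e F v x τ D T ε L N hτ hτ0 hτT hε hx hq hL hlip hLT hC s f
  have hsame := solver.run_same_exec (odeOracle e F) (odeInput e v τ D N) (odeInput e v τ D N)
    ⟨rfl, rfl, rfl⟩
  have htime := solver_takes e F v τ D (N := N) hk hd hn (odeInput e v τ D N) ⟨rfl, rfl, rfl⟩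
  have hs0 : (odeInput e v τ D N).time = 0 ∧ (odeInput e v τ D N).evals = 0 := ⟨rfl, rfl⟩
  rw [hs0.1, hs0.2, zero_add, zero_add] at htime
  obtain ⟨h, τ', y, X, hh, hτ', hy, hP, hout⟩ := solver_spec (N := N) e F v τ hτ D
  have hf : f = ((k * d * ∑ j, (k + D j) : ℕ) : ℝ) := by simp [f]
  have hsum : ∑ j, D j ≤ k * d * ∑ j, (k + D j) :=
    (Finset.sum_le_sum fun j _ => Nat.le_add_left _ _).trans
      (Nat.le_mul_of_pos_left _ (Nat.mul_pos hk hd))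
  have hf1 : 1 ≤ f := by
    rw [hf]
    have h1 : 1 ≤ ∑ j, (k + D j) :=
      le_trans (by omega : 1 ≤ k + D ⟨0, hn⟩)
        (Finset.single_le_sum (f := fun j => k + D j) (fun _ _ => Nat.zero_le _)
          (Finset.mem_univ _))
    exact_mod_cast Nat.mul_pos (Nat.mul_pos hk hd) h1
  refine ⟨htime.2.trans ?_, ?_, ?_⟩
  · gcongr
    norm_num
  · have h1 : (s.time : ℝ) ≤ ((33000 * (N + 1) *
        ((Nat.clog 2 (∑ j, D j) + 1) * (k * d * ∑ j, (k + D j))) : ℕ) : ℝ) := by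
      exact_mod_cast htime.1
    refine h1.trans ?_
    have h2 := clog_le_log hf1 (m := ∑ j, D j) (by rw [hf]; exact_mod_cast hsum)
    have h3 : ((33000 * (N + 1) *
        ((Nat.clog 2 (∑ j, D j) + 1) * (k * d * ∑ j, (k + D j))) : ℕ) : ℝ)
        = 33000 * (N + 1) * (((Nat.clog 2 (∑ j, D j) + 1 : ℕ) : ℝ) * f) := by
      rw [hf]; push_cast; ring
    rw [h3, pow_one]
    have hlog : 0 ≤ Real.log (2 + f) := Real.log_nonneg (by linarith)
    calc _ ≤ 33000 * ((N : ℝ) + 1) * (4 * Real.log (2 + f) * f) := by gcongr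
      _ = 132000 * (((N : ℝ) + 1) * (f * Real.log (2 + f))) := by ring
      _ ≤ 200000 * (((N : ℝ) + 1) * (f * Real.log (2 + f))) := by gcongr; norm_num
      _ = _ := by push_cast; ring
  -- Completeness is needed for the integral in the a priori bound.
  · have : FiniteDimensional ℝ E := Module.Basis.finiteDimensional_of_finite e
    have : CompleteSpace E := FiniteDimensional.complete ℝ E
    have hτj : ∀ j : Fin n, τ' j = τ j.castSucc ∧ τ' (j + 1) = τ j.succ := fun j =>
      ⟨by simpa using hτ' j.castSucc, by simpa using hτ' j.succ⟩
    have key := picard_close (N := N) hk hn hy hP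
      (fun j hj => by
        obtain ⟨a1, a2⟩ := hτj ⟨j, hj⟩
        simp only at a1 a2
        rw [a1, a2]
        exact hτ Fin.castSucc_lt_succ)
      (by have := hτ' 0; rw [hτ0] at this; exact this)
      (by have := hτ' (Fin.last n); rw [hτT] at this; exact this)
      (derivChain_of_isODESolution hx) hx.initial hL hx.ode hlip hLT hε
      (fun j hj => by
        obtain ⟨q, hq⟩ := hq
        obtain ⟨a1, a2⟩ := hτj ⟨j, hj⟩
        simp only at a1 a2
        rw [a1, a2]
        refine ⟨q ⟨j, hj⟩, D ⟨j, hj⟩, ?_, hq ⟨j, hj⟩⟩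
        have := hh ⟨j, hj⟩
        simp only at this
        rw [this]
        -- The degree is at most half the number of nodes, the range in which the filter is exact.
        exact Nat.le_pow_clog (by norm_num) _)
      hC
    intro j
    obtain ⟨o1, o2⟩ := hout j
    have hsz : outputSize s j
        = outputSize (solver.exec (odeOracle e F) (odeInput e v τ D N)) j := by
      simp only [outputSize, s, hsame.1, hsame.2.1]
    have hpc : outputPiece e s (τ j.castSucc) (τ j.succ) j = outputPiece e
        (solver.exec (odeOracle e F) (odeInput e v τ D N)) (τ j.castSucc) (τ j.succ) j := by
      funext t
      simp only [outputPiece, hsz, vecAt, s, hsame.1, hsame.2.1, hsame.2.2]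
    refine ⟨?_, fun i hi t ht => ?_⟩
    · rw [hsz, o1, hh, pow_succ]
      have := two_pow_clog_le (D j)
      omega
    · rw [hpc, o2, (hP (N + 1) (by omega)).iteratedDeriv_eq j.2 i hi.le]
      rw [← (hτj j).1, ← (hτj j).2] at ht
      refine (key i hi j j.2 t ht).trans ?_
      have hT : 0 < T := by
        rw [← hτ0, ← hτT]
        exact hτ (Fin.lt_def.2 (by simpa using Nat.pos_of_ne_zero (Nat.one_le_iff_ne_zero.1 hn)))
      gcongr
      norm_num
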